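/- Let $U=(a,b)$ be a bounded interval, $T>0$, $\beta\in\mathbb R$, $m\ge 5$ an integer and $V$ a real potential. Consider the Gross--Pitaevskii equation $$ i\,\partial_t\psi=-\tfrac12\,\partial_{xx}\psi+V(x)\psi+\beta|\psi|^2\psi,\quad x\in U,\qquad \psi(a,t)=\psi(b,t)=0,\qquad \psi(x,0)=\psi_0(x). $$ Put $\mu_l=l\pi/(b-a)$, $\hat\phi_l=\frac{2}{b-a}\int_a^b\phi(x)\sin(\mu_l(x-a))\,dx$, and let $H^k_{\sin}(U)$ be the space of all $\phi\in H^k(U)\cap H^1_0(U)$ with $\sum_{l\ge1}\mu_l^{2k}|\hat\phi_l|^2<\infty$. Assume that $$V\in H^m(U),\qquad \partial_xV\in H^{m-1}_{\sin}(U),$$ and that the equation has an exact solution $\psi\in C([0,T];H^m(U)\cap H_0^1(U))$ ($V$ and $\psi(\cdot,t)$ denote the continuous representatives on $[a,b]$). Let $M_1=\max_{t\in[0,T]}\|\psi(\cdot,t)\|_{L^\infty(U)}$. For an even positive integer $M$ let $h=(b-a)/M$, $x_j=a+jh$ ($0\le j\le M$), and for $v=(v_0,\dots,v_M)\in\mathbb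 C^{M+1}$ put $$\tilde v_l=\frac2M\sum_{j=1}^{M-1}v_j\sin\Big(\frac{jl\pi}{M}\Big),\qquad (I_Mv)(x)=\sum_{l=1}^{M-1}\tilde v_l\sin(\mu_l(x-a)).$$ For a time step $\tau>0$ let $t_n=n\tau$, and let $\psi^n=(\psi^n_j)_{0\le j\le M}$ be the approximation given by the Strang time-splitting sine pseudospectral method: $\psi^0_j=\psi_0(x_j)$ and, for $n\ge0$, $$\psi^{(1)}_j=\sum_{l=1}^{M-1}e^{-i\tau\mu_l^2/4}\,\widetilde{(\psi^n)}_l\sin(\mu_l(x_j-a)),\qquad \psi^{(2)}_j=e^{-i\tau(V(x_j)+\beta|\psi^{(1)}_j|^2)}\psi^{(1)}_j,$$ $$\psi^{n+1}_j=\sum_{l=1}^{M-1}e^{-i\tau\mu_l^2/4}\,\widetilde{(\psi^{(2)})}_l\sin(\mu_l(x_j-a)),$$ so that $\psi^{n+1}_0=\psi^{n+1}_M=0$. Then there exist constants $0<\tau_0,h_0\le1$ and $C>0$, with $C$ independent of $\tau$, $h$ and $n$, such that whenever $0<h\le h_0$ and $0<\tau\le\tau_0$ we have, for all integers $0\le n\le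 T/\tau$, $$\|\psi(\cdot,t_n)-I_M(\psi^n)\|_{L^2(U)}\le C(h^m+\tau^2),\qquad \|\partial_x(\psi(\cdot,t_n)-I_M(\psi^n))\|_{L^2(U)}\le C(h^{m-1}+\tau^2),$$ $$\max_{0\le j\le M}|\psi^n_j|\le M_1+1.$$ -/

import Mathlib

open Real Set Filter Topology MeasureTheory
open scoped ENNReal ContDiff

noncomputable section

/-! ### Sobolev spaces on a bounded interval `U = (a, b)` -/

/-- `g` is the `k`-th weak derivative of `u` on `(a, b)`: both are locally integrable and
`∫ u φ⁽ᵏ⁾ = (-1)ᵏ ∫ g φ` for every test function `φ ∈ C_c^∞((a, b))`. -/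
def HasWeakDeriv (a b : ℝ) (k : ℕ) (u g : ℝ → ℂ) : Prop :=
  LocallyIntegrableOn u (Ioo a b) ∧ LocallyIntegrableOn g (Ioo a b) ∧
    ∀ φ : ℝ → ℝ, ContDiff ℝ ∞ φ → HasCompactSupport φ → tsupport φ ⊆ Ioo a b →
      ∫ x in Ioo a b, ((iteratedDeriv k φ x : ℝ) : ℂ) * u x =
        (-1) ^ k * ∫ x in Ioo a b, ((φ x : ℝ) : ℂ) * g x

/-- The `L²(U)` norm. -/
def normL2 (a b : ℝ) (u : ℝ → ℂ) : ℝ≥0∞ := eLpNorm u 2 (volume.restrict (Ioo a b))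

/-- The `L^∞(U)` norm. -/
def normLinf (a b : ℝ) (u : ℝ → ℂ) : ℝ≥0∞ := eLpNorm u ∞ (volume.restrict (Ioo a b))

/-- The seminorm `‖∂ₓᵏ u‖_{L²(U)}`. Weak derivatives are unique almost everywhere, so the infimum
is over a single value; it is `∞` if the `k`-th weak derivative does not exist. -/
def semiH (a b : ℝ) (k : ℕ) (u : ℝ → ℂ) : ℝ≥0∞ :=
  ⨅ (g : ℝ → ℂ) (_ : HasWeakDeriv a b k u g), normL2 a b g

/-- The `H^m(U)` norm, `(∑_{k ≤ m} ‖∂ₓᵏ u‖²_{L²})^{1/2}`. -/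
def normH (a b : ℝ) (m : ℕ) (u : ℝ → ℂ) : ℝ≥0∞ :=
  (∑ k ∈ Finset.range (m + 1), semiH a b k u ^ 2) ^ (1 / 2 : ℝ)

/-- `u ∈ H^m(U)`. -/
def MemH (a b : ℝ) (m : ℕ) (u : ℝ → ℂ) : Prop :=
  ∀ k ≤ m, ∃ g : ℝ → ℂ, HasWeakDeriv a b k u g ∧ MemLp g 2 (volume.restrict (Ioo a b))

/-- `u ∈ H¹₀(U)`: `u ∈ H¹(U)` and the continuous representative of `u` on `[a, b]` vanishes
at both end points. -/
def MemH10 (a b : ℝ) (u : ℝ → ℂ) : Prop :=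
  MemH a b 1 u ∧ ∃ v : ℝ → ℂ, ContinuousOn v (Icc a b) ∧
    u =ᵐ[volume.restrict (Ioo a b)] v ∧ v a = 0 ∧ v b = 0

/-- The frequencies `μ_l = l π / (b - a)`. -/
def freq (a b : ℝ) (l : ℕ) : ℝ := l * π / (b - a)

/-- The sine coefficients `φ̂_l = 2 / (b - a) ∫_a^b φ(x) sin(μ_l (x - a)) dx`. -/
def sineCoeff (a b : ℝ) (φ : ℝ → ℂ) (l : ℕ) : ℂ :=
  2 / ((b : ℂ) - a) * ∫ x in Ioo a b, φ x * ((sin (freq a b l * (x - a)) : ℝ) : ℂ)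

/-- `φ ∈ H^m_sin(U)`: the functions `φ ∈ H^m(U) ∩ H¹₀(U)` for which
`∑_{l ≥ 1} μ_l^{2m} |φ̂_l|²` is finite. -/
def MemHsin (a b : ℝ) (m : ℕ) (φ : ℝ → ℂ) : Prop :=
  MemH a b m φ ∧ MemH10 a b φ ∧
    Summable fun l : ℕ => freq a b (l + 1) ^ (2 * m) * ‖sineCoeff a b φ (l + 1)‖ ^ 2

/-- `ψ ∈ C([0, T]; H^m(U) ∩ H¹₀(U))`, where `ψ t` is the function `x ↦ ψ(x, t)`. -/
def ContTimeH (a b T : ℝ) (m : ℕ) (ψ : ℝ → ℝ → ℂ) : Prop :=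
  (∀ t ∈ Icc 0 T, MemH a b m (ψ t) ∧ MemH10 a b (ψ t)) ∧
    ∀ s ∈ Icc 0 T, Tendsto (fun t => normH a b m (fun x => ψ t x - ψ s x)) (𝓝[Icc 0 T] s) (𝓝 0)

/-! ### The Gross-Pitaevskii equation -/

/-- `ψ` solves `i ∂ₜψ = -½ ∂ₓₓψ + V ψ + β |ψ|² ψ` for `a < x < b`, `0 < t < T`, with initial
value `ψ₀` and `ψ(a, t) = ψ(b, t) = 0`. -/
def IsGPESolution (a b T : ℝ) (V : ℝ → ℝ) (β : ℝ) (ψ₀ : ℝ → ℂ) (ψ : ℝ → ℝ → ℂ) : Prop :=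
  (∀ t ∈ Ioo 0 T, ∀ x ∈ Ioo a b, DifferentiableAt ℝ (fun s => ψ s x) t ∧
    Complex.I * deriv (fun s => ψ s x) t =
      -(1 / 2) * iteratedDeriv 2 (ψ t) x + V x * ψ t x + β * ‖ψ t x‖ ^ 2 * ψ t x) ∧
  (∀ x ∈ Icc a b, ψ 0 x = ψ₀ x) ∧
  (∀ t ∈ Icc 0 T, ψ t a = 0 ∧ ψ t b = 0)

/-! ### The time-splitting sine pseudospectral method -/

/-- The mesh size `h = (b - a) / M`. -/
def mesh (a b : ℝ) (M : ℕ) : ℝ := (b - a) / M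

/-- The grid points `x_j = a + j h`, `0 ≤ j ≤ M`. -/
def gridPt (a b : ℝ) (M : ℕ) (j : Fin (M + 1)) : ℝ := a + (j : ℕ) * mesh a b M

/-- The discrete sine transform `ṽ_l = (2 / M) ∑_{j=1}^{M-1} v_j sin(j l π / M)`. -/
def dst (M : ℕ) (v : Fin (M + 1) → ℂ) (l : ℕ) : ℂ :=
  2 / (M : ℂ) * ∑ j ∈ Finset.Ioo (0 : Fin (M + 1)) (Fin.last M),
    v j * ((sin ((j : ℕ) * l * π / M) : ℝ) : ℂ)

/-- The sine interpolation operator `(I_M v)(x) = ∑_{l=1}^{M-1} ṽ_l sin(μ_l (x - a))`. -/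
def sineInterp (a b : ℝ) (M : ℕ) (v : Fin (M + 1) → ℂ) (x : ℝ) : ℂ :=
  ∑ l ∈ Finset.Ioo 0 M, dst M v l * ((sin (freq a b l * (x - a)) : ℝ) : ℂ)

/-- The exact flow of `i ψ_t = -½ ψ_xx` over time `τ / 2` in the sine basis, on the grid:
`v ↦ (∑_{l=1}^{M-1} e^{-i τ μ_l² / 4} ṽ_l sin(μ_l (x_j - a)))_j`. -/
def kineticHalfStep (a b : ℝ) (M : ℕ) (τ : ℝ) (v : Fin (M + 1) → ℂ) : Fin (M + 1) → ℂ :=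
  fun j => ∑ l ∈ Finset.Ioo 0 M, Complex.exp (-Complex.I * τ * (freq a b l : ℂ) ^ 2 / 4) *
    dst M v l * ((sin (freq a b l * (gridPt a b M j - a)) : ℝ) : ℂ)

/-- The exact flow of `i ψ_t = (V + β |ψ|²) ψ` over time `τ` on the grid. -/
def potentialStep (a b : ℝ) (V : ℝ → ℝ) (β : ℝ) (M : ℕ) (τ : ℝ) (v : Fin (M + 1) → ℂ) :
    Fin (M + 1) → ℂ :=
  fun j => Complex.exp (-Complex.I * ((V (gridPt a b M j) + β * ‖v j‖ ^ 2 : ℝ) : ℂ) * τ) * v j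

/-- The numerical solution `ψⁿ = (ψⁿ_j)_{0 ≤ j ≤ M}` of the Strang splitting sine pseudospectral
method with time step `τ`, started from `ψ⁰_j = ψ₀(x_j)`. -/
def tssp (a b : ℝ) (V : ℝ → ℝ) (β : ℝ) (ψ₀ : ℝ → ℂ) (M : ℕ) (τ : ℝ) : ℕ → Fin (M + 1) → ℂ
  | 0 => fun j => ψ₀ (gridPt a b M j)
  | n + 1 => kineticHalfStep a b M τ
      (potentialStep a b V β M τ (kineticHalfStep a b M τ (tssp a b V β ψ₀ M τ n)))

/-- Kinetic half steps satisfy the discrete boundary condition `ψ_0 = ψ_M = 0`. -/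
theorem kineticHalfStep_boundary {a b : ℝ} (hab : a < b) {M : ℕ} (hM : 0 < M) (τ : ℝ)
    (v : Fin (M + 1) → ℂ) :
    kineticHalfStep a b M τ v 0 = 0 ∧ kineticHalfStep a b M τ v (Fin.last M) = 0 := by
  have hM' : (M : ℝ) ≠ 0 := by exact_mod_cast hM.ne'
  have hb : b - a ≠ 0 := sub_ne_zero.2 hab.ne'
  constructor
  · simp [kineticHalfStep, gridPt]
  · unfold kineticHalfStep
    refine Finset.sum_eq_zero fun l _ => ?_
    have : freq a b l * (gridPt a b M (Fin.last M) - a) = l * π := by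
      simp only [freq, gridPt, mesh, Fin.val_last]
      field_simp
      ring
    rw [this, Real.sin_nat_mul_pi]
    simp

end

/-! ### Weighted square-summable sequences -/

/-! Odd reflection about the end points turns the Dirichlet problem into a periodic one. A function
is recorded by the Fourier coefficients `oddCoeff` of its odd extension, a grid function by
`gridCoeff`, and `gridCoeff_step` identifies one time step of the scheme with `numStep`: a
unimodular multiplier, the potential flow applied pointwise on `2M` equispaced points of the circle,
a truncated discrete transform, and the multiplier again. All errors are measured in the weighted
`ℓ²` spaces `SobLE s`, which are algebras under convolution for `s ≥ 1`.

Regularity. The odd extension of an `H^m` function has `m` derivatives in `L²` only if its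
derivatives of even order below `m` vanish at both end points. The equation enforces this. If a
derivative of even order had a nonzero boundary value, then suitably weighted coefficients would
have a time derivative tending to a nonzero boundary term, although the weighted coefficients
themselves tend to zero at all times (`GPECurve.boundary_combination`, `GPECurve.boundary_zero`).
The nonlinear term keeps the odd symmetry because the assumption on the derivative of `V` gives the
potential an even extension of order `m` (`exists_potential_coeff`). Thus `GPECurve.famBdd` bounds
the coefficients of the solution at order `m ≥ 5`, uniformly in time. Each time derivative costs two
space derivatives, so the nonlinear term `F` is bounded at order 5, Lipschitz in time at order 3,
and has second time differences `O(σ²)` at order 1 (`time_regularity`).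

Local error. Both flows are expanded symmetrically about their midpoints, with `σ = τ/2`. After
conjugation by the free flow, the exact increment is `-2iσF` at the midpoint up to `O(σ³)`
(`midpoint_error`). The increment of the potential flow is `-2iσ` times the nonlinearity at the
flow's own midpoint, again up to `O(σ³)` (`exists_nstep_symm_onePt`). The two midpoint states agree
up to `O(σ² + ε)`, where `ε = M^{i-m}` is the aliasing error, because their first order terms cancel
(`half_step_error`, `exists_nstep_taylor_onePt`). So the defect is `O(τ(τ² + ε))` in the norms of
order `i = 0, 1` (`symmetric_defect_le`).

Stability. Discrete `L²` and `H¹` norms on the grid are compared with the coefficient norms of order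
0 and 1 through orthogonality of the oscillations and Jordan's inequality. Second difference bounds
for the potential flow show that one step amplifies errors by at most `1 + Cτ`; they need bounded
grid increments of the exact solution only, and merely a sup bound for the numerical one
(`gsob_sub_le_of_twoPt`). That sup bound follows from the `H¹` error at the same time level and the
embedding into `ℓ¹`, so the induction in `fourier_convergence` closes for small `τ` and `h`.
Parseval's identity then gives the two norms on the interval, and the embedding gives the maximum
bound on the grid. -/

/-- The weight `1 + |k|`. -/
noncomputable def wt (k : ℤ) : ℝ := 1 + |(k : ℝ)|

theorem one_le_wt (k : ℤ) : 1 ≤ wt k := by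
  have := abs_nonneg (k : ℝ)
  unfold wt; linarith

theorem wt_pos (k : ℤ) : 0 < wt k := lt_of_lt_of_le one_pos (one_le_wt k)

theorem wt_neg (k : ℤ) : wt (-k) = wt k := by simp [wt]

theorem abs_le_wt (k : ℤ) : |(k : ℝ)| ≤ wt k := by unfold wt; linarith

theorem wt_add_le (j k : ℤ) : wt (j + k) ≤ wt j + wt k := by
  have := abs_add_le (j : ℝ) k
  unfold wt; push_cast; linarith

/-- In a convolution the output frequency is `k = j + (k - j)`; subadditivity of the weight and
convexity of the power let either factor absorb all `s` derivatives. -/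
theorem wt_pow_le (s : ℕ) (j k : ℤ) : wt k ^ s ≤ 2 ^ s * (wt j ^ s + wt (k - j) ^ s) := by
  have h1 : wt k ≤ wt j + wt (k - j) := by simpa using wt_add_le j (k - j)
  have h2 := add_pow_le (wt_pos j).le (wt_pos (k - j)).le s
  calc wt k ^ s ≤ (wt j + wt (k - j)) ^ s := pow_le_pow_left₀ (wt_pos k).le h1 s
    _ ≤ 2 ^ (s - 1) * (wt j ^ s + wt (k - j) ^ s) := h2
    _ ≤ _ := by
      have := wt_pos j
      have := wt_pos (k - j)
      gcongr
      · norm_num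
      · omega

/-- The weighted restriction of `c` to a finite set of frequencies. -/
noncomputable def sobVec (s : ℕ) (S : Finset ℤ) (c : ℤ → ℂ) : EuclideanSpace ℂ S :=
  WithLp.toLp 2 fun k => wt k ^ s • c k

/-- The sequence `c` has weighted norm `(∑ (1 + |k|)^{2s} |c_k|²)^{1/2}` at most `B`. -/
def SobLE (s : ℕ) (c : ℤ → ℂ) (B : ℝ) : Prop := ∀ S : Finset ℤ, ‖sobVec s S c‖ ≤ B

theorem norm_sobVec_sq (s : ℕ) (S : Finset ℤ) (c : ℤ → ℂ) :
    ‖sobVec s S c‖ ^ 2 = ∑ k ∈ S, (wt k ^ s * ‖c k‖) ^ 2 := by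
  rw [EuclideanSpace.norm_sq_eq, ← Finset.sum_coe_sort S (fun k => (wt k ^ s * ‖c k‖) ^ 2)]
  refine Finset.sum_congr rfl fun k _ => ?_
  simp [sobVec, abs_of_pos (wt_pos k)]

theorem sobVec_add (s : ℕ) (S : Finset ℤ) (c d : ℤ → ℂ) :
    sobVec s S (fun k => c k + d k) = sobVec s S c + sobVec s S d := by
  ext k; simp [sobVec]

theorem sobVec_sub (s : ℕ) (S : Finset ℤ) (c d : ℤ → ℂ) :
    sobVec s S (fun k => c k - d k) = sobVec s S c - sobVec s S d := by
  ext k; simp [sobVec, mul_sub]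

namespace SobLE

variable {s r : ℕ} {c d : ℤ → ℂ} {A B : ℝ}

theorem nonneg (h : SobLE s c B) : 0 ≤ B := (norm_nonneg _).trans (h ∅)

theorem of_sum (hB : 0 ≤ B) (h : ∀ S : Finset ℤ, ∑ k ∈ S, (wt k ^ s * ‖c k‖) ^ 2 ≤ B ^ 2) :
    SobLE s c B := fun S => by
  refine le_of_sq_le_sq ?_ hB
  rw [norm_sobVec_sq]; exact h S

theorem sum_le (h : SobLE s c B) (S : Finset ℤ) : ∑ k ∈ S, (wt k ^ s * ‖c k‖) ^ 2 ≤ B ^ 2 := by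
  rw [← norm_sobVec_sq]
  exact pow_le_pow_left₀ (norm_nonneg _) (h S) 2

theorem mono (h : SobLE s c A) (hAB : A ≤ B) : SobLE s c B := fun S => (h S).trans hAB

/-- The comparison principle behind all multiplier estimates. The two orders may differ, so gains
and losses of derivatives are both instances of it. -/
theorem of_le (h : SobLE s d B) (hA : 0 ≤ A)
    (hcd : ∀ k, wt k ^ r * ‖c k‖ ≤ A * (wt k ^ s * ‖d k‖)) : SobLE r c (A * B) := by
  refine of_sum (mul_nonneg hA h.nonneg) fun S => ?_
  calc ∑ k ∈ S, (wt k ^ r * ‖c k‖) ^ 2 ≤ ∑ k ∈ S, A ^ 2 * (wt k ^ s * ‖d k‖) ^ 2 := by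
        refine Finset.sum_le_sum fun k _ => ?_
        rw [← mul_pow]
        exact pow_le_pow_left₀ (mul_nonneg (pow_nonneg (wt_pos k).le _) (norm_nonneg _)) (hcd k) 2
    _ ≤ (A * B) ^ 2 := by
        rw [← Finset.mul_sum, mul_pow]
        exact mul_le_mul_of_nonneg_left (h.sum_le S) (sq_nonneg A)

theorem of_norm_le (h : SobLE s d B) (hcd : ∀ k, ‖c k‖ ≤ ‖d k‖) : SobLE s c B := by
  have := h.of_le (r := s) (c := c) zero_le_one fun k => by
    rw [one_mul]
    exact mul_le_mul_of_nonneg_left (hcd k) (pow_nonneg (wt_pos k).le _)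
  simpa using this

theorem of_norm_le_mul (h : SobLE s d B) (hA : 0 ≤ A) (hcd : ∀ k, ‖c k‖ ≤ A * ‖d k‖) :
    SobLE s c (A * B) := h.of_le hA fun k => by
  rw [mul_left_comm]
  exact mul_le_mul_of_nonneg_left (hcd k) (pow_nonneg (wt_pos k).le _)

theorem weaken (h : SobLE s c B) (hr : r ≤ s) : SobLE r c B := by
  have := h.of_le (r := r) (c := c) zero_le_one fun k => by
    rw [one_mul]
    exact mul_le_mul_of_nonneg_right (pow_le_pow_right₀ (one_le_wt k) hr) (norm_nonneg _)
  simpa using this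

theorem add (hc : SobLE s c A) (hd : SobLE s d B) : SobLE s (fun k => c k + d k) (A + B) :=
  fun S => by
    rw [sobVec_add]
    exact (norm_add_le _ _).trans (add_le_add (hc S) (hd S))

theorem sub (hc : SobLE s c A) (hd : SobLE s d B) : SobLE s (fun k => c k - d k) (A + B) :=
  fun S => by
    rw [sobVec_sub]
    exact (norm_sub_le _ _).trans (add_le_add (hc S) (hd S))

theorem const_mul (hc : SobLE s c A) (z : ℂ) : SobLE s (fun k => z * c k) (‖z‖ * A) :=
  hc.of_norm_le_mul (norm_nonneg z) fun k => by rw [norm_mul]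

/-- A multiplier bounded by `A (1 + |k|)^r` costs `r` derivatives. -/
theorem mul_multiplier (hc : SobLE (s + r) c B) (hA : 0 ≤ A) {z : ℤ → ℂ}
    (hz : ∀ k, ‖z k‖ ≤ A * wt k ^ r) : SobLE s (fun k => z k * c k) (A * B) :=
  hc.of_le hA fun k => by
    rw [norm_mul, pow_add]
    have := wt_pos k
    calc wt k ^ s * (‖z k‖ * ‖c k‖) ≤ wt k ^ s * ((A * wt k ^ r) * ‖c k‖) := by
          gcongr; exact hz k
      _ = _ := by ring

theorem norm_le (h : SobLE s c B) (k : ℤ) : wt k ^ s * ‖c k‖ ≤ B := by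
  have := h.sum_le {k}
  rw [Finset.sum_singleton] at this
  exact le_of_sq_le_sq this h.nonneg

theorem star_neg (h : SobLE s c B) : SobLE s (fun k => starRingEnd ℂ (c (-k))) B := by
  refine of_sum h.nonneg fun S => ?_
  have := h.sum_le (S.map (Equiv.neg ℤ).toEmbedding)
  rw [Finset.sum_map] at this
  simpa [wt_neg] using this

end SobLE

/-! ### Embedding of weighted `ℓ²` into `ℓ¹`. -/

theorem summable_wt_neg_two : Summable fun k : ℤ => (wt k ^ 2)⁻¹ := by
  have h := (Real.summable_one_div_int_pow (p := 2)).2 (by norm_num)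
  refine Summable.of_norm_bounded_eventually h ?_
  have : ({0} : Set ℤ).Finite := Set.finite_singleton 0
  filter_upwards [this.compl_mem_cofinite] with k hk
  have hk : (k : ℝ) ≠ 0 := by simpa using hk
  rw [norm_inv, norm_pow, Real.norm_of_nonneg (wt_pos k).le, one_div, ← sq_abs (k : ℝ)]
  have : 0 < |(k : ℝ)| := abs_pos.2 hk
  gcongr
  exact abs_le_wt k

/-- The norm of the embedding of weighted `ℓ²` into `ℓ¹`. -/
noncomputable def embConst : ℝ := √(∑' k : ℤ, (wt k ^ 2)⁻¹)

theorem embConst_nonneg : 0 ≤ embConst := Real.sqrt_nonneg _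

theorem sum_wt_neg_two_le (S : Finset ℤ) : ∑ k ∈ S, (wt k ^ 2)⁻¹ ≤ embConst ^ 2 := by
  have h0 : ∀ k : ℤ, 0 ≤ (wt k ^ 2)⁻¹ := fun k => by positivity
  rw [embConst, Real.sq_sqrt (tsum_nonneg h0)]
  exact summable_wt_neg_two.sum_le_tsum S fun k _ => h0 k

namespace SobLE

variable {s r : ℕ} {c d : ℤ → ℂ} {A B : ℝ}

/-- Cauchy–Schwarz against the square summable sequence `1 / wt k`, at the price of one derivative.
-/
theorem sum_norm_le (h : SobLE (r + 1) c B) (S : Finset ℤ) :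
    ∑ k ∈ S, wt k ^ r * ‖c k‖ ≤ embConst * B := by
  refine le_of_sq_le_sq ?_ (mul_nonneg embConst_nonneg h.nonneg)
  calc (∑ k ∈ S, wt k ^ r * ‖c k‖) ^ 2
      = (∑ k ∈ S, (wt k)⁻¹ * (wt k ^ (r + 1) * ‖c k‖)) ^ 2 := by
        congr 1
        refine Finset.sum_congr rfl fun k _ => ?_
        have := (wt_pos k).ne'
        field_simp
        ring
    _ ≤ (∑ k ∈ S, (wt k)⁻¹ ^ 2) * ∑ k ∈ S, (wt k ^ (r + 1) * ‖c k‖) ^ 2 :=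
        Finset.sum_mul_sq_le_sq_mul_sq _ _ _
    _ ≤ embConst ^ 2 * B ^ 2 := by
        refine mul_le_mul ?_ (h.sum_le S) (Finset.sum_nonneg fun k _ => sq_nonneg _) (sq_nonneg _)
        simpa [inv_pow] using sum_wt_neg_two_le S
    _ = _ := by ring

theorem summable_wt (h : SobLE (r + 1) c B) : Summable fun k => wt k ^ r * ‖c k‖ :=
  summable_of_sum_le (fun k => mul_nonneg (pow_nonneg (wt_pos k).le _) (norm_nonneg _))
    h.sum_norm_le

theorem tsum_wt_le (h : SobLE (r + 1) c B) : ∑' k, wt k ^ r * ‖c k‖ ≤ embConst * B :=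
  h.summable_wt.tsum_le_of_sum_le h.sum_norm_le

theorem summable_norm (h : SobLE s c B) (hs : 1 ≤ s) : Summable fun k => ‖c k‖ := by
  simpa using (h.weaken hs).summable_wt (r := 0)

theorem tsum_norm_le (h : SobLE s c B) (hs : 1 ≤ s) : ∑' k, ‖c k‖ ≤ embConst * B := by
  simpa using (h.weaken hs).tsum_wt_le (r := 0)

end SobLE

/-! ### Convolution -/

/-- Convolution of sequences. -/
noncomputable def conv (c d : ℤ → ℂ) (k : ℤ) : ℂ := ∑' j, c j * d (k - j)

theorem conv_comm (c d : ℤ → ℂ) : conv c d = conv d c := by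
  ext k
  unfold conv
  rw [← (Equiv.subLeft k).tsum_eq]
  refine tsum_congr fun j => ?_
  simp [mul_comm]

theorem summable_norm_mul_shift {c d : ℤ → ℂ} (hc : Summable fun k => ‖c k‖)
    (hd : Summable fun k => ‖d k‖) (k : ℤ) : Summable fun j => ‖c j * d (k - j)‖ := by
  have hd' : Summable fun j => ‖d (k - j)‖ := (Equiv.subLeft k).summable_iff.2 hd
  refine Summable.of_nonneg_of_le (fun _ => norm_nonneg _) (fun j => ?_)
    (hc.mul_right (∑' j, ‖d (k - j)‖))
  rw [norm_mul]
  exact mul_le_mul_of_nonneg_left (hd'.le_tsum j fun _ _ => norm_nonneg _) (norm_nonneg _)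

theorem conv_add_left {c c' d : ℤ → ℂ} (hc : Summable fun k => ‖c k‖)
    (hc' : Summable fun k => ‖c' k‖) (hd : Summable fun k => ‖d k‖) (k : ℤ) :
    conv (fun k => c k + c' k) d k = conv c d k + conv c' d k := by
  unfold conv
  rw [← (summable_norm_mul_shift hc hd k).of_norm.tsum_add
    (summable_norm_mul_shift hc' hd k).of_norm]
  exact tsum_congr fun j => add_mul _ _ _

theorem conv_sub_left {c c' d : ℤ → ℂ} (hc : Summable fun k => ‖c k‖)
    (hc' : Summable fun k => ‖c' k‖) (hd : Summable fun k => ‖d k‖) (k : ℤ) :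
    conv (fun k => c k - c' k) d k = conv c d k - conv c' d k := by
  unfold conv
  rw [← (summable_norm_mul_shift hc hd k).of_norm.tsum_sub
    (summable_norm_mul_shift hc' hd k).of_norm]
  exact tsum_congr fun j => sub_mul _ _ _

theorem conv_add_right {c d d' : ℤ → ℂ} (hc : Summable fun k => ‖c k‖)
    (hd : Summable fun k => ‖d k‖) (hd' : Summable fun k => ‖d' k‖) (k : ℤ) :
    conv c (fun k => d k + d' k) k = conv c d k + conv c d' k := by
  rw [conv_comm, conv_add_left hd hd' hc, conv_comm d, conv_comm d']

theorem conv_sub_right {c d d' : ℤ → ℂ} (hc : Summable fun k => ‖c k‖)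
    (hd : Summable fun k => ‖d k‖) (hd' : Summable fun k => ‖d' k‖) (k : ℤ) :
    conv c (fun k => d k - d' k) k = conv c d k - conv c d' k := by
  rw [conv_comm, conv_sub_left hd hd' hc, conv_comm d, conv_comm d']

/-- Young's inequality `‖c * d‖_{ℓ²} ≤ ‖c‖_{ℓ²} ‖d‖_{ℓ¹}`. -/
theorem SobLE.conv_zero {c d : ℤ → ℂ} {A : ℝ} (hc : SobLE 0 c A)
    (hd : Summable fun k => ‖d k‖) : SobLE 0 (conv c d) (A * ∑' k, ‖d k‖) := by
  intro S
  have hshift : ∀ i : ℤ, ‖sobVec 0 S (fun k => c (k - i))‖ ≤ A := fun i => by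
    refine le_of_sq_le_sq ?_ hc.nonneg
    rw [norm_sobVec_sq]
    have := hc.sum_le (S.map (Equiv.subRight i).toEmbedding)
    rw [Finset.sum_map] at this
    simpa using this
  have hsum : Summable fun i => ‖d i • sobVec 0 S (fun k => c (k - i))‖ := by
    refine Summable.of_nonneg_of_le (fun _ => norm_nonneg _) (fun i => ?_) (hd.mul_right A)
    rw [norm_smul]
    exact mul_le_mul_of_nonneg_left (hshift i) (norm_nonneg _)
  -- On a finite window the convolution is an absolutely convergent sum of shifts of `c` with scalar
  -- coefficients `d i`, and every shift has norm at most `A`; the triangle inequality then gives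
  -- the claim.
  have heq : sobVec 0 S (conv c d) = ∑' i, d i • sobVec 0 S (fun k => c (k - i)) := by
    ext k
    have := (EuclideanSpace.proj k : EuclideanSpace ℂ S →L[ℂ] ℂ).map_tsum hsum.of_norm
    simp only [EuclideanSpace.coe_proj] at this
    rw [this, conv_comm]
    simp [sobVec, conv]
  rw [heq]
  refine (norm_tsum_le_tsum_norm hsum).trans ?_
  rw [mul_comm, ← tsum_mul_right]
  refine hsum.tsum_le_tsum (fun i => ?_) (hd.mul_right A)
  rw [norm_smul]
  exact mul_le_mul_of_nonneg_left (hshift i) (norm_nonneg _)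

/-- By `wt_pow_le` the weight falls on one of the factors. Young's inequality is then used with the
weighted factor in `ℓ²` and the other in `ℓ¹`, which it reaches through the embedding because `s ≥
1`. -/
theorem SobLE.conv {s : ℕ} {c d : ℤ → ℂ} {A B : ℝ} (hs : 1 ≤ s) (hc : SobLE s c A)
    (hd : SobLE s d B) : SobLE s (conv c d) (2 ^ (s + 1) * embConst * A * B) := by
  have hA := hc.nonneg
  have hB := hd.nonneg
  have hc1 := hc.summable_norm hs
  have hd1 := hd.summable_norm hs
  -- Absolute values, with and without weight, recast as complex sequences so that Young's
  -- inequality applies to them directly.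
  let wc : ℤ → ℂ := fun k => ((wt k ^ s * ‖c k‖ : ℝ) : ℂ)
  let wd : ℤ → ℂ := fun k => ((wt k ^ s * ‖d k‖ : ℝ) : ℂ)
  let nc : ℤ → ℂ := fun k => ((‖c k‖ : ℝ) : ℂ)
  let nd : ℤ → ℂ := fun k => ((‖d k‖ : ℝ) : ℂ)
  have hnw : ∀ k, ‖wc k‖ = wt k ^ s * ‖c k‖ := fun k => by
    simp [wc, abs_of_pos (wt_pos k)]
  have hnw' : ∀ k, ‖wd k‖ = wt k ^ s * ‖d k‖ := fun k => by
    simp [wd, abs_of_pos (wt_pos k)]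
  have hwc : SobLE 0 wc A := by
    have := hc.of_le (r := 0) (c := wc) zero_le_one fun k => by rw [hnw]; simp
    simpa using this
  have hwd : SobLE 0 wd B := by
    have := hd.of_le (r := 0) (c := wd) zero_le_one fun k => by rw [hnw']; simp
    simpa using this
  have hnc : Summable fun k => ‖nc k‖ := by simpa [nc] using hc1
  have hnd : Summable fun k => ‖nd k‖ := by simpa [nd] using hd1
  have h1 : SobLE 0 (_root_.conv wc nd) (A * (embConst * B)) :=
    (hwc.conv_zero hnd).mono
      (mul_le_mul_of_nonneg_left (by simpa [nd] using hd.tsum_norm_le hs) hA)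
  have h2 : SobLE 0 (_root_.conv wd nc) (B * (embConst * A)) :=
    (hwd.conv_zero hnc).mono
      (mul_le_mul_of_nonneg_left (by simpa [nc] using hc.tsum_norm_le hs) hB)
  have hbd : ∀ {x : ℤ → ℂ} {X : ℝ}, SobLE 0 x X → ∀ {y : ℤ → ℂ}, (Summable fun k => ‖y k‖) →
      ∀ k, Summable fun j => ‖x j‖ * ‖y (k - j)‖ := by
    intro x X hx y hy k
    have hy' : Summable fun j => ‖y (k - j)‖ := (Equiv.subLeft k).summable_iff.2 hy
    refine Summable.of_nonneg_of_le (fun _ => by positivity) (fun j => ?_) (hy'.mul_left X)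
    have := hx.norm_le j
    simp only [pow_zero, one_mul] at this
    gcongr
  have h12 := (h1.add h2).of_le (r := s) (c := _root_.conv c d) (A := 2 ^ s) (by positivity) ?_
  · refine h12.mono (le_of_eq ?_)
    ring
  intro k
  have hs1 := hbd hwc hnd k
  have hs2' := hbd hwd hnc k
  have hs2 : Summable fun j => ‖nc j‖ * ‖wd (k - j)‖ := by
    have := (Equiv.subLeft k).summable_iff.2 hs2'
    simpa [Function.comp_def, mul_comm] using this
  have e1 : _root_.conv wc nd k = ((∑' j, ‖wc j‖ * ‖nd (k - j)‖ : ℝ) : ℂ) := by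
    simp only [_root_.conv, Complex.ofReal_tsum]
    refine tsum_congr fun j => ?_
    rw [hnw]; simp [wc, nd]
  have e2 : _root_.conv wd nc k = ((∑' j, ‖nc j‖ * ‖wd (k - j)‖ : ℝ) : ℂ) := by
    rw [conv_comm]
    simp only [_root_.conv, Complex.ofReal_tsum]
    refine tsum_congr fun j => ?_
    rw [hnw']; simp [wd, nc]
  rw [e1, e2, ← Complex.ofReal_add, Complex.norm_real, Real.norm_of_nonneg
    (add_nonneg (tsum_nonneg fun _ => by positivity) (tsum_nonneg fun _ => by positivity)),
    pow_zero, one_mul, ← hs1.tsum_add hs2, ← tsum_mul_left]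
  have hm := summable_norm_mul_shift hc1 hd1 k
  calc wt k ^ s * ‖_root_.conv c d k‖ ≤ wt k ^ s * ∑' j, ‖c j * d (k - j)‖ :=
        mul_le_mul_of_nonneg_left (norm_tsum_le_tsum_norm hm) (pow_nonneg (wt_pos k).le _)
    _ = ∑' j, wt k ^ s * ‖c j * d (k - j)‖ := by rw [tsum_mul_left]
    _ ≤ _ := by
      refine (hm.mul_left _).tsum_le_tsum (fun j => ?_) ((hs1.add hs2).mul_left _)
      rw [hnw, hnw', norm_mul]
      simp only [nc, nd, Complex.norm_real, norm_norm]
      calc wt k ^ s * (‖c j‖ * ‖d (k - j)‖)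
          ≤ (2 ^ s * (wt j ^ s + wt (k - j) ^ s)) * (‖c j‖ * ‖d (k - j)‖) :=
            mul_le_mul_of_nonneg_right (wt_pow_le s j k) (by positivity)
        _ = _ := by ring

/-! ### The mean value inequality for families of sequences -/

/-- The norm is a supremum over finite windows, so the mean value inequality is only needed for
finite-dimensional vectors. Differentiability of each single coefficient is enough; no
differentiability in the infinite-dimensional norm is used. -/
theorem SobLE.sub_of_hasDerivAt {s : ℕ} {x x' : ℝ → ℤ → ℂ} {σ B : ℝ} (hσ : 0 ≤ σ)
    (hc : ∀ k, ContinuousOn (fun r => x r k) (Icc 0 σ))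
    (hd : ∀ k, ∀ r ∈ Ioo 0 σ, HasDerivAt (fun r => x r k) (x' r k) r)
    (hb : ∀ r ∈ Ioo 0 σ, SobLE s (x' r) B) :
    SobLE s (fun k => x σ k - x 0 k) (B * σ) := by
  intro S
  rw [sobVec_sub]
  rcases hσ.eq_or_lt with rfl | hσ
  · simp
  have hC : ContinuousOn (fun r => sobVec s S (x r)) (Icc 0 σ) := by
    refine (PiLp.continuous_toLp 2 _).comp_continuousOn (continuousOn_pi.2 fun k => ?_)
    exact (hc k).const_smul (wt k ^ s)
  have hD : ∀ r ∈ Ioo 0 σ, HasDerivAt (fun r => sobVec s S (x r)) (sobVec s S (x' r)) r := by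
    intro r hr
    have := hasDerivAt_pi.2 fun k : S => (hd k r hr).const_smul (wt k ^ s)
    exact ((PiLp.continuousLinearEquiv 2 ℝ fun _ : S => ℂ).symm.toContinuousLinearMap.hasFDerivAt
      (x := fun k : S => wt k ^ s • x r k)).comp_hasDerivAt r this
  -- Derivatives exist in the open interval only, so the estimate is made on `[ε, σ]` and continuity
  -- takes `ε` to `0`.
  have key : ∀ ε ∈ Ioo 0 σ, ‖sobVec s S (x σ) - sobVec s S (x ε)‖ ≤ B * (σ - ε) := by
    intro ε hε
    exact norm_image_sub_le_of_norm_deriv_right_le_segment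
      (hC.mono (Icc_subset_Icc_left hε.1.le))
      (fun r hr => (hD r ⟨hε.1.trans_le hr.1, hr.2⟩).hasDerivWithinAt)
      (fun r hr => hb r ⟨hε.1.trans_le hr.1, hr.2⟩ S) σ ⟨hε.2.le, le_rfl⟩
  have h0 : Tendsto (fun r => sobVec s S (x r)) (𝓝[Ioo 0 σ] 0) (𝓝 (sobVec s S (x 0))) :=
    ((hC 0 ⟨le_rfl, hσ.le⟩).mono Ioo_subset_Icc_self)
  have hne : (𝓝[Ioo 0 σ] (0 : ℝ)).NeBot := by
    rw [nhdsWithin_Ioo_eq_nhdsGT hσ]; infer_instance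
  have hlim := (tendsto_const_nhds (x := sobVec s S (x σ))).sub h0
  have hlim' : Tendsto (fun ε : ℝ => B * (σ - ε)) (𝓝[Ioo 0 σ] 0) (𝓝 (B * (σ - 0))) :=
    ((continuous_const.mul (continuous_const.sub continuous_id)).tendsto 0).mono_left
      nhdsWithin_le_nhds
  simpa using le_of_tendsto_of_tendsto hlim.norm hlim' (eventually_nhdsWithin_of_forall key)

/-! ### Fourier series -/

/-- The oscillation `y ↦ e^{iky}`. -/
noncomputable def osc (k : ℤ) (y : ℝ) : ℂ := Complex.exp (((k : ℝ) * y : ℝ) * Complex.I)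

theorem norm_osc (k : ℤ) (y : ℝ) : ‖osc k y‖ = 1 := Complex.norm_exp_ofReal_mul_I _

theorem osc_zero_left (y : ℝ) : osc 0 y = 1 := by simp [osc]

theorem osc_zero_right (k : ℤ) : osc k 0 = 1 := by simp [osc]

theorem osc_add_left (j k : ℤ) (y : ℝ) : osc (j + k) y = osc j y * osc k y := by
  rw [osc, osc, osc, ← Complex.exp_add]
  congr 1; push_cast; ring

theorem osc_add_right (k : ℤ) (y z : ℝ) : osc k (y + z) = osc k y * osc k z := by
  rw [osc, osc, osc, ← Complex.exp_add]
  congr 1; push_cast; ring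

theorem osc_neg_left (k : ℤ) (y : ℝ) : osc (-k) y = osc k (-y) := by simp [osc]

theorem osc_neg_mul_self (k : ℤ) (y : ℝ) : osc (-k) y * osc k y = 1 := by
  rw [← osc_add_left, neg_add_cancel, osc_zero_left]

theorem conj_osc (k : ℤ) (y : ℝ) : starRingEnd ℂ (osc k y) = osc (-k) y := by
  simp only [osc, ← Complex.exp_conj, map_mul, Complex.conj_ofReal, Complex.conj_I]
  congr 1; push_cast; ring

theorem osc_two_pi (k : ℤ) : osc k (2 * π) = 1 := by
  rw [osc, Complex.exp_eq_one_iff]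
  exact ⟨k, by push_cast; ring⟩

theorem osc_sub_one_norm_le (k : ℤ) (y : ℝ) : ‖osc k y - 1‖ ≤ |(k : ℝ)| * |y| := by
  have := Real.norm_exp_I_mul_ofReal_sub_one_le (x := (k : ℝ) * y)
  rw [Real.norm_eq_abs, abs_mul] at this
  rwa [osc, mul_comm _ Complex.I]

theorem osc_sub_osc_norm_le (k : ℤ) (y z : ℝ) : ‖osc k y - osc k z‖ ≤ |(k : ℝ)| * |y - z| := by
  have : osc k y - osc k z = osc k z * (osc k (y - z) - 1) := by
    rw [mul_sub, ← osc_add_right, mul_one]; congr 2; ring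
  rw [this, norm_mul, norm_osc, one_mul]
  exact osc_sub_one_norm_le k _

theorem hasDerivAt_osc (k : ℤ) (y : ℝ) : HasDerivAt (osc k) (Complex.I * k * osc k y) y := by
  have h : HasDerivAt (fun y : ℝ => (((k : ℝ) * y : ℝ) : ℂ) * Complex.I) ((k : ℂ) * Complex.I) y := by
    have := (((hasDerivAt_id y).const_mul (k : ℝ)).ofReal_comp).mul_const Complex.I
    simpa using this
  have := h.cexp
  unfold osc
  convert this using 1
  ring

theorem continuous_osc (k : ℤ) : Continuous (osc k) :=
  continuous_iff_continuousAt.2 fun y => (hasDerivAt_osc k y).continuousAt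

/-- The function `y ↦ ∑ c_k e^{iky}`. -/
noncomputable def fser (c : ℤ → ℂ) (y : ℝ) : ℂ := ∑' k, c k * osc k y

/-- The Fourier coefficients of the complex conjugate. -/
noncomputable def cbar (c : ℤ → ℂ) (k : ℤ) : ℂ := starRingEnd ℂ (c (-k))

theorem summable_cbar {c : ℤ → ℂ} (hc : Summable fun k => ‖c k‖) : Summable fun k => ‖cbar c k‖ := by
  simpa [cbar, Function.comp_def] using (Equiv.neg ℤ).summable_iff.2 hc

theorem SobLE.cbar {s : ℕ} {c : ℤ → ℂ} {B : ℝ} (h : SobLE s c B) : SobLE s (cbar c) B := h.star_neg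

section fser

variable {c d : ℤ → ℂ}

theorem summable_fser (hc : Summable fun k => ‖c k‖) (y : ℝ) : Summable fun k => c k * osc k y :=
  Summable.of_norm (by simpa [norm_osc] using hc)

theorem norm_fser_le (hc : Summable fun k => ‖c k‖) (y : ℝ) : ‖fser c y‖ ≤ ∑' k, ‖c k‖ := by
  have h : Summable fun k => ‖c k * osc k y‖ := by simpa [norm_osc] using hc
  simpa [norm_osc, fser] using norm_tsum_le_tsum_norm h

theorem SobLE.norm_fser_le {s : ℕ} {B : ℝ} (h : SobLE s c B) (hs : 1 ≤ s) (y : ℝ) :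
    ‖fser c y‖ ≤ embConst * B :=
  (_root_.norm_fser_le (h.summable_norm hs) y).trans (h.tsum_norm_le hs)

theorem fser_add (hc : Summable fun k => ‖c k‖) (hd : Summable fun k => ‖d k‖) (y : ℝ) :
    fser (fun k => c k + d k) y = fser c y + fser d y := by
  unfold fser
  rw [← (summable_fser hc y).tsum_add (summable_fser hd y)]
  exact tsum_congr fun k => add_mul _ _ _

theorem fser_sub (hc : Summable fun k => ‖c k‖) (hd : Summable fun k => ‖d k‖) (y : ℝ) :
    fser (fun k => c k - d k) y = fser c y - fser d y := by
  unfold fser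
  rw [← (summable_fser hc y).tsum_sub (summable_fser hd y)]
  exact tsum_congr fun k => sub_mul _ _ _

theorem fser_const_mul (z : ℂ) (y : ℝ) : fser (fun k => z * c k) y = z * fser c y := by
  unfold fser
  rw [← tsum_mul_left]
  exact tsum_congr fun k => mul_assoc _ _ _

theorem fser_cbar (y : ℝ) : fser (cbar c) y = starRingEnd ℂ (fser c y) := by
  unfold fser
  rw [← (Equiv.neg ℤ).tsum_eq, Complex.conj_tsum]
  refine tsum_congr fun k => ?_
  simp [cbar, conj_osc]

theorem fser_add_two_pi (y : ℝ) : fser c (y + 2 * π) = fser c y := by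
  unfold fser
  exact tsum_congr fun k => by rw [osc_add_right, osc_two_pi, mul_one]

theorem fser_neg_of_odd (hc : ∀ k, c (-k) = -c k) (y : ℝ) : fser c (-y) = -fser c y := by
  unfold fser
  rw [← (Equiv.neg ℤ).tsum_eq, ← tsum_neg]
  refine tsum_congr fun k => ?_
  simp [hc, osc_neg_left]

theorem fser_neg_of_even (hc : ∀ k, c (-k) = c k) (y : ℝ) : fser c (-y) = fser c y := by
  unfold fser
  rw [← (Equiv.neg ℤ).tsum_eq]
  refine tsum_congr fun k => ?_
  simp [hc, osc_neg_left]

/-- A shear of `ℤ²` that turns a pair of frequencies into total frequency and first frequency; it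
rearranges the product of two series into the iterated sum of a convolution. -/
theorem exists_convolution_equiv : ∃ e : ℤ × ℤ ≃ ℤ × ℤ, ∀ p, e p = (p.2, p.1 - p.2) :=
  ⟨⟨fun p => (p.2, p.1 - p.2), fun p => (p.1 + p.2, p.1), fun p => by ext <;> simp,
    fun p => by ext <;> simp⟩, fun _ => rfl⟩

theorem osc_mul_osc_sub (j k : ℤ) (y : ℝ) : osc j y * osc (k - j) y = osc k y := by
  rw [← osc_add_left, add_sub_cancel]

theorem fser_conv (hc : Summable fun k => ‖c k‖) (hd : Summable fun k => ‖d k‖) (y : ℝ) :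
    fser (conv c d) y = fser c y * fser d y := by
  have hc' : Summable fun k => ‖c k * osc k y‖ := by simpa [norm_osc] using hc
  have hd' : Summable fun k => ‖d k * osc k y‖ := by simpa [norm_osc] using hd
  obtain ⟨e, he⟩ := exists_convolution_equiv
  have hs := summable_mul_of_summable_norm hc' hd'
  have h1 : fser c y * fser d y = ∑' p : ℤ × ℤ, c p.1 * osc p.1 y * (d p.2 * osc p.2 y) :=
    tsum_mul_tsum_of_summable_norm hc' hd'
  have hterm : ∀ p : ℤ × ℤ, c (e p).1 * osc (e p).1 y * (d (e p).2 * osc (e p).2 y) =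
      c p.2 * d (p.1 - p.2) * osc p.1 y := fun p => by
    rw [he, mul_mul_mul_comm, osc_mul_osc_sub]
  have hs' : Summable fun p : ℤ × ℤ => c p.2 * d (p.1 - p.2) * osc p.1 y :=
    (e.summable_iff.2 hs).congr hterm
  rw [h1, ← e.tsum_eq, tsum_congr hterm, hs'.tsum_prod, fser]
  refine tsum_congr fun k => ?_
  rw [conv, ← tsum_mul_right]

theorem fser_sub_norm_le (hc : Summable fun k => wt k ^ 1 * ‖c k‖) (y z : ℝ) :
    ‖fser c y - fser c z‖ ≤ (∑' k, wt k ^ 1 * ‖c k‖) * |y - z| := by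
  have hc0 : Summable fun k => ‖c k‖ := by
    refine Summable.of_nonneg_of_le (fun _ => norm_nonneg _) (fun k => ?_) hc
    exact le_mul_of_one_le_left (norm_nonneg _) (by simpa using one_le_wt k)
  unfold fser
  rw [← (summable_fser hc0 y).tsum_sub (summable_fser hc0 z), ← tsum_mul_right]
  refine tsum_of_norm_bounded (hc.mul_right _).hasSum fun k => ?_
  rw [← mul_sub, norm_mul, pow_one, mul_comm (wt k), mul_assoc]
  refine mul_le_mul_of_nonneg_left ((osc_sub_osc_norm_le k y z).trans ?_) (norm_nonneg _)
  exact mul_le_mul_of_nonneg_right (abs_le_wt k) (abs_nonneg _)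

theorem hasDerivAt_fser (hc : Summable fun k => wt k ^ 1 * ‖c k‖) (y : ℝ) :
    HasDerivAt (fser c) (fser (fun k => Complex.I * k * c k) y) y := by
  have hc0 : Summable fun k => ‖c k‖ := by
    refine Summable.of_nonneg_of_le (fun _ => norm_nonneg _) (fun k => ?_) hc
    exact le_mul_of_one_le_left (norm_nonneg _) (by simpa using one_le_wt k)
  have := hasDerivAt_tsum (g := fun k y => c k * osc k y)
    (g' := fun k y => c k * (Complex.I * k * osc k y)) hc
    (fun k y => (hasDerivAt_osc k y).const_mul (c k)) (fun k y => ?_) (summable_fser hc0 0) y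
  · have h : fser (fun k => Complex.I * k * c k) y = ∑' k, c k * (Complex.I * k * osc k y) :=
      tsum_congr fun k => by ring
    rw [h]
    exact this
  · simp only [norm_mul, Complex.norm_I, norm_osc, one_mul, mul_one, pow_one, Complex.norm_intCast]
    rw [mul_comm]
    exact mul_le_mul_of_nonneg_right (abs_le_wt k) (norm_nonneg _)

theorem continuous_fser (hc : Summable fun k => ‖c k‖) : Continuous (fser c) := by
  refine continuous_tsum (fun k => continuous_const.mul (continuous_osc k)) hc fun k y => ?_
  simp [norm_osc]

theorem integral_osc (k : ℤ) : ∫ y in (-π)..π, osc k y = if k = 0 then 2 * (π : ℂ) else 0 := by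
  split_ifs with hk
  · subst hk
    simp [osc_zero_left]; ring
  · have hne : (k : ℂ) * Complex.I ≠ 0 := mul_ne_zero (by exact_mod_cast hk) Complex.I_ne_zero
    have : ∀ y : ℝ, osc k y = Complex.exp ((k : ℂ) * Complex.I * y) := fun y => by
      rw [osc]; congr 1; push_cast; ring
    simp_rw [this]
    rw [integral_exp_mul_complex hne, ← this, ← this]
    have h : osc k π = osc k (-π + 2 * π) := by congr 1; ring
    rw [h, osc_add_right, osc_two_pi, mul_one, sub_self, zero_div]

theorem integral_fser (hc : Summable fun k => ‖c k‖) :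
    ∫ y in (-π)..π, fser c y = 2 * π * c 0 := by
  have h := intervalIntegral.hasSum_intervalIntegral_of_summable_norm (a := -π)
    (b := π) (f := fun k => (⟨fun y => c k * osc k y,
      continuous_const.mul (continuous_osc k)⟩ : C(ℝ, ℂ))) ?_
  · simp only [ContinuousMap.coe_mk] at h
    have h2 := h.tsum_eq
    unfold fser
    rw [← h2, tsum_eq_single 0]
    · rw [intervalIntegral.integral_const_mul, integral_osc]; simp; ring
    · intro k hk
      rw [intervalIntegral.integral_const_mul, integral_osc]; simp [hk]
  · refine Summable.of_nonneg_of_le (fun _ => norm_nonneg _) (fun k => ?_) hc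
    rw [ContinuousMap.norm_le _ (norm_nonneg _)]
    intro y
    simp [norm_osc]

theorem integral_fser_mul_osc (hc : Summable fun k => ‖c k‖) (k : ℤ) :
    ∫ y in (-π)..π, fser c y * osc (-k) y = 2 * π * c k := by
  have hs : Summable fun j => ‖c (j + k)‖ := (Equiv.addRight k).summable_iff.2 hc
  have := integral_fser hs
  rw [zero_add] at this
  rw [← this]
  refine intervalIntegral.integral_congr fun y _ => ?_
  simp only [fser]
  rw [← tsum_mul_right, ← (Equiv.addRight k).tsum_eq]
  refine tsum_congr fun j => ?_
  rw [Equiv.coe_addRight, mul_assoc, ← osc_add_left]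
  congr 2; ring

end fser

/-- Parseval's identity. -/
theorem SobLE.integral_norm_fser_sq {c : ℤ → ℂ} {B : ℝ} (hc : SobLE 1 c B) :
    ∫ y in (-π)..π, ‖fser c y‖ ^ 2 = 2 * π * ∑' k, ‖c k‖ ^ 2 := by
  have h1 := hc.summable_norm le_rfl
  have h2 := summable_cbar h1
  -- The mean of `|f|²` is the zeroth coefficient of `f` times its conjugate, which is the sum of
  -- squares.
  have h := integral_fser ((hc.conv le_rfl hc.cbar).summable_norm le_rfl)
  have e1 : ∀ y, fser (_root_.conv c (_root_.cbar c)) y = ((‖fser c y‖ ^ 2 : ℝ) : ℂ) := fun y => by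
    rw [fser_conv h1 h2, fser_cbar, Complex.mul_conj, Complex.normSq_eq_norm_sq]
  have e2 : _root_.conv c (_root_.cbar c) 0 = ((∑' k, ‖c k‖ ^ 2 : ℝ) : ℂ) := by
    rw [_root_.conv, Complex.ofReal_tsum]
    refine tsum_congr fun k => ?_
    rw [_root_.cbar, zero_sub, neg_neg, Complex.mul_conj, Complex.normSq_eq_norm_sq]
  simp_rw [e1] at h
  rw [e2, intervalIntegral.integral_ofReal] at h
  exact_mod_cast h

/-! ### Grid functions on `2M` equispaced points of the circle -/

/-- The mesh size `π / M`. -/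
noncomputable def gstep (M : ℕ) : ℝ := π / M

/-- The normalised vector of values of `g` on the grid. -/
noncomputable def gvec (M : ℕ) (g : ℝ → ℂ) : EuclideanSpace ℂ (Fin (2 * M)) :=
  WithLp.toLp 2 fun j => (√(2 * M))⁻¹ • g ((j : ℕ) * gstep M)

/-- The discrete `L²` norm. -/
noncomputable def gnorm (M : ℕ) (g : ℝ → ℂ) : ℝ := ‖gvec M g‖

/-- The discrete Fourier coefficients. -/
noncomputable def dft (M : ℕ) (g : ℝ → ℂ) (k : ℤ) : ℂ :=
  (∑ j ∈ Finset.range (2 * M), g (j * gstep M) * osc (-k) (j * gstep M)) / (2 * M)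

/-- Restriction to the frequencies `|k| < M`. -/
noncomputable def trunc (M : ℕ) (c : ℤ → ℂ) (k : ℤ) : ℂ := if |k| < M then c k else 0

/-- The forward difference on the grid. -/
noncomputable def fdiff (M : ℕ) (g : ℝ → ℂ) (y : ℝ) : ℂ := g (y + gstep M) - g y

theorem gnorm_nonneg (M : ℕ) (g : ℝ → ℂ) : 0 ≤ gnorm M g := norm_nonneg _

theorem gnorm_add_le (M : ℕ) (f g : ℝ → ℂ) :
    gnorm M (fun y => f y + g y) ≤ gnorm M f + gnorm M g := by
  have : gvec M (fun y => f y + g y) = gvec M f + gvec M g := by ext j; simp [gvec]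
  rw [gnorm, this]; exact norm_add_le _ _

theorem gnorm_sq (M : ℕ) (g : ℝ → ℂ) :
    gnorm M g ^ 2 = (∑ j ∈ Finset.range (2 * M), ‖g (j * gstep M)‖ ^ 2) / (2 * M) := by
  rw [gnorm, EuclideanSpace.norm_sq_eq, Finset.sum_range, Finset.sum_div]
  refine Finset.sum_congr rfl fun j _ => ?_
  simp only [gvec, Complex.real_smul, norm_mul, Complex.norm_real, norm_inv, mul_pow, inv_pow,
    Real.norm_eq_abs, sq_abs]
  rw [Real.sq_sqrt (by positivity)]
  field_simp

theorem gnorm_mono {M : ℕ} {f g : ℝ → ℂ} (h : ∀ y, ‖f y‖ ≤ ‖g y‖) : gnorm M f ≤ gnorm M g := by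
  refine le_of_sq_le_sq ?_ (gnorm_nonneg _ _)
  rw [gnorm_sq, gnorm_sq]
  gcongr
  exact h _

theorem gnorm_const_mul (M : ℕ) (z : ℂ) (g : ℝ → ℂ) :
    gnorm M (fun y => z * g y) = ‖z‖ * gnorm M g := by
  have : gvec M (fun y => z * g y) = z • gvec M g := by
    ext j; simp [gvec]; ring
  rw [gnorm, this, norm_smul, gnorm]

theorem gnorm_norm (M : ℕ) (g : ℝ → ℂ) : gnorm M (fun y => ((‖g y‖ : ℝ) : ℂ)) = gnorm M g :=
  le_antisymm (gnorm_mono fun y => by simp) (gnorm_mono fun y => by simp)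

theorem gnorm_le_add {M : ℕ} {f g₁ g₂ : ℝ → ℂ} {A B : ℝ} (hA : 0 ≤ A) (hB : 0 ≤ B)
    (h : ∀ y, ‖f y‖ ≤ A * ‖g₁ y‖ + B * ‖g₂ y‖) : gnorm M f ≤ A * gnorm M g₁ + B * gnorm M g₂ := by
  have h1 := gnorm_add_le M (fun y => (A : ℂ) * ((‖g₁ y‖ : ℝ) : ℂ))
    (fun y => (B : ℂ) * ((‖g₂ y‖ : ℝ) : ℂ))
  rw [gnorm_const_mul, gnorm_const_mul, gnorm_norm, gnorm_norm, Complex.norm_real,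
    Complex.norm_real, Real.norm_of_nonneg hA, Real.norm_of_nonneg hB] at h1
  refine (gnorm_mono fun y => ?_).trans h1
  rw [← Complex.ofReal_mul, ← Complex.ofReal_mul, ← Complex.ofReal_add, Complex.norm_real,
    Real.norm_of_nonneg (by positivity)]
  exact h y

theorem gnorm_le_mul {M : ℕ} {f g : ℝ → ℂ} {A : ℝ} (hA : 0 ≤ A) (h : ∀ y, ‖f y‖ ≤ A * ‖g y‖) :
    gnorm M f ≤ A * gnorm M g := by
  simpa using gnorm_le_add (M := M) (g₂ := g) hA le_rfl fun y => by simpa using h y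

theorem gnorm_le_const {M : ℕ} (hM : 0 < M) {f : ℝ → ℂ} {A : ℝ} (hA : 0 ≤ A)
    (h : ∀ y, ‖f y‖ ≤ A) : gnorm M f ≤ A := by
  refine le_of_sq_le_sq ?_ hA
  have hM' : (0 : ℝ) < M := by exact_mod_cast hM
  rw [gnorm_sq, div_le_iff₀ (by positivity)]
  calc ∑ j ∈ Finset.range (2 * M), ‖f (j * gstep M)‖ ^ 2
      ≤ ∑ j ∈ Finset.range (2 * M), A ^ 2 :=
        Finset.sum_le_sum fun j _ => pow_le_pow_left₀ (norm_nonneg _) (h _) 2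
    _ = A ^ 2 * (2 * M) := by simp; ring

/-- A shift by one mesh width permutes the grid cyclically; periodicity identifies the point that
leaves with the one that enters. -/
theorem gnorm_shift {M : ℕ} (hM : 0 < M) {g : ℝ → ℂ} (hg : ∀ y, g (y + 2 * π) = g y) :
    gnorm M (fun y => g (y + gstep M)) = gnorm M g := by
  rw [← sq_eq_sq₀ (gnorm_nonneg _ _) (gnorm_nonneg _ _), gnorm_sq, gnorm_sq]
  congr 1
  have h1 : ∀ j : ℕ, (j : ℝ) * gstep M + gstep M = ((j + 1 : ℕ) : ℝ) * gstep M := fun j => by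
    push_cast; ring
  simp_rw [h1]
  have h2 := Finset.sum_range_succ' (fun j : ℕ => ‖g (j * gstep M)‖ ^ 2) (2 * M)
  rw [Finset.sum_range_succ] at h2
  have h3 : ((2 * M : ℕ) : ℝ) * gstep M = 2 * π := by
    have : (M : ℝ) ≠ 0 := by exact_mod_cast hM.ne'
    rw [gstep]; push_cast; field_simp
  have h4 : g (2 * π) = g 0 := by simpa using hg 0
  rw [h3, h4] at h2
  simp only [Nat.cast_zero, zero_mul] at h2
  linarith

theorem gnorm_fdiff_le {M : ℕ} (hM : 0 < M) {g : ℝ → ℂ} (hg : ∀ y, g (y + 2 * π) = g y) :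
    gnorm M (fdiff M g) ≤ 2 * gnorm M g := by
  have := gnorm_le_add (M := M) (f := fdiff M g) (g₁ := fun y => g (y + gstep M)) (g₂ := g)
    zero_le_one zero_le_one fun y => by simpa [fdiff] using norm_sub_le _ _
  rw [gnorm_shift hM hg] at this
  linarith

/-! ### Orthogonality of oscillations on the grid and comparison of norms. -/

theorem sum_osc_grid {M : ℕ} (hM : 0 < M) {k : ℤ} (hk : ¬ ((2 * M : ℕ) : ℤ) ∣ k) :
    ∑ j ∈ Finset.range (2 * M), osc k (j * gstep M) = 0 := by
  have hM' : (M : ℝ) ≠ 0 := by exact_mod_cast hM.ne'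
  have hpow : ∀ j : ℕ, osc k (j * gstep M) = osc k (gstep M) ^ j := fun j => by
    rw [osc, osc, ← Complex.exp_nat_mul]; congr 1; push_cast; ring
  have h1 : osc k (gstep M) ^ (2 * M) = 1 := by
    rw [← hpow, ← osc_two_pi k]
    congr 1
    rw [gstep]; push_cast; field_simp
  have h2 : osc k (gstep M) ≠ 1 := by
    intro h
    rw [osc, Complex.exp_eq_one_iff] at h
    obtain ⟨n, hn⟩ := h
    apply hk
    refine ⟨n, ?_⟩
    have h3 : ((k * gstep M : ℝ) : ℂ) = ((n * (2 * π) : ℝ) : ℂ) := by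
      apply mul_right_cancel₀ Complex.I_ne_zero
      rw [hn]; push_cast; ring
    have h4 : (k : ℝ) * gstep M = n * (2 * π) := by exact_mod_cast h3
    rw [gstep] at h4
    field_simp at h4
    have h5 : (k : ℝ) = ((2 * M : ℕ) : ℤ) * n := by push_cast; linarith
    exact_mod_cast h5
  simp_rw [hpow]
  have h3 := mul_neg_geom_sum (osc k (gstep M)) (2 * M)
  rw [h1, sub_self] at h3
  exact (mul_eq_zero.1 h3).resolve_left (sub_ne_zero.2 h2.symm)

theorem inner_gvec (M : ℕ) (f g : ℝ → ℂ) : inner ℂ (gvec M f) (gvec M g) =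
    (∑ j ∈ Finset.range (2 * M), g (j * gstep M) * starRingEnd ℂ (f (j * gstep M))) / (2 * M) := by
  rw [PiLp.inner_apply, Finset.sum_range, Finset.sum_div]
  refine Finset.sum_congr rfl fun j _ => ?_
  have h : (((√(2 * M))⁻¹ : ℝ) : ℂ) * (((√(2 * M))⁻¹ : ℝ) : ℂ) = (2 * M : ℂ)⁻¹ := by
    rw [← Complex.ofReal_mul, ← mul_inv, Real.mul_self_sqrt (by positivity)]; push_cast; rfl
  simp only [gvec, Complex.real_smul, RCLike.inner_apply, map_mul, Complex.conj_ofReal]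
  rw [div_eq_mul_inv, ← h]; ring

theorem dft_eq_inner (M : ℕ) (g : ℝ → ℂ) (k : ℤ) :
    dft M g k = inner ℂ (gvec M (osc k)) (gvec M g) := by
  rw [inner_gvec, dft]
  simp_rw [conj_osc]

/-- Oscillations incongruent modulo `2M` are orthogonal on the grid because the sum of the powers of
a nontrivial `2M`-th root of unity vanishes. The set of frequencies is left general: it is used both
for `|k| < M` and for arbitrary blocks of length `2M` in the aliasing estimate. -/
theorem orthonormal_gvec_osc {M : ℕ} (hM : 0 < M) {S : Finset ℤ}
    (hS : ∀ k ∈ S, ∀ l ∈ S, ((2 * M : ℕ) : ℤ) ∣ k - l → k = l) :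
    Orthonormal ℂ fun k : S => gvec M (osc k) := by
  have hM' : (M : ℂ) ≠ 0 := by exact_mod_cast hM.ne'
  rw [orthonormal_iff_ite]
  rintro ⟨k, hk⟩ ⟨l, hl⟩
  rw [inner_gvec]
  simp_rw [conj_osc, ← osc_add_left]
  split_ifs with h
  · obtain rfl : k = l := congrArg Subtype.val h
    simp only [add_neg_cancel, osc_zero_left, Finset.sum_const, Finset.card_range, nsmul_eq_mul,
      mul_one]
    push_cast
    exact div_self (mul_ne_zero two_ne_zero hM')
  · have : ¬ ((2 * M : ℕ) : ℤ) ∣ l + -k := fun hd =>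
      h (Subtype.ext (hS l hl k hk (by simpa [sub_eq_add_neg] using hd)).symm)
    rw [sum_osc_grid hM this, zero_div]

theorem gnorm_sum_osc_sq {M : ℕ} (hM : 0 < M) {S : Finset ℤ}
    (hS : ∀ k ∈ S, ∀ l ∈ S, ((2 * M : ℕ) : ℤ) ∣ k - l → k = l) (d : ℤ → ℂ) :
    gnorm M (fun y => ∑ k ∈ S, d k * osc k y) ^ 2 = ∑ k ∈ S, ‖d k‖ ^ 2 := by
  have h1 : gvec M (fun y => ∑ k ∈ S, d k * osc k y) = ∑ k : S, d k • gvec M (osc k) := by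
    ext j
    simp only [gvec, WithLp.ofLp_sum, Finset.sum_apply, PiLp.smul_apply, Complex.real_smul,
      smul_eq_mul]
    rw [← Finset.sum_coe_sort S, Finset.mul_sum]
    refine Finset.sum_congr rfl fun k _ => ?_
    ring
  have h2 := (orthonormal_gvec_osc hM hS).inner_sum (fun k => d k) (fun k => d k) Finset.univ
  rw [← h1, inner_self_eq_norm_sq_to_K] at h2
  have h3 : ∑ k : S, starRingEnd ℂ (d k) * d k = ((∑ k ∈ S, ‖d k‖ ^ 2 : ℝ) : ℂ) := by
    rw [← Finset.sum_coe_sort S]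
    push_cast
    refine Finset.sum_congr rfl fun k _ => ?_
    rw [mul_comm, Complex.mul_conj, Complex.normSq_eq_norm_sq]; push_cast; rfl
  rw [h3] at h2
  apply Complex.ofReal_injective
  rw [← h2, gnorm, Complex.ofReal_pow]
  rfl

theorem inj_mod_of_abs_lt {M : ℕ} {k l : ℤ} (hk : |k| < M) (hl : |l| < M)
    (h : ((2 * M : ℕ) : ℤ) ∣ k - l) : k = l := by
  rw [abs_lt] at hk hl
  have := Int.eq_zero_of_abs_lt_dvd h (by rw [abs_lt]; push_cast; constructor <;> omega)
  omega

theorem SobLE.trunc {s : ℕ} {c : ℤ → ℂ} {B : ℝ} (h : SobLE s c B) (M : ℕ) :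
    SobLE s (trunc M c) B := h.of_norm_le fun k => by
  unfold _root_.trunc; split_ifs <;> simp

theorem trunc_of_lt {M : ℕ} {c : ℤ → ℂ} {k : ℤ} (hk : |k| < M) : trunc M c k = c k := if_pos hk

theorem trunc_of_le {M : ℕ} {c : ℤ → ℂ} {k : ℤ} (hk : (M : ℤ) ≤ |k|) : trunc M c k = 0 :=
  if_neg (not_lt.2 hk)

theorem mem_Ioo_iff_abs_lt {M : ℕ} {k : ℤ} : k ∈ Finset.Ioo (-(M : ℤ)) M ↔ |k| < M := by
  rw [Finset.mem_Ioo, abs_lt]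

theorem summable_norm_trunc (M : ℕ) (c : ℤ → ℂ) : Summable fun k => ‖trunc M c k‖ :=
  summable_of_ne_finset_zero (s := Finset.Ioo (-(M : ℤ)) M) fun k hk => by
    rw [mem_Ioo_iff_abs_lt, not_lt] at hk
    rw [trunc_of_le hk, norm_zero]

theorem fser_trunc (M : ℕ) (c : ℤ → ℂ) (y : ℝ) :
    fser (trunc M c) y = ∑ k ∈ Finset.Ioo (-(M : ℤ)) M, c k * osc k y := by
  rw [fser, tsum_eq_sum (s := Finset.Ioo (-(M : ℤ)) M)]
  · refine Finset.sum_congr rfl fun k hk => ?_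
    rw [trunc_of_lt (mem_Ioo_iff_abs_lt.1 hk)]
  · intro k hk
    rw [mem_Ioo_iff_abs_lt, not_lt] at hk
    rw [trunc_of_le hk, zero_mul]

theorem SobLE.gnorm_fser_trunc_le {M : ℕ} (hM : 0 < M) {c : ℤ → ℂ} {B : ℝ} (h : SobLE 0 c B) :
    gnorm M (fser (_root_.trunc M c)) ≤ B := by
  refine le_of_sq_le_sq ?_ h.nonneg
  simp_rw [show fser (_root_.trunc M c) = fun y => ∑ k ∈ Finset.Ioo (-(M : ℤ)) M, c k * osc k y from
    funext fun y => fser_trunc M c y]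
  rw [gnorm_sum_osc_sq hM fun k hk l hl =>
    inj_mod_of_abs_lt (mem_Ioo_iff_abs_lt.1 hk) (mem_Ioo_iff_abs_lt.1 hl)]
  simpa using h.sum_le (Finset.Ioo (-(M : ℤ)) M)

theorem fdiff_fser {M : ℕ} {c : ℤ → ℂ} (hc : Summable fun k => ‖c k‖) (y : ℝ) :
    fdiff M (fser c) y = fser (fun k => (osc k (gstep M) - 1) * c k) y := by
  rw [fdiff, fser, fser, fser, ← (summable_fser hc _).tsum_sub (summable_fser hc _)]
  refine tsum_congr fun k => ?_
  rw [osc_add_right]; ring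

/-- The forward difference is the multiplier `e^{ikπ/M} - 1`, of size at most `π|k|/M`; after
scaling by `M` it costs one derivative, uniformly in `M`. -/
theorem SobLE.gnorm_fdiff_fser_trunc_le {M : ℕ} (hM : 0 < M) {c : ℤ → ℂ} {B : ℝ}
    (h : SobLE 1 c B) : M * gnorm M (fdiff M (fser (_root_.trunc M c))) ≤ π * B := by
  have hM' : (0 : ℝ) < M := by exact_mod_cast hM
  have h1 : fdiff M (fser (_root_.trunc M c)) =
      fser (_root_.trunc M fun k => (osc k (gstep M) - 1) * c k) := by
    ext y
    rw [fdiff_fser (summable_norm_trunc M c)]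
    congr 1
    ext k
    unfold _root_.trunc; split_ifs <;> simp
  have h2 : SobLE 0 (fun k => (osc k (gstep M) - 1) * c k) (π / M * B) := by
    refine SobLE.mul_multiplier (r := 1) h (by positivity) fun k => ?_
    refine (osc_sub_one_norm_le k _).trans ?_
    rw [gstep, abs_of_nonneg (by positivity : 0 ≤ π / M), mul_comm, pow_one]
    exact mul_le_mul_of_nonneg_left (abs_le_wt k) (by positivity)
  rw [h1]
  calc (M : ℝ) * _ ≤ M * (π / M * B) :=
        mul_le_mul_of_nonneg_left (h2.gnorm_fser_trunc_le hM) hM'.le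
    _ = π * B := by field_simp

/-- Bessel's inequality for the `2M - 1` frequencies `|k| < M`, one fewer than the dimension of the
space of grid functions. -/
theorem sobLE_zero_trunc_dft {M : ℕ} (hM : 0 < M) (g : ℝ → ℂ) :
    SobLE 0 (trunc M (dft M g)) (gnorm M g) := by
  refine SobLE.of_sum (gnorm_nonneg _ _) fun S => ?_
  have hb := (orthonormal_gvec_osc hM (S := Finset.Ioo (-(M : ℤ)) M) fun k hk l hl =>
    inj_mod_of_abs_lt (mem_Ioo_iff_abs_lt.1 hk) (mem_Ioo_iff_abs_lt.1 hl)).sum_inner_products_le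
    (gvec M g) (s := Finset.univ)
  simp_rw [← dft_eq_inner] at hb
  rw [Finset.sum_coe_sort (Finset.Ioo (-(M : ℤ)) M) (fun k => ‖dft M g k‖ ^ 2)] at hb
  simp only [pow_zero, one_mul]
  refine le_trans ?_ hb
  calc ∑ k ∈ S, ‖trunc M (dft M g) k‖ ^ 2
      = ∑ k ∈ S with |k| < (M : ℤ), ‖dft M g k‖ ^ 2 := by
        rw [Finset.sum_filter]
        refine Finset.sum_congr rfl fun k _ => ?_
        unfold trunc; split_ifs <;> simp
    _ ≤ _ := Finset.sum_le_sum_of_subset_of_nonneg (fun k hk =>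
        mem_Ioo_iff_abs_lt.2 (Finset.mem_filter.1 hk).2) fun _ _ _ => sq_nonneg _

theorem dft_fdiff {M : ℕ} (hM : 0 < M) {g : ℝ → ℂ} (hg : ∀ y, g (y + 2 * π) = g y) (k : ℤ) :
    dft M (fdiff M g) k = (osc k (gstep M) - 1) * dft M g k := by
  have hM' : (M : ℝ) ≠ 0 := by exact_mod_cast hM.ne'
  have h1 : ∑ j ∈ Finset.range (2 * M), g (j * gstep M + gstep M) * osc (-k) (j * gstep M) =
      osc k (gstep M) *
        ∑ j ∈ Finset.range (2 * M), g (j * gstep M) * osc (-k) (j * gstep M) := by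
    have e1 : ∀ j : ℕ, g (j * gstep M + gstep M) * osc (-k) (j * gstep M) =
        osc k (gstep M) *
          (g ((j + 1 : ℕ) * gstep M) * osc (-k) ((j + 1 : ℕ) * gstep M)) := fun j => by
      have : ((j + 1 : ℕ) : ℝ) * gstep M = j * gstep M + gstep M := by push_cast; ring
      rw [this, osc_add_right]
      have := osc_neg_mul_self k (gstep M)
      linear_combination (-(g (j * gstep M + gstep M) * osc (-k) (j * gstep M))) * this
    simp_rw [e1]
    rw [← Finset.mul_sum]
    congr 1
    have h2 := Finset.sum_range_succ'
      (fun j : ℕ => g (j * gstep M) * osc (-k) (j * gstep M)) (2 * M)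
    rw [Finset.sum_range_succ] at h2
    have h3 : ((2 * M : ℕ) : ℝ) * gstep M = 2 * π := by
      rw [gstep]; push_cast; field_simp
    have h4 : g (2 * π) = g 0 := by simpa using hg 0
    rw [h3, h4, osc_two_pi] at h2
    simp only [Nat.cast_zero, zero_mul, osc_zero_right] at h2
    exact (add_right_cancel h2).symm
  rw [dft, dft]
  simp only [fdiff, sub_mul, Finset.sum_sub_distrib]
  rw [h1]; ring

/-- Jordan's inequality `|sin x| ≥ 2|x|/π`; the restriction `|k| < M` keeps the half angle within
`[-π/2, π/2]`. -/
theorem le_norm_osc_gstep_sub_one {M : ℕ} (hM : 0 < M) {k : ℤ} (hk : |k| < M) :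
    2 * |(k : ℝ)| / M ≤ ‖osc k (gstep M) - 1‖ := by
  have hM' : (0 : ℝ) < M := by exact_mod_cast hM
  have hk' : |(k : ℝ)| < M := by exact_mod_cast hk
  rw [osc, mul_comm _ Complex.I, Complex.norm_exp_I_mul_ofReal_sub_one, Real.norm_eq_abs, abs_mul, abs_two]
  have h1 : |(k : ℝ) * gstep M / 2| = |(k : ℝ)| * π / (2 * M) := by
    rw [gstep, abs_div, abs_mul, abs_of_nonneg (by positivity : 0 ≤ π / M), abs_two]
    field_simp
  have h2 : |(k : ℝ) * gstep M / 2| ≤ π / 2 := by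
    rw [h1, div_le_div_iff₀ (by positivity) two_pos]
    nlinarith [Real.pi_pos]
  have h3 := Real.mul_abs_le_abs_sin h2
  rw [h1] at h3
  have h4 : 2 / π * (|(k : ℝ)| * π / (2 * M)) = |(k : ℝ)| / M := by
    have := Real.pi_pos.ne'
    field_simp
  rw [h4] at h3
  calc 2 * |(k : ℝ)| / M = 2 * (|(k : ℝ)| / M) := by ring
    _ ≤ _ := by linarith

/-- The converse of the difference bound: by Jordan's inequality the scaled forward difference
dominates `|k|` times each resolved coefficient, and Bessel's inequality is applied to the function
and to its difference. -/
theorem sobLE_one_trunc_dft {M : ℕ} (hM : 0 < M) {g : ℝ → ℂ} (hg : ∀ y, g (y + 2 * π) = g y) :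
    SobLE 1 (trunc M (dft M g)) (gnorm M g + M * gnorm M (fdiff M g)) := by
  have hM' : (0 : ℝ) < M := by exact_mod_cast hM
  have h0 := sobLE_zero_trunc_dft hM g
  have h1 := (sobLE_zero_trunc_dft hM (fdiff M g)).const_mul (M : ℂ)
  rw [Complex.norm_natCast] at h1
  have h2 : SobLE 0 (fun k => ((‖trunc M (dft M g) k‖ : ℝ) : ℂ) +
      ((‖(M : ℂ) * trunc M (dft M (fdiff M g)) k‖ : ℝ) : ℂ)) _ :=
    (h0.of_norm_le (c := fun k => ((‖trunc M (dft M g) k‖ : ℝ) : ℂ)) fun k => by simp).add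
    (h1.of_norm_le (c := fun k => ((‖(M : ℂ) * trunc M (dft M (fdiff M g)) k‖ : ℝ) : ℂ))
      fun k => by simp)
  have := h2.of_le (r := 1) (c := trunc M (dft M g)) zero_le_one fun k => ?_
  · simpa using this
  by_cases hk : |k| < (M : ℤ)
  · simp only [trunc_of_lt hk, pow_one, pow_zero, one_mul]
    rw [← Complex.ofReal_add, Complex.norm_real, Real.norm_of_nonneg (by positivity),
      dft_fdiff hM hg, norm_mul, norm_mul, Complex.norm_natCast, wt, add_mul, one_mul, ← mul_assoc]
    gcongr
    have := le_norm_osc_gstep_sub_one hM hk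
    rw [div_le_iff₀ hM'] at this
    have := abs_nonneg (k : ℝ)
    linarith
  · simp [trunc_of_le (not_lt.1 hk)]

theorem dft_fser_trunc {M : ℕ} (hM : 0 < M) (c : ℤ → ℂ) :
    trunc M (dft M (fser (trunc M c))) = trunc M c := by
  ext l
  by_cases hl : |l| < (M : ℤ)
  · rw [trunc_of_lt hl, trunc_of_lt hl, dft_eq_inner]
    have h1 : gvec M (fser (trunc M c)) =
        ∑ k : Finset.Ioo (-(M : ℤ)) M, c k • gvec M (osc k) := by
      ext j
      simp [gvec, fser_trunc]
      rw [← Finset.sum_coe_sort (Finset.Ioo (-(M : ℤ)) M), Finset.mul_sum]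
      refine Finset.sum_congr rfl fun k _ => ?_
      ring
    have h2 := (orthonormal_gvec_osc hM (S := Finset.Ioo (-(M : ℤ)) M) fun k hk l hl =>
      inj_mod_of_abs_lt (mem_Ioo_iff_abs_lt.1 hk) (mem_Ioo_iff_abs_lt.1 hl)).inner_right_sum
      (fun k => c k) (Finset.mem_univ ⟨l, mem_Ioo_iff_abs_lt.2 hl⟩)
    rw [h1]; exact h2
  · rw [trunc_of_le (not_lt.1 hl), trunc_of_le (not_lt.1 hl)]

/-- Frequencies are grouped in blocks `[2Mr, 2M(r+1))`. Outside `|k| < M` one has `|k| ≥ M|r|`,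
where only the block `r = -1` needs the assumption `|k| ≥ M` for this. -/
theorem wt_ge_of_block {M : ℕ} (hM : 0 < M) {k : ℤ} (hk : (M : ℤ) ≤ |k|) :
    (M : ℝ) / 2 * wt (k / (2 * M : ℕ)) ≤ wt k := by
  have h2 : (0 : ℤ) < (2 * M : ℕ) := by positivity
  set r := k / ((2 * M : ℕ) : ℤ) with hr
  have e1 : ((2 * M : ℕ) : ℤ) * r ≤ k := Int.mul_ediv_self_le h2.ne'
  have e2 : k < ((2 * M : ℕ) : ℤ) * r + (2 * M : ℕ) := Int.lt_mul_ediv_self_add h2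
  have e3 : (M : ℤ) * |r| ≤ |k| := by
    push_cast at e1 e2
    rcases lt_trichotomy r (-1) with h | h | h
    · rw [abs_of_neg (by omega : r < 0)]
      have : -k ≤ |k| := neg_le_abs k
      nlinarith
    · rw [h]; simpa using hk
    · rw [abs_of_nonneg (by omega : 0 ≤ r)]
      have : k ≤ |k| := le_abs_self k
      have : (0 : ℤ) ≤ M * r := mul_nonneg (by positivity) (by omega)
      nlinarith
  have e4 : (M : ℝ) * |(r : ℝ)| ≤ |(k : ℝ)| := by exact_mod_cast e3
  have e5 : (M : ℝ) ≤ |(k : ℝ)| := by exact_mod_cast hk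
  unfold wt
  nlinarith

/-- Aliasing: the grid values of a series with high frequencies only are small. -/
theorem SobLE.gnorm_fser_le_of_high {M m : ℕ} (hM : 0 < M) (hm : 2 ≤ m) {d : ℤ → ℂ} {B : ℝ}
    (h : SobLE m d B) (hd : ∀ k, |k| < (M : ℤ) → d k = 0) :
    gnorm M (fser d) ≤ 2 ^ m * embConst ^ 2 * B / M ^ m := by
  have hM' : (0 : ℝ) < M := by exact_mod_cast hM
  have hB := h.nonneg
  have hs := h.summable_norm (by omega)
  have h2 : (0 : ℤ) < (2 * M : ℕ) := by positivity
  have hfin : ∀ S : Finset ℤ, gnorm M (fun y => ∑ k ∈ S, d k * osc k y) ≤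
      2 ^ m * embConst ^ 2 * B / M ^ m := by
    intro S
    -- Within one block all residues modulo `2M` differ, so orthogonality on the grid gives the
    -- exact norm of its contribution. The block bounds carry the factor `1 / wt r ^ 2` and are
    -- summed over `r`.
    let q : ℤ → ℤ := fun k => k / ((2 * M : ℕ) : ℤ)
    have hblock : ∀ r : ℤ, gnorm M (fun y => ∑ k ∈ S with q k = r, d k * osc k y) ≤
        (2 / M) ^ m * B * (wt r ^ 2)⁻¹ := by
      intro r
      have hw := wt_pos r
      refine le_of_sq_le_sq ?_ (by positivity)
      rw [gnorm_sum_osc_sq hM]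
      · calc ∑ k ∈ S with q k = r, ‖d k‖ ^ 2
            ≤ ∑ k ∈ S with q k = r, ((2 / M) ^ m * (wt r ^ 2)⁻¹) ^ 2 * (wt k ^ m * ‖d k‖) ^ 2 := by
              refine Finset.sum_le_sum fun k hk => ?_
              rw [← mul_pow]
              refine pow_le_pow_left₀ (norm_nonneg _) ?_ 2
              by_cases hkM : |k| < (M : ℤ)
              · rw [hd k hkM]; simp
              rw [← mul_assoc]
              refine le_mul_of_one_le_left (norm_nonneg _) ?_
              have hb := wt_ge_of_block hM (not_lt.1 hkM)
              rw [show k / ((2 * M : ℕ) : ℤ) = r from (Finset.mem_filter.1 hk).2] at hb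
              have hb2 : (M / 2 * wt r) ^ m ≤ wt k ^ m := pow_le_pow_left₀ (by positivity) hb m
              have hb3 : wt r ^ 2 ≤ wt r ^ m := pow_le_pow_right₀ (one_le_wt r) hm
              calc (1 : ℝ) = (2 / M) ^ m * (wt r ^ 2)⁻¹ * ((M / 2) ^ m * wt r ^ 2) := by
                    rw [div_pow, div_pow]; field_simp
                _ ≤ (2 / M) ^ m * (wt r ^ 2)⁻¹ * ((M / 2) ^ m * wt r ^ m) := by gcongr
                _ ≤ _ := by rw [← mul_pow]; gcongr
          _ ≤ ((2 / M) ^ m * (wt r ^ 2)⁻¹) ^ 2 * B ^ 2 := by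
              rw [← Finset.mul_sum]
              exact mul_le_mul_of_nonneg_left (h.sum_le _) (sq_nonneg _)
          _ = _ := by ring
      · intro k hk l hl hdvd
        have hk := (Finset.mem_filter.1 hk).2
        have hl := (Finset.mem_filter.1 hl).2
        simp only [q] at hk hl
        have e1 := Int.mul_ediv_add_emod k ((2 * M : ℕ) : ℤ)
        have e2 := Int.mul_ediv_add_emod l ((2 * M : ℕ) : ℤ)
        have e4 : k % ((2 * M : ℕ) : ℤ) = l % ((2 * M : ℕ) : ℤ) :=
          Int.emod_eq_emod_iff_emod_sub_eq_zero.2 (Int.emod_eq_zero_of_dvd hdvd)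
        rw [← e1, ← e2, hk, hl, e4]
    have hsplit : ∀ T : Finset ℤ, gnorm M (fun y => ∑ r ∈ T, ∑ k ∈ S with q k = r, d k * osc k y) ≤
        ∑ r ∈ T, (2 / M) ^ m * B * (wt r ^ 2)⁻¹ := by
      intro T
      induction T using Finset.induction_on with
      | empty => simpa using gnorm_le_const hM le_rfl (f := fun _ => 0) (by simp)
      | insert r T hr ih =>
        simp only [Finset.sum_insert hr]
        exact (gnorm_add_le _ _ _).trans (add_le_add (hblock r) ih)
    have := hsplit (S.image q)
    simp_rw [Finset.sum_fiberwise_of_maps_to fun k hk => Finset.mem_image_of_mem q hk] at this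
    refine this.trans ?_
    rw [← Finset.mul_sum]
    calc (2 / M) ^ m * B * ∑ r ∈ S.image q, (wt r ^ 2)⁻¹ ≤ (2 / M) ^ m * B * embConst ^ 2 :=
          mul_le_mul_of_nonneg_left (sum_wt_neg_two_le _) (by positivity)
      _ = _ := by rw [div_pow]; ring
  -- The grid norm involves finitely many points, so pointwise convergence of the partial sums is
  -- enough to pass to the limit.
  have hlim : Tendsto (fun S : Finset ℤ => gnorm M (fun y => ∑ k ∈ S, d k * osc k y)) atTop
      (𝓝 (gnorm M (fser d))) := by
    refine Tendsto.norm ((PiLp.continuous_toLp 2 _).continuousAt.tendsto.comp ?_)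
    refine tendsto_pi_nhds.2 fun j => ?_
    have : Tendsto (fun S : Finset ℤ => ∑ k ∈ S, d k * osc k ((j : ℕ) * gstep M)) atTop
      (𝓝 (fser d ((j : ℕ) * gstep M))) := (summable_fser hs _).hasSum
    exact this.const_smul _
  exact le_of_tendsto hlim (Eventually.of_forall hfin)

/-! ### Families of sequences depending on time -/

/-- The family `x` is bounded in the norm of order `s` on `[0, T]`. -/
def FamBdd (T : ℝ) (s : ℕ) (x : ℝ → ℤ → ℂ) : Prop :=
  ∃ C, 0 ≤ C ∧ ∀ t ∈ Icc 0 T, SobLE s (x t) C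

/-- The family `x` is Lipschitz in time in the norm of order `s`. -/
def FamLip (T : ℝ) (s : ℕ) (x : ℝ → ℤ → ℂ) : Prop :=
  ∃ C, 0 ≤ C ∧ ∀ t ∈ Icc 0 T, ∀ t' ∈ Icc 0 T, SobLE s (fun k => x t k - x t' k) (C * |t - t'|)

/-- The second symmetric time differences of `x` are `O(σ²)` in the norm of order `s`. -/
def FamSec (T : ℝ) (s : ℕ) (x : ℝ → ℤ → ℂ) : Prop :=
  ∃ C, 0 ≤ C ∧ ∀ t σ, 0 ≤ σ → t - σ ∈ Icc 0 T → t + σ ∈ Icc 0 T →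
    SobLE s (fun k => x (t + σ) k + x (t - σ) k - 2 * x t k) (C * σ ^ 2)

theorem mem_Icc_of_sub_add {T t σ : ℝ} (hσ : 0 ≤ σ) (h1 : t - σ ∈ Icc 0 T) (h2 : t + σ ∈ Icc 0 T) :
    t ∈ Icc 0 T := ⟨by linarith [h1.1], by linarith [h2.2]⟩

section fam

variable {T : ℝ} {s r : ℕ} {x y : ℝ → ℤ → ℂ}

theorem FamBdd.weaken (h : FamBdd T s x) (hr : r ≤ s) : FamBdd T r x := by
  obtain ⟨C, hC, h⟩ := h
  exact ⟨C, hC, fun t ht => (h t ht).weaken hr⟩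

theorem FamLip.weaken (h : FamLip T s x) (hr : r ≤ s) : FamLip T r x := by
  obtain ⟨C, hC, h⟩ := h
  exact ⟨C, hC, fun t ht t' ht' => (h t ht t' ht').weaken hr⟩

theorem FamBdd.add (hx : FamBdd T s x) (hy : FamBdd T s y) :
    FamBdd T s (fun t k => x t k + y t k) := by
  obtain ⟨C, hC, hx⟩ := hx
  obtain ⟨D, hD, hy⟩ := hy
  exact ⟨C + D, by positivity, fun t ht => (hx t ht).add (hy t ht)⟩

theorem FamLip.add (hx : FamLip T s x) (hy : FamLip T s y) :
    FamLip T s (fun t k => x t k + y t k) := by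
  obtain ⟨C, hC, hx⟩ := hx
  obtain ⟨D, hD, hy⟩ := hy
  refine ⟨C + D, by positivity, fun t ht t' ht' => ?_⟩
  have := (hx t ht t' ht').add (hy t ht t' ht')
  convert this using 1
  · ext k; ring
  · ring

theorem FamSec.add (hx : FamSec T s x) (hy : FamSec T s y) :
    FamSec T s (fun t k => x t k + y t k) := by
  obtain ⟨C, hC, hx⟩ := hx
  obtain ⟨D, hD, hy⟩ := hy
  refine ⟨C + D, by positivity, fun t σ hσ h1 h2 => ?_⟩
  have := (hx t σ hσ h1 h2).add (hy t σ hσ h1 h2)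
  convert this using 1
  · ext k; ring
  · ring

theorem FamBdd.const_mul (hx : FamBdd T s x) (z : ℂ) : FamBdd T s (fun t k => z * x t k) := by
  obtain ⟨C, hC, hx⟩ := hx
  exact ⟨‖z‖ * C, by positivity, fun t ht => (hx t ht).const_mul z⟩

theorem FamLip.const_mul (hx : FamLip T s x) (z : ℂ) : FamLip T s (fun t k => z * x t k) := by
  obtain ⟨C, hC, hx⟩ := hx
  refine ⟨‖z‖ * C, by positivity, fun t ht t' ht' => ?_⟩
  have := (hx t ht t' ht').const_mul z
  convert this using 1
  · ext k; ring
  · ring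

theorem FamSec.const_mul (hx : FamSec T s x) (z : ℂ) : FamSec T s (fun t k => z * x t k) := by
  obtain ⟨C, hC, hx⟩ := hx
  refine ⟨‖z‖ * C, by positivity, fun t σ hσ h1 h2 => ?_⟩
  have := (hx t σ hσ h1 h2).const_mul z
  convert this using 1
  · ext k; ring
  · ring

theorem FamBdd.cbar (hx : FamBdd T s x) : FamBdd T s (fun t => cbar (x t)) := by
  obtain ⟨C, hC, hx⟩ := hx
  exact ⟨C, hC, fun t ht => (hx t ht).cbar⟩

theorem FamLip.cbar (hx : FamLip T s x) : FamLip T s (fun t => cbar (x t)) := by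
  obtain ⟨C, hC, hx⟩ := hx
  refine ⟨C, hC, fun t ht t' ht' => ?_⟩
  have := (hx t ht t' ht').cbar
  convert this using 1
  ext k; simp [_root_.cbar]

theorem FamSec.cbar (hx : FamSec T s x) : FamSec T s (fun t => cbar (x t)) := by
  obtain ⟨C, hC, hx⟩ := hx
  refine ⟨C, hC, fun t σ hσ h1 h2 => ?_⟩
  have := (hx t σ hσ h1 h2).cbar
  convert this using 1
  ext k
  simp only [_root_.cbar, map_sub, map_add, map_mul, Complex.conj_ofNat]

theorem FamBdd.conv (hs : 1 ≤ s) (hx : FamBdd T s x) (hy : FamBdd T s y) :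
    FamBdd T s (fun t => conv (x t) (y t)) := by
  obtain ⟨C, hC, hx⟩ := hx
  obtain ⟨D, hD, hy⟩ := hy
  have := embConst_nonneg
  exact ⟨2 ^ (s + 1) * embConst * C * D, by positivity, fun t ht => (hx t ht).conv hs (hy t ht)⟩

theorem FamLip.conv (hs : 1 ≤ s) (hx : FamBdd T s x) (hy : FamBdd T s y) (hx' : FamLip T s x)
    (hy' : FamLip T s y) : FamLip T s (fun t => conv (x t) (y t)) := by
  obtain ⟨C, hC, hx⟩ := hx
  obtain ⟨D, hD, hy⟩ := hy
  obtain ⟨C', hC', hx'⟩ := hx'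
  obtain ⟨D', hD', hy'⟩ := hy'
  have := embConst_nonneg
  refine ⟨2 ^ (s + 1) * embConst * (C' * D + C * D'), by positivity, fun t ht t' ht' => ?_⟩
  have h := ((hx' t ht t' ht').conv hs (hy t ht)).add ((hx t' ht').conv hs (hy' t ht t' ht'))
  convert h using 1
  · ext k
    rw [conv_sub_left ((hx t ht).summable_norm hs) ((hx t' ht').summable_norm hs)
      ((hy t ht).summable_norm hs), conv_sub_right ((hx t' ht').summable_norm hs)
      ((hy t ht).summable_norm hs) ((hy t' ht').summable_norm hs)]
    ring
  · ring

theorem conv_const_mul_left (z : ℂ) (c d : ℤ → ℂ) (k : ℤ) :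
    conv (fun k => z * c k) d k = z * conv c d k := by
  unfold conv
  rw [← tsum_mul_left]
  exact tsum_congr fun j => by ring

/-- The discrete Leibniz rule: the second symmetric difference of a product consists of the second
difference of one factor times the other factor at `t`, twice, and the products of the forward
increments and of the backward increments. -/
theorem FamSec.conv (hs : 1 ≤ s) (hx : FamBdd T s x) (hy : FamBdd T s y) (hx' : FamLip T s x)
    (hy' : FamLip T s y) (hx'' : FamSec T s x) (hy'' : FamSec T s y) :
    FamSec T s (fun t => conv (x t) (y t)) := by
  obtain ⟨C, hC, hx⟩ := hx
  obtain ⟨D, hD, hy⟩ := hy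
  obtain ⟨C', hC', hx'⟩ := hx'
  obtain ⟨D', hD', hy'⟩ := hy'
  obtain ⟨C'', hC'', hx''⟩ := hx''
  obtain ⟨D'', hD'', hy''⟩ := hy''
  have := embConst_nonneg
  refine ⟨2 ^ (s + 1) * embConst * (C'' * D + 2 * C' * D' + C * D''), by positivity,
    fun t σ hσ h1 h2 => ?_⟩
  have h0 := mem_Icc_of_sub_add hσ h1 h2
  have a1 : |t + σ - t| = σ := by rw [add_sub_cancel_left, abs_of_nonneg hσ]
  have a2 : |t - σ - t| = σ := by rw [sub_sub_cancel_left, abs_neg, abs_of_nonneg hσ]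
  have k1 := hx' _ h2 _ h0
  have k2 := hx' _ h1 _ h0
  have l1 := hy' _ h2 _ h0
  have l2 := hy' _ h1 _ h0
  rw [a1] at k1 l1
  rw [a2] at k2 l2
  have h := ((((hx'' t σ hσ h1 h2).conv hs (hy t h0)).add (k1.conv hs l1)).add
    (k2.conv hs l2)).add ((hx t h0).conv hs (hy'' t σ hσ h1 h2))
  have sx0 := (hx t h0).summable_norm hs
  have sx1 := (hx _ h1).summable_norm hs
  have sx2 := (hx _ h2).summable_norm hs
  have sy0 := (hy t h0).summable_norm hs
  have sy1 := (hy _ h1).summable_norm hs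
  have sy2 := (hy _ h2).summable_norm hs
  have tx0 : Summable fun k => ‖(2 : ℂ) * x t k‖ := by simpa using sx0.mul_left 2
  have ty0 : Summable fun k => ‖(2 : ℂ) * y t k‖ := by simpa using sy0.mul_left 2
  have tx12 := (((hx _ h2).add (hx _ h1)).summable_norm hs)
  have ty12 := (((hy _ h2).add (hy _ h1)).summable_norm hs)
  have ly1 := (l1.summable_norm hs)
  have ly2 := (l2.summable_norm hs)
  convert h using 1
  · ext k
    rw [conv_sub_left tx12 tx0 sy0, conv_add_left sx2 sx1 sy0, conv_const_mul_left,
      conv_sub_right sx0 ty12 ty0, conv_add_right sx0 sy2 sy1, conv_comm (x t) (fun k => 2 * y t k),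
      conv_const_mul_left, conv_comm (y t) (x t), conv_sub_left sx2 sx0 ly1,
      conv_sub_left sx1 sx0 ly2, conv_sub_right sx2 sy2 sy0, conv_sub_right sx0 sy2 sy0,
      conv_sub_right sx1 sy1 sy0, conv_sub_right sx0 sy1 sy0]
    ring
  · ring

theorem FamBdd.const {c : ℤ → ℂ} {B : ℝ} (hc : SobLE s c B) : FamBdd T s fun _ => c :=
  ⟨B, hc.nonneg, fun _ _ => hc⟩

theorem sobLE_zero (s : ℕ) : SobLE s (fun _ => 0) 0 :=
  SobLE.of_sum le_rfl fun S => by simp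

theorem FamLip.const (c : ℤ → ℂ) : FamLip T s fun _ => c :=
  ⟨0, le_rfl, fun t _ t' _ => by simpa using sobLE_zero s⟩

theorem FamSec.const (c : ℤ → ℂ) : FamSec T s fun _ => c :=
  ⟨0, le_rfl, fun t σ _ _ _ => by
    have : (fun k => c k + c k - 2 * c k) = fun _ => (0 : ℂ) := by ext k; ring
    simpa [this] using sobLE_zero s⟩

end fam

/-- The Fourier coefficients of `V u + β |u|² u`, where `v` and `c` are those of `V` and `u`. -/
noncomputable def nonlin (v : ℤ → ℂ) (β : ℝ) (c : ℤ → ℂ) (k : ℤ) : ℂ :=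
  conv v c k + β * conv (conv c (cbar c)) c k

section nonlin

variable {T β : ℝ} {s : ℕ} {v : ℤ → ℂ} {B : ℝ} {c : ℝ → ℤ → ℂ}

theorem FamBdd.nonlin (hs : 1 ≤ s) (hv : SobLE s v B) (hc : FamBdd T s c) :
    FamBdd T s fun t => nonlin v β (c t) :=
  ((FamBdd.const hv).conv hs hc).add (((hc.conv hs hc.cbar).conv hs hc).const_mul β)

theorem FamLip.nonlin (hs : 1 ≤ s) (hv : SobLE s v B) (hc : FamBdd T s c) (hc' : FamLip T s c) :
    FamLip T s fun t => nonlin v β (c t) :=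
  (FamLip.conv hs (FamBdd.const hv) hc (FamLip.const v) hc').add
    ((FamLip.conv hs (hc.conv hs hc.cbar) hc (FamLip.conv hs hc hc.cbar hc' hc'.cbar)
      hc').const_mul β)

theorem FamSec.nonlin (hs : 1 ≤ s) (hv : SobLE s v B) (hc : FamBdd T s c) (hc' : FamLip T s c)
    (hc'' : FamSec T s c) : FamSec T s fun t => nonlin v β (c t) :=
  (FamSec.conv hs (FamBdd.const hv) hc (FamLip.const v) hc' (FamSec.const v) hc'').add
    ((FamSec.conv hs (hc.conv hs hc.cbar) hc (FamLip.conv hs hc hc.cbar hc' hc'.cbar)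
      hc' (FamSec.conv hs hc hc.cbar hc' hc'.cbar hc'' hc''.cbar) hc'').const_mul β)

end nonlin

/-! ### Time regularity of the exact solution -/

section derivative

variable {T : ℝ} {s : ℕ} {x x' : ℝ → ℤ → ℂ}

theorem FamLip.of_hasDerivAt (hc : ∀ k, ContinuousOn (fun t => x t k) (Icc 0 T))
    (hd : ∀ k, ∀ t ∈ Ioo 0 T, HasDerivAt (fun t => x t k) (x' t k) t) (hb : FamBdd T s x') :
    FamLip T s x := by
  obtain ⟨C, hC, hb⟩ := hb
  have key : ∀ t ∈ Icc 0 T, ∀ t' ∈ Icc 0 T, t' ≤ t →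
      SobLE s (fun k => x t k - x t' k) (C * (t - t')) := by
    intro t ht t' ht' h
    have := SobLE.sub_of_hasDerivAt (s := s) (x := fun r => x (t' + r)) (x' := fun r => x' (t' + r))
      (σ := t - t') (B := C) (by linarith) (fun k => ?_) (fun k r hr => ?_) (fun r hr => ?_)
    · simpa using this
    · refine (hc k).comp (by fun_prop) fun r hr => ?_
      exact ⟨by linarith [hr.1, ht'.1], by linarith [hr.2, ht.2]⟩
    · exact (hd k (t' + r) ⟨by linarith [hr.1, ht'.1], by linarith [hr.2, ht.2]⟩).comp_const_add
        t' r
    · exact hb _ ⟨by linarith [hr.1, ht'.1], by linarith [hr.2, ht.2]⟩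
  refine ⟨C, hC, fun t ht t' ht' => ?_⟩
  rcases le_total t' t with h | h
  · rw [abs_of_nonneg (sub_nonneg.2 h)]; exact key t ht t' ht' h
  · rw [abs_of_nonpos (sub_nonpos.2 h), neg_sub]
    exact (key t' ht' t ht h).of_norm_le fun k => by rw [norm_sub_rev]

/-- The function `r ↦ x(t + r) + x(t - r)` has derivative `x'(t + r) - x'(t - r)`, of size `O(r)`
when `x'` is Lipschitz. Hence no second derivative of `x` is required. -/
theorem FamSec.of_hasDerivAt (hc : ∀ k, ContinuousOn (fun t => x t k) (Icc 0 T))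
    (hd : ∀ k, ∀ t ∈ Ioo 0 T, HasDerivAt (fun t => x t k) (x' t k) t) (hb : FamLip T s x') :
    FamSec T s x := by
  obtain ⟨C, hC, hb⟩ := hb
  refine ⟨2 * C, by positivity, fun t σ hσ h1 h2 => ?_⟩
  have := SobLE.sub_of_hasDerivAt (s := s) (x := fun r k => x (t + r) k + x (t - r) k)
      (x' := fun r k => x' (t + r) k - x' (t - r) k)
      (σ := σ) (B := C * (2 * σ)) hσ (fun k => ?_) (fun k r hr => ?_) (fun r hr => ?_)
  · convert this using 1
    · ext k; simp; ring
    · ring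
  · refine ((hc k).comp (by fun_prop) fun r hr => ?_).add
      ((hc k).comp (f := fun r => t - r) (by fun_prop) fun r hr => ?_)
    · exact ⟨by linarith [hr.1, h1.1], by linarith [hr.2, h2.2]⟩
    · exact ⟨by linarith [hr.2, h1.1], by linarith [hr.1, h2.2]⟩
  · have d1 := (hd k (t + r) ⟨by linarith [hr.1, h1.1], by linarith [hr.2, h2.2]⟩).comp_const_add t r
    have d2 := (hd k (t - r) ⟨by linarith [hr.2, h1.1], by linarith [hr.1, h2.2]⟩).comp_const_sub t r
    exact (d1.add d2).congr_deriv (sub_eq_add_neg _ _).symm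
  · refine (hb (t + r) ⟨by linarith [hr.1, h1.1], by linarith [hr.2, h2.2]⟩ (t - r)
      ⟨by linarith [hr.2, h1.1], by linarith [hr.1, h2.2]⟩).mono ?_
    rw [show t + r - (t - r) = 2 * r by ring, abs_of_pos (by linarith [hr.1])]
    have := hr.2
    gcongr

end derivative

/-- The symbol `e^{iκk²r}` of the backward free evolution. -/
noncomputable def phase (κ r : ℝ) (k : ℤ) : ℂ := Complex.exp (((κ * k ^ 2 * r : ℝ) : ℂ) * Complex.I)

theorem norm_phase (κ r : ℝ) (k : ℤ) : ‖phase κ r k‖ = 1 := Complex.norm_exp_ofReal_mul_I _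

theorem phase_neg_mul (κ r : ℝ) (k : ℤ) : phase κ (-r) k * phase κ r k = 1 := by
  rw [phase, phase, ← Complex.exp_add, ← add_mul, ← Complex.ofReal_add]
  simp

theorem phase_index_neg (κ r : ℝ) (k : ℤ) : phase κ r (-k) = phase κ r k := by simp [phase]

theorem hasDerivAt_phase (κ r : ℝ) (k : ℤ) :
    HasDerivAt (fun r => phase κ r k) (Complex.I * (κ * k ^ 2) * phase κ r k) r := by
  have h : HasDerivAt (fun r : ℝ => ((κ * k ^ 2 * r : ℝ) : ℂ) * Complex.I)
      (((κ * k ^ 2 * 1 : ℝ) : ℂ) * Complex.I) r :=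
    (((hasDerivAt_id r).const_mul (κ * (k : ℝ) ^ 2)).ofReal_comp).mul_const Complex.I
  have := h.cexp
  unfold phase
  convert this using 1
  push_cast; ring

theorem hasDerivAt_phase_neg (κ r : ℝ) (k : ℤ) : HasDerivAt (fun r : ℝ => phase κ (-r) k)
    (-(Complex.I * (κ * k ^ 2) * phase κ (-r) k)) r :=
  ((hasDerivAt_phase κ (-r) k).scomp r (hasDerivAt_neg r)).congr_deriv (by simp)

theorem sq_abs_le_wt (k : ℤ) : (k : ℝ) ^ 2 ≤ wt k ^ 2 := by
  rw [← sq_abs]; exact pow_le_pow_left₀ (abs_nonneg _) (abs_le_wt k) 2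

theorem norm_phase_sub_one_le {κ r : ℝ} (hκ : 0 ≤ κ) (k : ℤ) :
    ‖phase κ r k - 1‖ ≤ κ * |r| * wt k ^ 2 := by
  have := Real.norm_exp_I_mul_ofReal_sub_one_le (x := κ * (k : ℝ) ^ 2 * r)
  rw [phase, mul_comm _ Complex.I]
  refine this.trans ?_
  rw [Real.norm_eq_abs, abs_mul, abs_of_nonneg (by positivity : 0 ≤ κ * (k : ℝ) ^ 2)]
  have := sq_abs_le_wt k
  calc κ * (k : ℝ) ^ 2 * |r| ≤ κ * wt k ^ 2 * |r| := by gcongr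
    _ = _ := by ring

/-- For unimodular `z` one has `z + z⁻¹ - 2 = (z - 1)(1 - z⁻¹)`, and each factor costs two
derivatives and gains one power of `r`. -/
theorem norm_phase_add_phase_neg_le {κ r : ℝ} (hκ : 0 ≤ κ) (k : ℤ) :
    ‖phase κ r k + phase κ (-r) k - 2‖ ≤ (κ ^ 2 * r ^ 2) * wt k ^ 4 := by
  have h1 : phase κ r k + phase κ (-r) k - 2 = (phase κ r k - 1) * (1 - phase κ (-r) k) := by
    have := phase_neg_mul κ r k
    linear_combination this
  rw [h1, norm_mul, norm_sub_rev 1]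
  have h2 := norm_phase_sub_one_le (r := r) hκ k
  have h3 := norm_phase_sub_one_le (r := -r) hκ k
  rw [abs_neg] at h3
  calc _ ≤ (κ * |r| * wt k ^ 2) * (κ * |r| * wt k ^ 2) := by gcongr
    _ = κ ^ 2 * |r| ^ 2 * wt k ^ 4 := by ring
    _ = _ := by rw [sq_abs]

section exact

variable {T κ : ℝ} {c F : ℝ → ℤ → ℂ}

/-- Error of the midpoint rule in the variation of constants formula. -/
theorem midpoint_error (hκ : 0 ≤ κ) (hc : ∀ k, ContinuousOn (fun t => c t k) (Icc 0 T))
    (hd : ∀ k, ∀ t ∈ Ioo 0 T,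
      HasDerivAt (fun t => c t k) (-Complex.I * (κ * k ^ 2 * c t k + F t k)) t)
    (hF5 : FamBdd T 5 F) (hF3 : FamLip T 3 F) (hF1 : FamSec T 1 F) :
    ∃ C, 0 ≤ C ∧ ∀ t σ, 0 ≤ σ → t - σ ∈ Icc 0 T → t + σ ∈ Icc 0 T →
      SobLE 1 (fun k => phase κ σ k * c (t + σ) k - phase κ (-σ) k * c (t - σ) k +
        2 * Complex.I * σ * F t k) (C * σ ^ 3) := by
  obtain ⟨C5, hC5, h5⟩ := hF5
  obtain ⟨C3, hC3, h3⟩ := hF3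
  obtain ⟨C1, hC1, h1⟩ := hF1
  refine ⟨κ ^ 2 * C5 + 2 * (κ * C3) + C1, by positivity, fun t σ hσ hm hp => ?_⟩
  have h0 := mem_Icc_of_sub_add hσ hm hp
  -- The phases are integrating factors, so the unbounded term `κk²c` drops out of the
  -- `r`-derivative. What remains splits into four terms of size `O(r²)` in order 1: the second
  -- difference of the phase (four derivatives of `F`), two products of a phase increment with a
  -- time increment of `F` (two derivatives), and the second difference of `F`. This explains the
  -- orders 5, 3 and 1 in the hypotheses.
  have := SobLE.sub_of_hasDerivAt (s := 1)
    (x := fun r k => phase κ r k * c (t + r) k - phase κ (-r) k * c (t - r) k +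
        2 * Complex.I * r * F t k)
    (x' := fun r k => -Complex.I * ((phase κ r k + phase κ (-r) k - 2) * F t k +
      (phase κ r k - 1) * (F (t + r) k - F t k) + (phase κ (-r) k - 1) * (F (t - r) k - F t k) +
      (F (t + r) k + F (t - r) k - 2 * F t k)))
    (σ := σ) (B := (κ ^ 2 * C5 + 2 * (κ * C3) + C1) * σ ^ 2) hσ (fun k => ?_) (fun k r hr => ?_)
    (fun r hr => ?_)
  · convert this using 1
    · ext k; simp [phase]
    · ring
  · have c1 : ContinuousOn (fun r => phase κ r k) (Icc 0 σ) := fun r _ =>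
      (hasDerivAt_phase κ r k).continuousAt.continuousWithinAt
    have c2 : ContinuousOn (fun r => phase κ (-r) k) (Icc 0 σ) := fun r _ =>
      ((hasDerivAt_phase κ (-r) k).continuousAt.comp (f := fun r : ℝ => -r)
        continuous_neg.continuousAt).continuousWithinAt
    refine ((c1.mul ((hc k).comp (by fun_prop) fun r hr => ?_)).sub
      (c2.mul ((hc k).comp (f := fun r => t - r) (by fun_prop) fun r hr => ?_))).add (by fun_prop)
    · exact ⟨by linarith [hr.1, hm.1], by linarith [hr.2, hp.2]⟩
    · exact ⟨by linarith [hr.2, hm.1], by linarith [hr.1, hp.2]⟩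
  · have d1 := (hd k (t + r) ⟨by linarith [hr.1, hm.1], by linarith [hr.2, hp.2]⟩).comp_const_add t r
    have d2 := (hd k (t - r) ⟨by linarith [hr.2, hm.1], by linarith [hr.1, hp.2]⟩).comp_const_sub t r
    have e2 : HasDerivAt (fun r : ℝ => phase κ (-r) k)
        (-(Complex.I * (κ * k ^ 2) * phase κ (-r) k)) r := hasDerivAt_phase_neg κ r k
    have e3 : HasDerivAt (fun r : ℝ => 2 * Complex.I * (r : ℂ) * F t k)
        (2 * Complex.I * ((1 : ℝ) : ℂ) * F t k) r :=
      (((hasDerivAt_id r).ofReal_comp).const_mul (2 * Complex.I)).mul_const (F t k)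
    refine ((((hasDerivAt_phase κ r k).mul d1).sub (e2.mul d2)).add e3).congr_deriv ?_
    push_cast; ring
  · have hrp : t + r ∈ Icc 0 T := ⟨by linarith [hr.1, hm.1], by linarith [hr.2, hp.2]⟩
    have hrm : t - r ∈ Icc 0 T := ⟨by linarith [hr.2, hm.1], by linarith [hr.1, hp.2]⟩
    have hr0 := hr.1.le
    have a1 := SobLE.mul_multiplier (s := 1) (r := 4) (h5 t h0) (by positivity)
      (norm_phase_add_phase_neg_le (r := r) hκ)
    have a2 := SobLE.mul_multiplier (s := 1) (r := 2) (h3 _ hrp t h0) (by positivity)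
      (norm_phase_sub_one_le (r := r) hκ)
    have a3 := SobLE.mul_multiplier (s := 1) (r := 2) (h3 _ hrm t h0) (by positivity)
      (norm_phase_sub_one_le (r := -r) hκ)
    have a4 := h1 t r hr0 hrm hrp
    have := (((a1.add a2).add a3).add a4).const_mul (-Complex.I)
    refine this.mono ?_
    rw [add_sub_cancel_left, sub_sub_cancel_left, abs_neg, abs_of_nonneg hr0, norm_neg,
      Complex.norm_I, one_mul]
    calc _ = (κ ^ 2 * C5 + 2 * (κ * C3) + C1) * r ^ 2 := by ring
      _ ≤ _ := by have := hr.2.le; gcongr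

/-- The half step backwards from the midpoint, to second order. -/
theorem half_step_error (hκ : 0 ≤ κ) (hc : ∀ k, ContinuousOn (fun t => c t k) (Icc 0 T))
    (hd : ∀ k, ∀ t ∈ Ioo 0 T,
      HasDerivAt (fun t => c t k) (-Complex.I * (κ * k ^ 2 * c t k + F t k)) t)
    (hF5 : FamBdd T 5 F) (hF3 : FamLip T 3 F) :
    ∃ C, 0 ≤ C ∧ ∀ t σ, 0 ≤ σ → t - σ ∈ Icc 0 T → t ∈ Icc 0 T →
      SobLE 1 (fun k => phase κ (-σ) k * c (t - σ) k - c t k - Complex.I * σ * F t k)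
        (C * σ ^ 2) := by
  obtain ⟨C5, hC5, h5⟩ := hF5
  obtain ⟨C3, hC3, h3⟩ := hF3
  refine ⟨κ * C5 + C3, by positivity, fun t σ hσ hm h0 => ?_⟩
  -- The same integrating factor, now with a derivative of size `O(r)`; two spare derivatives of `F`
  -- suffice for the phase increment.
  have := SobLE.sub_of_hasDerivAt (s := 1)
    (x := fun r k => phase κ (-r) k * c (t - r) k - Complex.I * r * F t k)
    (x' := fun r k => Complex.I * ((phase κ (-r) k - 1) * F (t - r) k + (F (t - r) k - F t k)))
    (σ := σ) (B := (κ * C5 + C3) * σ) hσ (fun k => ?_) (fun k r hr => ?_) (fun r hr => ?_)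
  · convert this using 1
    · ext k; simp [phase]; ring
    · ring
  · have c2 : ContinuousOn (fun r => phase κ (-r) k) (Icc 0 σ) := fun r _ =>
      ((hasDerivAt_phase κ (-r) k).continuousAt.comp (f := fun r : ℝ => -r)
        continuous_neg.continuousAt).continuousWithinAt
    refine (c2.mul ((hc k).comp (f := fun r => t - r) (by fun_prop) fun r hr => ?_)).sub
      (by fun_prop)
    exact ⟨by linarith [hr.2, hm.1], by linarith [hr.1, h0.2]⟩
  · have d2 := (hd k (t - r) ⟨by linarith [hr.2, hm.1], by linarith [hr.1, h0.2]⟩).comp_const_sub t r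
    have e2 : HasDerivAt (fun r : ℝ => phase κ (-r) k)
        (-(Complex.I * (κ * k ^ 2) * phase κ (-r) k)) r := hasDerivAt_phase_neg κ r k
    have e3 : HasDerivAt (fun r : ℝ => Complex.I * (r : ℂ) * F t k)
        (Complex.I * ((1 : ℝ) : ℂ) * F t k) r :=
      (((hasDerivAt_id r).ofReal_comp).const_mul Complex.I).mul_const (F t k)
    refine ((e2.mul d2).sub e3).congr_deriv ?_
    push_cast; ring
  · have hrm : t - r ∈ Icc 0 T := ⟨by linarith [hr.2, hm.1], by linarith [hr.1, h0.2]⟩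
    have hr0 := hr.1.le
    have a1 := SobLE.mul_multiplier (s := 1) (r := 2) ((h5 _ hrm).weaken (by norm_num))
      (by positivity) (norm_phase_sub_one_le (r := -r) hκ)
    have a2 := (h3 _ hrm t h0).weaken (r := 1) (by norm_num)
    refine ((a1.add a2).const_mul Complex.I).mono ?_
    rw [sub_sub_cancel_left, abs_neg, abs_of_nonneg hr0, Complex.norm_I, one_mul]
    calc _ = (κ * C5 + C3) * r := by ring
      _ ≤ _ := by have := hr.2.le; gcongr

end exact

/-- Time regularity of the solution of `i c_k' = κ k² c_k + F_k`, `F = V u + β |u|² u`. -/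
theorem time_regularity {T κ β B : ℝ} {c : ℝ → ℤ → ℂ} {v : ℤ → ℂ} (hκ : 0 ≤ κ) (hv : SobLE 5 v B)
    (hb : FamBdd T 5 c) (hc : ∀ k, ContinuousOn (fun t => c t k) (Icc 0 T))
    (hd : ∀ k, ∀ t ∈ Ioo 0 T, HasDerivAt (fun t => c t k)
      (-Complex.I * (κ * k ^ 2 * c t k + nonlin v β (c t) k)) t) :
    FamLip T 3 c ∧ FamLip T 3 (fun t => nonlin v β (c t)) ∧
      FamSec T 1 (fun t => nonlin v β (c t)) := by
  have hF5 : FamBdd T 5 fun t => nonlin v β (c t) := hb.nonlin (by norm_num) hv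
  -- The equation trades one time derivative for two space derivatives, so the available order falls
  -- from 5 to 3 and then to 1.
  have hmulB : FamBdd T 3 fun t k => (κ : ℂ) * k ^ 2 * c t k := by
    obtain ⟨C, hC, h⟩ := hb
    refine ⟨κ * C, by positivity, fun t ht => SobLE.mul_multiplier (r := 2) (h t ht) hκ fun k => ?_⟩
    rw [norm_mul, Complex.norm_real, Real.norm_of_nonneg hκ, norm_pow, Complex.norm_intCast, sq_abs]
    exact mul_le_mul_of_nonneg_left (sq_abs_le_wt k) hκ
  have hL : FamLip T 3 c := FamLip.of_hasDerivAt hc hd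
    ((hmulB.add (hF5.weaken (by norm_num))).const_mul (-Complex.I))
  have hFL : FamLip T 3 fun t => nonlin v β (c t) :=
    FamLip.nonlin (by norm_num) (hv.weaken (by norm_num)) (hb.weaken (by norm_num)) hL
  have hmulL : FamLip T 1 fun t k => (κ : ℂ) * k ^ 2 * c t k := by
    obtain ⟨C, hC, h⟩ := hL
    refine ⟨κ * C, by positivity, fun t ht t' ht' => ?_⟩
    have := SobLE.mul_multiplier (s := 1) (r := 2) (h t ht t' ht') hκ
      (z := fun k => (κ : ℂ) * k ^ 2) fun k => ?_
    · convert this using 1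
      · ext k; ring
      · ring
    rw [norm_mul, Complex.norm_real, Real.norm_of_nonneg hκ, norm_pow, Complex.norm_intCast, sq_abs]
    exact mul_le_mul_of_nonneg_left (sq_abs_le_wt k) hκ
  have hS : FamSec T 1 c := FamSec.of_hasDerivAt hc hd
    ((hmulL.add (hFL.weaken (by norm_num))).const_mul (-Complex.I))
  exact ⟨hL, hFL, FamSec.nonlin le_rfl (hv.weaken (by norm_num)) (hb.weaken (by norm_num))
    (hL.weaken (by norm_num)) hS⟩

/-! ### Second differences of smooth maps -/

section smooth

variable {E F : Type*} [NormedAddCommGroup E] [NormedSpace ℝ E] [FiniteDimensional ℝ E]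
  [NormedAddCommGroup F] [NormedSpace ℝ F]

theorem exists_lipschitz_closedBall {K : E → F} (hK : ContDiff ℝ 1 K) (R : ℝ) :
    ∃ L, 0 ≤ L ∧ ∀ x y, ‖x‖ ≤ R → ‖y‖ ≤ R → ‖K x - K y‖ ≤ L * ‖x - y‖ := by
  have hcont : Continuous (fderiv ℝ K) := hK.continuous_fderiv one_ne_zero
  have : ProperSpace E := FiniteDimensional.proper ℝ E
  obtain ⟨L, hL⟩ := (isCompact_closedBall (0 : E) R).exists_bound_of_continuousOn
    hcont.continuousOn
  refine ⟨max L 0, le_max_right _ _, fun x y hx hy => ?_⟩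
  exact Convex.norm_image_sub_le_of_norm_fderiv_le (𝕜 := ℝ) (s := Metric.closedBall (0 : E) R)
    (fun z _ => (hK.differentiable one_ne_zero) z) (fun z hz => (hL z hz).trans (le_max_left _ _))
    (convex_closedBall _ _) (by simpa using hy) (by simpa using hx)

/-- With `d = x' - x`, the translated difference `z ↦ K (z + d) - K z` has derivative `O(‖d‖)`
because the derivative of `K` is Lipschitz on balls. The remaining term `K (y + d) - K y'` is
controlled by the defect `y + d - y'`, which is the second difference of the arguments. -/
theorem exists_second_difference {K : E → F} (hK : ContDiff ℝ 2 K) (R : ℝ) :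
    ∃ L, 0 ≤ L ∧ ∀ x y x' y', ‖x‖ ≤ R → ‖y‖ ≤ R → ‖x'‖ ≤ R → ‖y'‖ ≤ R →
      ‖K x' - K y' - (K x - K y)‖ ≤ L * (‖x' - y' - (x - y)‖ + ‖x' - x‖ * ‖x - y‖) := by
  -- Translation by `d`, of norm at most `2R`, may leave the ball of radius `R` but not the one of
  -- radius `3R`.
  obtain ⟨L₁, hL₁, h₁⟩ := exists_lipschitz_closedBall (hK.of_le (by norm_num)) (3 * R)
  obtain ⟨L₂, hL₂, h₂⟩ := exists_lipschitz_closedBall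
    (hK.fderiv_right (m := 1) (by norm_num)) (3 * R)
  refine ⟨L₁ + L₂, by positivity, fun x y x' y' hx hy hx' hy' => ?_⟩
  have hR : 0 ≤ R := (norm_nonneg x).trans hx
  set d := x' - x with hd
  have hdn : ‖d‖ ≤ 2 * R := (norm_sub_le _ _).trans (by linarith)
  have hshift : ∀ z : E, ‖z‖ ≤ R → ‖z + d‖ ≤ 3 * R := fun z hz =>
    (norm_add_le _ _).trans (by linarith)
  have hKd := hK.differentiable two_ne_zero
  have e1 : ‖(K (x + d) - K x) - (K (y + d) - K y)‖ ≤ L₂ * ‖d‖ * ‖x - y‖ := by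
    refine Convex.norm_image_sub_le_of_norm_hasFDerivWithin_le (𝕜 := ℝ)
      (s := Metric.closedBall (0 : E) R) (f := fun z => K (z + d) - K z)
      (f' := fun z => fderiv ℝ K (z + d) - fderiv ℝ K z) (fun z hz => ?_) (fun z hz => ?_)
      (convex_closedBall _ _) (by simpa using hy) (by simpa using hx)
    · have := ((hKd (z + d)).hasFDerivAt.comp z ((hasFDerivAt_id z).add_const d)).sub
        (hKd z).hasFDerivAt
      rw [ContinuousLinearMap.comp_id] at this
      exact this.hasFDerivWithinAt
    · have hz : ‖z‖ ≤ R := by simpa using hz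
      simpa using h₂ (z + d) z (hshift z hz) (by linarith)
  have e2 := h₁ (y + d) y' (hshift y hy) (by linarith)
  have e3 : K x' - K y' - (K x - K y) =
      ((K (x + d) - K x) - (K (y + d) - K y)) + (K (y + d) - K y') := by
    rw [hd, add_sub_cancel]; abel
  have e4 : ‖y + d - y'‖ = ‖x' - y' - (x - y)‖ := by rw [hd]; congr 1; abel
  rw [e4] at e2
  rw [e3]
  refine (norm_add_le _ _).trans ?_
  have := norm_nonneg (x' - y' - (x - y))
  have := mul_nonneg (norm_nonneg d) (norm_nonneg (x - y))
  nlinarith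

end smooth

/-! ### The potential flow -/

/-- The nonlinearity `(V + β |z|²) z`. -/
noncomputable def nls (β V : ℝ) (z : ℂ) : ℂ := ((V + β * ‖z‖ ^ 2 : ℝ) : ℂ) * z

/-- The flow of `i z' = (V + β |z|²) z` over time `s`. -/
noncomputable def nstep (β s V : ℝ) (z : ℂ) : ℂ :=
  Complex.exp (-Complex.I * ((V + β * ‖z‖ ^ 2 : ℝ) : ℂ) * s) * z

/-- The `p`-th time derivative of the flow. -/
noncomputable def nflow (β : ℝ) (p : ℕ) (x : ℝ × ℝ × ℂ) : ℂ :=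
  (-Complex.I * ((x.2.1 + β * ‖x.2.2‖ ^ 2 : ℝ) : ℂ)) ^ p * nstep β x.1 x.2.1 x.2.2

theorem contDiff_nflow (β : ℝ) (p : ℕ) : ContDiff ℝ 2 (nflow β p) := by
  have h1 : ContDiff ℝ 2 fun x : ℝ × ℝ × ℂ => ((x.2.1 + β * ‖x.2.2‖ ^ 2 : ℝ) : ℂ) :=
    Complex.ofRealCLM.contDiff.comp (contDiff_fst.comp contDiff_snd |>.add
      (contDiff_const.mul ((contDiff_snd.comp contDiff_snd).norm_sq ℝ)))
  have h2 : ContDiff ℝ 2 fun x : ℝ × ℝ × ℂ => (x.1 : ℂ) := Complex.ofRealCLM.contDiff.comp contDiff_fst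
  have h3 : ContDiff ℝ 2 fun x : ℝ × ℝ × ℂ => x.2.2 := contDiff_snd.comp contDiff_snd
  unfold nflow nstep
  exact ((contDiff_const.mul h1).pow p).mul ((((contDiff_const.mul h1).mul h2).cexp).mul h3)

theorem hasDerivAt_nflow (β : ℝ) (p : ℕ) (s V : ℝ) (z : ℂ) :
    HasDerivAt (fun s => nflow β p (s, V, z)) (nflow β (p + 1) (s, V, z)) s := by
  unfold nflow nstep
  have h1 : HasDerivAt (fun s : ℝ => -Complex.I * ((V + β * ‖z‖ ^ 2 : ℝ) : ℂ) * (s : ℂ))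
      (-Complex.I * ((V + β * ‖z‖ ^ 2 : ℝ) : ℂ) * ((1 : ℝ) : ℂ)) s :=
    ((hasDerivAt_id s).ofReal_comp).const_mul _
  have := ((h1.cexp.mul_const z).const_mul ((-Complex.I * ((V + β * ‖z‖ ^ 2 : ℝ) : ℂ)) ^ p))
  refine this.congr_deriv ?_
  push_cast; ring

theorem nflow_zero (β s V : ℝ) (z : ℂ) : nflow β 0 (s, V, z) = nstep β s V z := by simp [nflow]

theorem nstep_zero_time (β V : ℝ) (z : ℂ) : nstep β 0 V z = z := by simp [nstep]

theorem nstep_zero (β s V : ℝ) : nstep β s V 0 = 0 := by simp [nstep]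

theorem nflow_one_zero_time (β V : ℝ) (z : ℂ) : nflow β 1 (0, V, z) = -Complex.I * nls β V z := by
  simp [nflow, nstep, nls]; ring

theorem norm_nstep (β s V : ℝ) (z : ℂ) : ‖nstep β s V z‖ = ‖z‖ := by
  rw [nstep, norm_mul]
  have : -Complex.I * ((V + β * ‖z‖ ^ 2 : ℝ) : ℂ) * s =
      ((-(V + β * ‖z‖ ^ 2) * s : ℝ) : ℂ) * Complex.I := by push_cast; ring
  rw [this, Complex.norm_exp_ofReal_mul_I, one_mul]

theorem nstep_nstep (β s s' V : ℝ) (z : ℂ) :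
    nstep β s V (nstep β s' V z) = nstep β (s + s') V z := by
  conv_lhs => rw [nstep, norm_nstep]
  rw [nstep, nstep, ← mul_assoc, ← Complex.exp_add]
  congr 2; push_cast; ring

theorem nls_zero (β V : ℝ) : nls β V 0 = 0 := by simp [nls]

/-- Lipschitz bound in both arguments for the values of `Φ` on the ball of radius `R`. -/
def OnePt (R L : ℝ) (Φ : ℝ → ℂ → ℂ) : Prop :=
  ∀ V V' z z', |V| ≤ R → |V'| ≤ R → ‖z‖ ≤ R → ‖z'‖ ≤ R →
    ‖Φ V' z' - Φ V z‖ ≤ L * (|V' - V| + ‖z' - z‖)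

/-- Second difference bound for `Φ` on the ball of radius `R`. -/
def TwoPt (R L : ℝ) (Φ : ℝ → ℂ → ℂ) : Prop :=
  ∀ V V' z z' u u', |V| ≤ R → |V'| ≤ R → ‖z‖ ≤ R → ‖z'‖ ≤ R → ‖u‖ ≤ R → ‖u'‖ ≤ R →
    ‖Φ V' z' - Φ V' u' - (Φ V z - Φ V u)‖ ≤
      L * (‖z' - u' - (z - u)‖ + (|V' - V| + ‖z' - z‖) * ‖z - u‖)

theorem norm_triple_le {s V R : ℝ} {z : ℂ} (hs : |s| ≤ 1) (hV : |V| ≤ R) (hz : ‖z‖ ≤ R) :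
    ‖(s, V, z)‖ ≤ max 1 R := by
  simp only [Prod.norm_def, Real.norm_eq_abs]
  exact max_le (hs.trans (le_max_left _ _)) ((max_le hV hz).trans (le_max_right _ _))

theorem norm_triple_sub_le (s s' V V' : ℝ) (z z' : ℂ) :
    ‖(s', V', z') - (s, V, z)‖ ≤ |s' - s| + (|V' - V| + ‖z' - z‖) := by
  simp only [Prod.mk_sub_mk, Prod.norm_def, Real.norm_eq_abs]
  have := abs_nonneg (s' - s)
  have := abs_nonneg (V' - V)
  have := norm_nonneg (z' - z)
  exact max_le (by linarith) (max_le (by linarith) (by linarith))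

/-- The flow is smooth jointly in time, potential and state, so a single constant serves all times
in `[-1, 1]`. -/
theorem exists_nflow_twoPt (β R : ℝ) (p : ℕ) :
    ∃ L, 0 ≤ L ∧ ∀ s, |s| ≤ 1 → TwoPt R L fun V z => nflow β p (s, V, z) := by
  obtain ⟨L, hL, h⟩ := exists_second_difference (contDiff_nflow β p) (max 1 R)
  refine ⟨L, hL, fun s hs V V' z z' u u' hV hV' hz hz' hu hu' => ?_⟩
  refine (h (s, V, z) (s, V, u) (s, V', z') (s, V', u') (norm_triple_le hs hV hz)
    (norm_triple_le hs hV hu) (norm_triple_le hs hV' hz') (norm_triple_le hs hV' hu')).trans ?_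
  have e1 := norm_triple_sub_le s s V V' z z'
  have e2 := norm_triple_sub_le s s V V u z
  have e3 : ‖(s, V', z') - (s, V', u') - ((s, V, z) - (s, V, u))‖ = ‖z' - u' - (z - u)‖ := by
    simp [Prod.norm_def]
  simp only [sub_self, abs_zero, zero_add] at e1 e2
  rw [e3]
  gcongr

theorem exists_nflow_onePt (β R : ℝ) (p : ℕ) :
    ∃ L, 0 ≤ L ∧ ∀ s, |s| ≤ 1 → OnePt R L fun V z => nflow β p (s, V, z) := by
  obtain ⟨L, hL, h⟩ := exists_lipschitz_closedBall
    ((contDiff_nflow β p).of_le (by norm_num)) (max 1 R)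
  refine ⟨L, hL, fun s hs V V' z z' hV hV' hz hz' => ?_⟩
  refine (h (s, V', z') (s, V, z) (norm_triple_le hs hV' hz') (norm_triple_le hs hV hz)).trans ?_
  have e1 := norm_triple_sub_le s s V V' z z'
  simp only [sub_self, abs_zero, zero_add] at e1
  gcongr

/-- A second difference over a rectangle with one side in time and the other in the pair `(V, z)`:
the four corners have vanishing second difference, and only the product of the two side lengths
remains. -/
theorem exists_nflow_time_onePt (β R : ℝ) (p : ℕ) :
    ∃ L, 0 ≤ L ∧ ∀ s s', |s| ≤ 1 → |s'| ≤ 1 →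
      OnePt R (L * |s' - s|) fun V z => nflow β p (s', V, z) - nflow β p (s, V, z) := by
  obtain ⟨L, hL, h⟩ := exists_second_difference (contDiff_nflow β p) (max 1 R)
  refine ⟨L, hL, fun s s' hs hs' V V' z z' hV hV' hz hz' => ?_⟩
  have := h (s, V', z') (s, V, z) (s', V', z') (s', V, z) (norm_triple_le hs hV' hz')
    (norm_triple_le hs hV hz) (norm_triple_le hs' hV' hz') (norm_triple_le hs' hV hz)
  have e1 := norm_triple_sub_le s s V V' z z'
  have e2 := norm_triple_sub_le s s' V' V' z' z'
  have e3 : ‖(s', V', z') - (s', V, z) - ((s, V', z') - (s, V, z))‖ = 0 := by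
    simp
  simp only [sub_self, abs_zero, zero_add, norm_zero, add_zero] at e1 e2
  rw [e3, zero_add] at this
  calc _ = ‖nflow β p (s', V', z') - nflow β p (s', V, z) -
        (nflow β p (s, V', z') - nflow β p (s, V, z))‖ := by congr 1; ring
    _ ≤ _ := this
    _ ≤ L * (|s' - s| * (|V' - V| + ‖z' - z‖)) := by gcongr
    _ = _ := by ring

theorem norm_sub_le_of_hasDerivAt {f f' : ℝ → ℂ} {s C : ℝ} (hs : 0 ≤ s)
    (hf : ∀ r, HasDerivAt f (f' r) r) (hb : ∀ r ∈ Icc 0 s, ‖f' r‖ ≤ C) :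
    ‖f s - f 0‖ ≤ C * s := by
  have := norm_image_sub_le_of_norm_deriv_le_segment' (a := 0) (b := s)
    (fun r _ => (hf r).hasDerivWithinAt) (fun r hr => hb r ⟨hr.1, hr.2.le⟩) s ⟨hs, le_rfl⟩
  simpa using this

/-- At time zero the flow minus the identity vanishes, so integrating the bound for its time
derivative gains a factor `s`. This factor keeps the amplification in one step at `1 + O(τ)`. -/
theorem exists_nstep_sub_twoPt (β R : ℝ) :
    ∃ L, 0 ≤ L ∧ ∀ s, 0 ≤ s → s ≤ 1 → TwoPt R (L * s) fun V z => nstep β s V z - z := by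
  obtain ⟨L, hL, h⟩ := exists_nflow_twoPt β R 1
  refine ⟨L, hL, fun s hs hs1 V V' z z' u u' hV hV' hz hz' hu hu' => ?_⟩
  have hd := fun r => (((hasDerivAt_nflow β 0 r V' z').sub (hasDerivAt_nflow β 0 r V' u')).sub
    ((hasDerivAt_nflow β 0 r V z).sub (hasDerivAt_nflow β 0 r V u)))
  have := norm_sub_le_of_hasDerivAt hs hd fun r hr =>
    h r (by rw [abs_of_nonneg hr.1]; linarith [hr.2]) V V' z z' u u' hV hV' hz hz' hu hu'
  simp only [Pi.sub_apply, nflow_zero, nstep_zero_time] at this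
  calc _ = ‖nstep β s V' z' - nstep β s V' u' - (nstep β s V z - nstep β s V u) -
        (z' - u' - (z - u))‖ := by congr 1; ring
    _ ≤ _ := this
    _ = _ := by ring

theorem exists_nls_twoPt (β R : ℝ) : ∃ L, 0 ≤ L ∧ TwoPt R L (nls β) := by
  obtain ⟨L, hL, h⟩ := exists_nflow_twoPt β R 1
  refine ⟨L, hL, fun V V' z z' u u' hV hV' hz hz' hu hu' => ?_⟩
  have := h 0 (by simp) V V' z z' u u' hV hV' hz hz' hu hu'
  simp only [nflow_one_zero_time, ← mul_sub] at this
  simpa using this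

theorem exists_nstep_onePt (β R : ℝ) :
    ∃ L, 0 ≤ L ∧ ∀ s, |s| ≤ 1 → OnePt R L fun V z => nstep β s V z := by
  simpa only [nflow_zero] using exists_nflow_onePt β R 0

/-- Not only the Taylor remainder but also its Lipschitz constant in `(V, z)` must be of second
order, since discrete `H¹` estimates take grid differences of the remainder. -/
theorem exists_nstep_taylor_onePt (β R : ℝ) :
    ∃ L, 0 ≤ L ∧ ∀ s, 0 ≤ s → s ≤ 1 →
      OnePt R (L * s ^ 2) fun V z => nstep β s V z - z + Complex.I * s * nls β V z := by
  obtain ⟨L, hL, h⟩ := exists_nflow_time_onePt β R 1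
  refine ⟨L, hL, fun s hs hs1 V V' z z' hV hV' hz hz' => ?_⟩
  have hd0 : ∀ (V : ℝ) (z : ℂ) (r : ℝ), HasDerivAt
      (fun r : ℝ => nflow β 0 (r, V, z) - (r : ℂ) * nflow β 1 (0, V, z))
      (nflow β 1 (r, V, z) - nflow β 1 (0, V, z)) r := fun V z r => by
    have := (hasDerivAt_nflow β 0 r V z).sub
      (((hasDerivAt_id r).ofReal_comp).mul_const (nflow β 1 (0, V, z)))
    exact this.congr_deriv (by simp)
  have := norm_sub_le_of_hasDerivAt (C := L * s * (|V' - V| + ‖z' - z‖)) hs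
    (fun r => (hd0 V' z' r).sub (hd0 V z r)) fun r hr => ?_
  · simp only [Pi.sub_apply, nflow_zero, nstep_zero_time, nflow_one_zero_time, Complex.ofReal_zero,
      zero_mul, sub_zero] at this
    calc _ = ‖nstep β s V' z' - s * (-Complex.I * nls β V' z') -
          (nstep β s V z - s * (-Complex.I * nls β V z)) - (z' - z)‖ := by congr 1; ring
      _ ≤ _ := this
      _ = _ := by ring
  · have hr1 : |r| ≤ 1 := by rw [abs_of_nonneg hr.1]; linarith [hr.2]
    refine (h 0 r (by simp) hr1 V V' z z' hV hV' hz hz').trans ?_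
    rw [sub_zero, abs_of_nonneg hr.1]
    have := hr.2
    gcongr

/-- Even powers of the time step cancel in the difference of the forward and backward flows. Two
integrations in time of the Lipschitz bound for the second time derivative produce the third power.
-/
theorem exists_nstep_symm_onePt (β R : ℝ) :
    ∃ L, 0 ≤ L ∧ ∀ s, 0 ≤ s → s ≤ 1 → OnePt R (L * s ^ 3) fun V z =>
      nstep β s V z - nstep β (-s) V z + 2 * Complex.I * s * nls β V z := by
  obtain ⟨L, hL, h⟩ := exists_nflow_time_onePt β R 2
  refine ⟨2 * L, by positivity, fun s hs hs1 V V' z z' hV hV' hz hz' => ?_⟩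
  have hdn : ∀ (p : ℕ) (V : ℝ) (z : ℂ) (r : ℝ),
      HasDerivAt (fun r : ℝ => nflow β p (-r, V, z)) (-nflow β (p + 1) (-r, V, z)) r :=
    fun p V z r => ((hasDerivAt_nflow β p (-r) V z).scomp r (hasDerivAt_neg r)).congr_deriv
      (by simp)
  have hd1 : ∀ (V : ℝ) (z : ℂ) (r : ℝ), HasDerivAt
      (fun r : ℝ => nflow β 0 (r, V, z) - nflow β 0 (-r, V, z) - (r : ℂ) * (2 * nflow β 1 (0, V, z)))
      (nflow β 1 (r, V, z) + nflow β 1 (-r, V, z) - 2 * nflow β 1 (0, V, z)) r := fun V z r => by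
    have := ((hasDerivAt_nflow β 0 r V z).sub (hdn 0 V z r)).sub
      (((hasDerivAt_id r).ofReal_comp).mul_const (2 * nflow β 1 (0, V, z)))
    exact this.congr_deriv (by simp)
  have hd2 : ∀ (V : ℝ) (z : ℂ) (r : ℝ), HasDerivAt
      (fun r : ℝ => nflow β 1 (r, V, z) + nflow β 1 (-r, V, z) - 2 * nflow β 1 (0, V, z))
      (nflow β 2 (r, V, z) - nflow β 2 (-r, V, z)) r := fun V z r =>
    ((((hasDerivAt_nflow β 1 r V z).add (hdn 1 V z r)).sub_const _).congr_deriv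
      (sub_eq_add_neg _ _).symm)
  have hin : ∀ r ∈ Icc 0 s, ‖(nflow β 1 (r, V', z') + nflow β 1 (-r, V', z') -
      2 * nflow β 1 (0, V', z')) - (nflow β 1 (r, V, z) + nflow β 1 (-r, V, z) -
      2 * nflow β 1 (0, V, z))‖ ≤ 2 * L * s ^ 2 * (|V' - V| + ‖z' - z‖) := by
    intro r hr
    have := norm_sub_le_of_hasDerivAt (C := L * (2 * s) * (|V' - V| + ‖z' - z‖)) hr.1
      (fun r => (hd2 V' z' r).sub (hd2 V z r)) fun q hq => ?_
    · simp only [Pi.sub_apply, neg_zero, ← two_mul, sub_self, sub_zero] at this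
      refine this.trans ?_
      have := hr.2
      calc L * (2 * s) * (|V' - V| + ‖z' - z‖) * r ≤ L * (2 * s) * (|V' - V| + ‖z' - z‖) * s := by
            gcongr
        _ = _ := by ring
    · have hq1 : |q| ≤ 1 := by rw [abs_of_nonneg hq.1]; linarith [hq.2, hr.2]
      refine (h (-q) q (by rwa [abs_neg]) hq1 V V' z z' hV hV' hz hz').trans ?_
      rw [sub_neg_eq_add, ← two_mul, abs_of_nonneg (by linarith [hq.1])]
      have := hq.2.trans hr.2
      gcongr
  have := norm_sub_le_of_hasDerivAt hs (fun r => (hd1 V' z' r).sub (hd1 V z r)) hin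
  simp only [Pi.sub_apply, nflow_zero, nflow_one_zero_time, neg_zero, sub_self, Complex.ofReal_zero,
    zero_mul, sub_zero] at this
  calc _ = ‖nstep β s V' z' - nstep β (-s) V' z' - s * (2 * (-Complex.I * nls β V' z')) -
        (nstep β s V z - nstep β (-s) V z - s * (2 * (-Complex.I * nls β V z)))‖ := by
        congr 1; ring
    _ ≤ _ := this
    _ = _ := by ring

/-! ### Discrete Sobolev norms on the grid -/

/-- The discrete `L²` norm for `i = 0` and the discrete `H¹` norm for `i = 1`. -/
noncomputable def gsob (i M : ℕ) (g : ℝ → ℂ) : ℝ := gnorm M g + i * (M * gnorm M (fdiff M g))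

theorem gstep_pos {M : ℕ} (hM : 0 < M) : 0 < gstep M := by
  have : (0 : ℝ) < M := by exact_mod_cast hM
  unfold gstep; positivity

theorem mul_gstep {M : ℕ} (hM : 0 < M) : M * gstep M = π := by
  have : (M : ℝ) ≠ 0 := by exact_mod_cast hM.ne'
  unfold gstep; field_simp

theorem gsob_add_le (i M : ℕ) (f g : ℝ → ℂ) :
    gsob i M (fun y => f y + g y) ≤ gsob i M f + gsob i M g := by
  have h1 := gnorm_add_le M f g
  have h2 : gnorm M (fdiff M fun y => f y + g y) ≤ gnorm M (fdiff M f) + gnorm M (fdiff M g) := by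
    have : (fdiff M fun y => f y + g y) = fun y => fdiff M f y + fdiff M g y := by
      ext y; simp only [fdiff]; ring
    rw [this]; exact gnorm_add_le _ _ _
  unfold gsob
  have h3 : (i : ℝ) * (M * gnorm M (fdiff M fun y => f y + g y)) ≤
      i * (M * (gnorm M (fdiff M f) + gnorm M (fdiff M g))) := by gcongr
  linarith

theorem gsob_const_mul (i M : ℕ) (z : ℂ) (g : ℝ → ℂ) :
    gsob i M (fun y => z * g y) = ‖z‖ * gsob i M g := by
  have : (fdiff M fun y => z * g y) = fun y => z * fdiff M g y := by
    ext y; simp only [fdiff]; ring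
  rw [gsob, gsob, this, gnorm_const_mul, gnorm_const_mul]; ring

theorem gsob_neg (i M : ℕ) (g : ℝ → ℂ) : gsob i M (fun y => -g y) = gsob i M g := by
  have := gsob_const_mul i M (-1) g
  simpa using this

theorem gsob_sub_le (i M : ℕ) (f g : ℝ → ℂ) :
    gsob i M (fun y => f y - g y) ≤ gsob i M f + gsob i M g := by
  have := gsob_add_le i M f fun y => -g y
  rw [gsob_neg] at this
  simpa [sub_eq_add_neg] using this

section pointwise

variable {i M : ℕ} {R R' L : ℝ} {Vf : ℝ → ℝ} {f g : ℝ → ℂ} {Φ : ℝ → ℂ → ℂ}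

/-- The second difference bound is applied at neighbouring grid points. Increments of the potential
and of `f` are `O(gstep M)`, and the factor `M` in the discrete `H¹` norm is absorbed by `M * gstep
M = π`. The bound is asymmetric on purpose: `g` may be the numerical solution, of which only a sup
bound is known. -/
theorem gsob_sub_le_of_twoPt (hM : 0 < M) (hL : 0 ≤ L) (hR' : 0 ≤ R') (hΦ : TwoPt R L Φ)
    (hV : ∀ y, |Vf y| ≤ R) (hf : ∀ y, ‖f y‖ ≤ R) (hg : ∀ y, ‖g y‖ ≤ R)
    (hV' : ∀ y, |Vf (y + gstep M) - Vf y| ≤ R' * gstep M)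
    (hf' : ∀ y, ‖f (y + gstep M) - f y‖ ≤ R' * gstep M) (hi : i ≤ 1) :
    gsob i M (fun y => Φ (Vf y) (f y) - Φ (Vf y) (g y)) ≤
      L * (1 + 2 * π * R') * gsob i M (fun y => f y - g y) := by
  have hh := gstep_pos hM
  have hi' : (i : ℝ) ≤ 1 := by exact_mod_cast hi
  have h0 : gnorm M (fun y => Φ (Vf y) (f y) - Φ (Vf y) (g y)) ≤
      L * gnorm M (fun y => f y - g y) := by
    refine gnorm_le_mul hL fun y => ?_
    have := hΦ (Vf y) (Vf y) (g y) (f y) (g y) (g y) (hV y) (hV y) (hg y) (hf y) (hg y) (hg y)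
    simpa using this
  have h1 : gnorm M (fdiff M fun y => Φ (Vf y) (f y) - Φ (Vf y) (g y)) ≤
      L * gnorm M (fdiff M fun y => f y - g y) +
        (L * (2 * R' * gstep M)) * gnorm M (fun y => f y - g y) := by
    refine gnorm_le_add hL (by positivity) fun y => ?_
    have := hΦ (Vf y) (Vf (y + gstep M)) (f y) (f (y + gstep M)) (g y) (g (y + gstep M)) (hV _)
      (hV _) (hf _) (hf _) (hg _) (hg _)
    refine this.trans ?_
    rw [mul_assoc, ← mul_add]
    refine mul_le_mul_of_nonneg_left ?_ hL
    simp only [fdiff]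
    have a1 := hV' y
    have a2 := hf' y
    have a3 : (|Vf (y + gstep M) - Vf y| + ‖f (y + gstep M) - f y‖) ≤ 2 * R' * gstep M := by linarith
    gcongr
  have h2 : M * gnorm M (fdiff M fun y => Φ (Vf y) (f y) - Φ (Vf y) (g y)) ≤
      L * (M * gnorm M (fdiff M fun y => f y - g y)) +
        L * (2 * π * R') * gnorm M (fun y => f y - g y) := by
    calc _ ≤ M * (L * gnorm M (fdiff M fun y => f y - g y) +
        (L * (2 * R' * gstep M)) * gnorm M (fun y => f y - g y)) := by gcongr
      _ = L * (M * gnorm M (fdiff M fun y => f y - g y)) +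
        L * (2 * (M * gstep M) * R') * gnorm M (fun y => f y - g y) := by ring
      _ = _ := by rw [mul_gstep hM]
  have n0 := gnorm_nonneg M (fun y => f y - g y)
  have n1 := gnorm_nonneg M (fdiff M fun y => f y - g y)
  unfold gsob
  calc _ ≤ L * gnorm M (fun y => f y - g y) + i * (L * (M * gnorm M (fdiff M fun y => f y - g y)) +
        L * (2 * π * R') * gnorm M (fun y => f y - g y)) := by gcongr
    _ ≤ L * gnorm M (fun y => f y - g y) + (i * (L * (M * gnorm M (fdiff M fun y => f y - g y))) +
        1 * (L * (2 * π * R') * gnorm M (fun y => f y - g y))) := by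
        rw [mul_add]; gcongr
    _ ≤ L * gnorm M (fun y => f y - g y) + (i * (L * (M * gnorm M (fdiff M fun y => f y - g y))) +
        1 * (L * (2 * π * R') * gnorm M (fun y => f y - g y))) +
        L * (2 * π * R') * (i * (M * gnorm M (fdiff M fun y => f y - g y))) := by
        have : 0 ≤ L * (2 * π * R') * (i * (M * gnorm M (fdiff M fun y => f y - g y))) := by
          positivity
        linarith
    _ = _ := by ring

/-- The Lipschitz bound is used twice: against the state `0`, where `Φ` vanishes, for the size, and
between neighbouring grid points for the difference. -/
theorem gsob_le_of_onePt (hM : 0 < M) (hL : 0 ≤ L) (hR : 0 ≤ R) (hR' : 0 ≤ R') (hΦ : OnePt R L Φ)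
    (hΦ0 : ∀ V, Φ V 0 = 0) (hV : ∀ y, |Vf y| ≤ R) (hf : ∀ y, ‖f y‖ ≤ R)
    (hV' : ∀ y, |Vf (y + gstep M) - Vf y| ≤ R' * gstep M)
    (hf' : ∀ y, ‖f (y + gstep M) - f y‖ ≤ R' * gstep M) (hi : i ≤ 1) :
    gsob i M (fun y => Φ (Vf y) (f y)) ≤ L * (R + 2 * π * R') := by
  have hh := gstep_pos hM
  have hi' : (i : ℝ) ≤ 1 := by exact_mod_cast hi
  have h0 : gnorm M (fun y => Φ (Vf y) (f y)) ≤ L * R := by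
    refine gnorm_le_const hM (by positivity) fun y => ?_
    have := hΦ (Vf y) (Vf y) 0 (f y) (hV y) (hV y) (by simpa using hR) (hf y)
    simp only [hΦ0, sub_zero, sub_self, abs_zero, zero_add] at this
    refine this.trans ?_
    have := hf y
    gcongr
  have h1 : gnorm M (fdiff M fun y => Φ (Vf y) (f y)) ≤ L * (2 * R' * gstep M) := by
    refine gnorm_le_const hM (by positivity) fun y => ?_
    refine (hΦ (Vf y) (Vf (y + gstep M)) (f y) (f (y + gstep M)) (hV _) (hV _) (hf _) (hf _)).trans ?_
    have a1 := hV' y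
    have a2 := hf' y
    have a3 : (|Vf (y + gstep M) - Vf y| + ‖f (y + gstep M) - f y‖) ≤ 2 * R' * gstep M := by linarith
    gcongr
  have h2 : M * gnorm M (fdiff M fun y => Φ (Vf y) (f y)) ≤ L * (2 * π * R') := by
    calc _ ≤ M * (L * (2 * R' * gstep M)) := by gcongr
      _ = L * (2 * (M * gstep M) * R') := by ring
      _ = _ := by rw [mul_gstep hM]
  unfold gsob
  have n1 := gnorm_nonneg M (fdiff M fun y => Φ (Vf y) (f y))
  have h3 : (i : ℝ) * (M * gnorm M (fdiff M fun y => Φ (Vf y) (f y))) ≤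
      1 * (M * gnorm M (fdiff M fun y => Φ (Vf y) (f y))) := by gcongr
  linarith

end pointwise

theorem SobLE.gsob_fser_trunc_le {i M : ℕ} (hM : 0 < M) {c : ℤ → ℂ} {B : ℝ} (hi : i ≤ 1)
    (h : SobLE i c B) : gsob i M (fser (_root_.trunc M c)) ≤ (1 + π) * B := by
  have hB := h.nonneg
  have h0 := (h.weaken (Nat.zero_le i)).gnorm_fser_trunc_le hM
  unfold gsob
  interval_cases i
  · have : 0 ≤ π * B := by positivity
    simp only [Nat.cast_zero, zero_mul, add_zero]; linarith
  · have := h.gnorm_fdiff_fser_trunc_le hM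
    simp only [Nat.cast_one, one_mul]; linarith

theorem sobLE_trunc_dft {i M : ℕ} (hM : 0 < M) {g : ℝ → ℂ} (hg : ∀ y, g (y + 2 * π) = g y)
    (hi : i ≤ 1) : SobLE i (trunc M (dft M g)) (gsob i M g) := by
  unfold gsob
  interval_cases i
  · simpa using sobLE_zero_trunc_dft hM g
  · simpa using sobLE_one_trunc_dft hM hg

/-- The difference on the grid is bounded crudely by twice the function, which loses a factor `M`
when `i = 1`; with `M ≥ 1` this gives `1 + 2M ≤ 3M`. -/
theorem SobLE.gsob_fser_le_of_high {i M m : ℕ} (hM : 0 < M) (hm : 2 ≤ m) (hi : i ≤ 1) {d : ℤ → ℂ}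
    {B : ℝ} (h : SobLE m d B) (hd : ∀ k, |k| < (M : ℤ) → d k = 0) :
    gsob i M (fser d) ≤ 3 * (2 ^ m * embConst ^ 2 * B) * ((M : ℝ) ^ i / M ^ m) := by
  have hB := h.nonneg
  have hM' : (0 : ℝ) < M := by exact_mod_cast hM
  have h1 := h.gnorm_fser_le_of_high hM hm hd
  have h2 := gnorm_fdiff_le hM (g := fser d) fun y => fser_add_two_pi y
  have hM1 : (1 : ℝ) ≤ M := by exact_mod_cast hM
  have h0 := gnorm_nonneg M (fser d)
  have h3 : gsob i M (fser d) ≤ 3 * (M : ℝ) ^ i * gnorm M (fser d) := by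
    unfold gsob
    interval_cases i
    · simp; linarith
    · simp only [Nat.cast_one, one_mul, pow_one]; nlinarith
  calc _ ≤ 3 * (M : ℝ) ^ i * gnorm M (fser d) := h3
    _ ≤ 3 * (M : ℝ) ^ i * (2 ^ m * embConst ^ 2 * B / M ^ m) := by gcongr
    _ = _ := by ring

theorem SobLE.norm_fser_increment_le {c : ℤ → ℂ} {B : ℝ} (h : SobLE 2 c B) {M : ℕ} (hM : 0 < M)
    (y : ℝ) : ‖fser c (y + gstep M) - fser c y‖ ≤ embConst * B * gstep M := by
  have := fser_sub_norm_le (h.summable_wt (r := 1)) (y + gstep M) y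
  rw [add_sub_cancel_left, abs_of_pos (gstep_pos hM)] at this
  exact this.trans (mul_le_mul_of_nonneg_right h.tsum_wt_le (gstep_pos hM).le)

/-! ### Linearity of the discrete transform and the nonlinearity in physical space. -/

theorem dft_add (M : ℕ) (f g : ℝ → ℂ) (k : ℤ) :
    dft M (fun y => f y + g y) k = dft M f k + dft M g k := by
  simp only [dft, add_mul, Finset.sum_add_distrib, add_div]

theorem dft_sub (M : ℕ) (f g : ℝ → ℂ) (k : ℤ) :
    dft M (fun y => f y - g y) k = dft M f k - dft M g k := by
  simp only [dft, sub_mul, Finset.sum_sub_distrib, sub_div]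

theorem dft_const_mul (M : ℕ) (z : ℂ) (g : ℝ → ℂ) (k : ℤ) :
    dft M (fun y => z * g y) k = z * dft M g k := by
  simp only [dft, mul_assoc, ← Finset.mul_sum, mul_div_assoc]

theorem fser_nonlin {s : ℕ} {c v : ℤ → ℂ} {β B B' : ℝ} (hs : 1 ≤ s) (hc : SobLE s c B)
    (hv : SobLE s v B') (hvr : cbar v = v) (y : ℝ) :
    fser (nonlin v β c) y = nls β (fser v y).re (fser c y) := by
  have s1 := hc.summable_norm hs
  have s2 := hv.summable_norm hs
  have s3 := (hv.conv hs hc).summable_norm hs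
  have hcc := hc.conv hs hc.cbar
  have s4 := (hcc.conv hs hc).summable_norm hs
  have s5 : Summable fun k => ‖(β : ℂ) * conv (conv c (cbar c)) c k‖ := by
    simpa using s4.mul_left ‖(β : ℂ)‖
  have hV : fser v y = ((fser v y).re : ℂ) := by
    have := fser_cbar (c := v) y
    rw [hvr] at this
    exact (Complex.conj_eq_iff_re.1 this.symm).symm
  have : fser (nonlin v β c) y = fser (conv v c) y + fser (fun k => (β : ℂ) * conv (conv c (cbar c)) c k) y :=
    fser_add s3 s5 y
  rw [this, fser_const_mul, fser_conv s2 s1, fser_conv (hcc.summable_norm hs) s1,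
    fser_conv s1 (summable_cbar s1), fser_cbar, Complex.mul_conj, Complex.normSq_eq_norm_sq, nls, hV]
  push_cast
  simp only [Complex.ofReal_re]
  ring

/-! ### Convergence of the splitting scheme in Fourier space -/

/-- One step of the Strang splitting pseudospectral method, acting on Fourier coefficients. -/
noncomputable def numStep (κ β : ℝ) (v : ℤ → ℂ) (M : ℕ) (τ : ℝ) (a : ℤ → ℂ) (k : ℤ) : ℂ :=
  phase κ (-(τ / 2)) k * trunc M (dft M fun y =>
    nstep β τ (fser v y).re (fser (fun k => phase κ (-(τ / 2)) k * a k) y)) k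

theorem trunc_add (M : ℕ) (c d : ℤ → ℂ) (k : ℤ) :
    trunc M (fun k => c k + d k) k = trunc M c k + trunc M d k := by
  unfold trunc; split_ifs <;> simp

theorem trunc_sub (M : ℕ) (c d : ℤ → ℂ) (k : ℤ) :
    trunc M (fun k => c k - d k) k = trunc M c k - trunc M d k := by
  unfold trunc; split_ifs <;> simp

theorem trunc_mul (M : ℕ) (z c : ℤ → ℂ) (k : ℤ) :
    trunc M (fun k => z k * c k) k = z k * trunc M c k := by
  unfold trunc; split_ifs <;> simp

theorem trunc_trunc (M : ℕ) (c : ℤ → ℂ) : trunc M (trunc M c) = trunc M c := by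
  ext k; unfold trunc; split_ifs <;> rfl

set_option maxHeartbeats 1000000 in
/-- Local error in one step, given the nonlinear bounds; `ε` is the aliasing error. -/
theorem symmetric_defect_le {i M : ℕ} (hM : 0 < M) (hi : i ≤ 1) {β R R' R'' Lf Ls L3 σ ε K : ℝ}
    (hLf : 0 ≤ Lf) (hLs : 0 ≤ Ls) (hL3 : 0 ≤ L3) (hR : 0 ≤ R) (hR' : 0 ≤ R') (hRR : R' ≤ R'')
    (hK : 0 ≤ K) (hε : 0 ≤ ε) (hσ : 0 ≤ σ) (hσ1 : σ ≤ 1)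
    (hf : TwoPt R Lf (nls β))
    (hs : OnePt R (Ls * σ ^ 2) fun V z => nstep β σ V z - z + Complex.I * σ * nls β V z)
    (h3 : OnePt R (L3 * σ ^ 3) fun V z =>
      nstep β σ V z - nstep β (-σ) V z + 2 * Complex.I * σ * nls β V z)
    {Vf : ℝ → ℝ} {cm pf wf Ft hs' : ℝ → ℂ}
    (hV : ∀ y, |Vf y| ≤ R) (hV' : ∀ y, |Vf (y + gstep M) - Vf y| ≤ R' * gstep M)
    (hcm : ∀ y, ‖cm y‖ ≤ R) (hcm' : ∀ y, ‖cm (y + gstep M) - cm y‖ ≤ R' * gstep M)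
    (hpf : ∀ y, ‖pf y‖ ≤ R) (hpf' : ∀ y, ‖pf (y + gstep M) - pf y‖ ≤ R' * gstep M)
    (hwf : ∀ y, ‖wf y‖ ≤ R) (hwf' : ∀ y, ‖wf (y + gstep M) - wf y‖ ≤ R' * gstep M)
    (hyf' : ∀ y, ‖nstep β σ (Vf (y + gstep M)) (wf (y + gstep M)) - nstep β σ (Vf y) (wf y)‖ ≤
      R'' * gstep M)
    (htail : gsob i M (fun y => nls β (Vf y) (cm y) - Ft y) ≤ K * ε)
    (hctail : gsob i M (fun y => cm y - pf y) ≤ K * ε)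
    (hFt : gsob i M Ft ≤ K) (hhs : gsob i M hs' ≤ K * σ ^ 2)
    (hwp : ∀ y, wf y - pf y = hs' y + Complex.I * σ * Ft y) :
    gsob i M (fun y => 2 * Complex.I * σ * Ft y +
      (nstep β (2 * σ) (Vf y) (wf y) - wf y)) ≤
      (2 * (K + Lf * (1 + 2 * π * R') * K +
        Lf * (1 + 2 * π * R') * (Ls * (R + 2 * π * R') + K + K + Lf * (1 + 2 * π * R') * K +
          Lf * (1 + 2 * π * R') * (2 * K))) + L3 * (R + 2 * π * R'')) *
        (σ * (σ ^ 2 + ε)) := by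
  set Λ := Lf * (1 + 2 * π * R') with hΛdef
  have hΛ : 0 ≤ Λ := by positivity
  have hI : ‖Complex.I * (σ : ℂ)‖ = σ := by
    rw [norm_mul, Complex.norm_I, one_mul, Complex.norm_real, Real.norm_of_nonneg hσ]
  -- The midpoint of the potential flow that starts from `wf`; the symmetric expansion is made
  -- around it.
  set yf : ℝ → ℂ := fun y => nstep β σ (Vf y) (wf y) with hyf
  have hyR : ∀ y, ‖yf y‖ ≤ R := fun y => by rw [hyf]; simpa only [norm_nstep] using hwf y
  have b2 : gsob i M (fun y => nls β (Vf y) (cm y) - nls β (Vf y) (pf y)) ≤ Λ * (K * ε) :=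
    (gsob_sub_le_of_twoPt (Φ := nls β) hM hLf hR' hf hV hcm hpf hV' hcm' hi).trans (by gcongr)
  have b3 : gsob i M (fun y => pf y - wf y) ≤ 2 * K * σ := by
    have e : (fun y => pf y - wf y) = fun y => -(hs' y + Complex.I * σ * Ft y) := by
      ext y; rw [← hwp]; ring
    rw [e, gsob_neg]
    have := gsob_add_le i M hs' fun y => Complex.I * σ * Ft y
    rw [gsob_const_mul, hI] at this
    have h2 : σ ^ 2 ≤ σ := by nlinarith
    calc _ ≤ gsob i M hs' + σ * gsob i M Ft := this
      _ ≤ K * σ + σ * K := by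
          gcongr
          exact hhs.trans (by gcongr)
      _ = _ := by ring
  have b4 : gsob i M (fun y => nls β (Vf y) (pf y) - nls β (Vf y) (wf y)) ≤ Λ * (2 * K * σ) :=
    (gsob_sub_le_of_twoPt (Φ := nls β) hM hLf hR' hf hV hpf hwf hV' hpf' hi).trans (by gcongr)
  have b5 : gsob i M (fun y => yf y - wf y + Complex.I * σ * nls β (Vf y) (wf y)) ≤
      Ls * σ ^ 2 * (R + 2 * π * R') :=
    gsob_le_of_onePt (Vf := Vf) (f := wf)
      (Φ := fun V z => nstep β σ V z - z + Complex.I * σ * nls β V z) hM (by positivity) hR hR' hs (fun V => by simp [nstep_zero, nls_zero]) hV hwf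
      hV' hwf' hi
  -- The exact midpoint `pf` and the flow midpoint `yf` both differ from `wf` by `iσ` times a value
  -- of the nonlinearity at first order. These terms cancel up to increments of the nonlinearity,
  -- which are `O(σ + ε)` and carry another factor `σ`.
  have b6 : gsob i M (fun y => pf y - yf y) ≤
      (Ls * (R + 2 * π * R') + K + K + Λ * K + Λ * (2 * K)) * (σ ^ 2 + ε) := by
    have e : (fun y => pf y - yf y) = fun y =>
        (Complex.I * σ * (((nls β (Vf y) (cm y) - Ft y) -
          (nls β (Vf y) (cm y) - nls β (Vf y) (pf y))) -
          (nls β (Vf y) (pf y) - nls β (Vf y) (wf y))) - hs' y) -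
          (yf y - wf y + Complex.I * σ * nls β (Vf y) (wf y)) := by
      ext y
      linear_combination -(hwp y)
    rw [e]
    have a1 := gsob_sub_le i M (fun y => Complex.I * σ * (((nls β (Vf y) (cm y) - Ft y) -
          (nls β (Vf y) (cm y) - nls β (Vf y) (pf y))) -
          (nls β (Vf y) (pf y) - nls β (Vf y) (wf y))) - hs' y)
          (fun y => yf y - wf y + Complex.I * σ * nls β (Vf y) (wf y))
    have a2 := gsob_sub_le i M (fun y => Complex.I * σ * (((nls β (Vf y) (cm y) - Ft y) -
          (nls β (Vf y) (cm y) - nls β (Vf y) (pf y))) -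
          (nls β (Vf y) (pf y) - nls β (Vf y) (wf y)))) hs'
    rw [gsob_const_mul, hI] at a2
    have a3 := gsob_sub_le i M (fun y => (nls β (Vf y) (cm y) - Ft y) -
          (nls β (Vf y) (cm y) - nls β (Vf y) (pf y)))
          (fun y => nls β (Vf y) (pf y) - nls β (Vf y) (wf y))
    have a4 := gsob_sub_le i M (fun y => nls β (Vf y) (cm y) - Ft y)
          (fun y => nls β (Vf y) (cm y) - nls β (Vf y) (pf y))
    have a5 : σ * gsob i M (fun y => ((nls β (Vf y) (cm y) - Ft y) -
          (nls β (Vf y) (cm y) - nls β (Vf y) (pf y))) -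
          (nls β (Vf y) (pf y) - nls β (Vf y) (wf y))) ≤
          1 * (K * ε + Λ * (K * ε)) + Λ * (2 * K) * σ ^ 2 := by
      calc _ ≤ σ * (K * ε + Λ * (K * ε) + Λ * (2 * K * σ)) := by gcongr; linarith
        _ = σ * (K * ε + Λ * (K * ε)) + Λ * (2 * K) * σ ^ 2 := by ring
        _ ≤ _ := by gcongr
    have p1 : 0 ≤ Λ * K := by positivity
    have p2 : 0 ≤ Ls * (R + 2 * π * R') := by positivity
    have q1 : 0 ≤ Ls * (R + 2 * π * R') * ε := by positivity
    have q2 : 0 ≤ K * ε := by positivity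
    have q3 : 0 ≤ K * σ ^ 2 := by positivity
    have q4 : 0 ≤ Λ * K * σ ^ 2 := by positivity
    have q5 : 0 ≤ Λ * (2 * K) * ε := by positivity
    nlinarith
  set K6 := Ls * (R + 2 * π * R') + K + K + Λ * K + Λ * (2 * K) with hK6
  have hK6n : 0 ≤ K6 := by positivity
  have b7 : gsob i M (fun y => nls β (Vf y) (pf y) - nls β (Vf y) (yf y)) ≤
      Λ * (K6 * (σ ^ 2 + ε)) :=
    (gsob_sub_le_of_twoPt (Φ := nls β) hM hLf hR' hf hV hpf hyR hV' hpf' hi).trans (by gcongr)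
  have hgs := gstep_pos hM
  have hV'' : ∀ y, |Vf (y + gstep M) - Vf y| ≤ R'' * gstep M := fun y =>
    (hV' y).trans (by gcongr)
  have b8 : gsob i M (fun y => nstep β σ (Vf y) (yf y) - nstep β (-σ) (Vf y) (yf y) +
      2 * Complex.I * σ * nls β (Vf y) (yf y)) ≤ L3 * σ ^ 3 * (R + 2 * π * R'') :=
    gsob_le_of_onePt (Vf := Vf) (f := yf)
      (Φ := fun V z => nstep β σ V z - nstep β (-σ) V z + 2 * Complex.I * σ * nls β V z)
      hM (by positivity) hR (hR'.trans hRR) h3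
      (fun V => by simp [nstep_zero, nls_zero]) hV hyR hV'' hyf' hi
  -- The group property writes the full increment as the forward minus the backward half flow from
  -- `yf`; adding and subtracting the nonlinearity at `yf` and at the intermediate states leaves
  -- only terms already estimated.
  have e : (fun y => 2 * Complex.I * σ * Ft y + (nstep β (2 * σ) (Vf y) (wf y) - wf y)) = fun y =>
      (2 * (Complex.I * σ)) * (((nls β (Vf y) (cm y) - nls β (Vf y) (pf y)) +
        (nls β (Vf y) (pf y) - nls β (Vf y) (yf y))) - (nls β (Vf y) (cm y) - Ft y)) +
      (nstep β σ (Vf y) (yf y) - nstep β (-σ) (Vf y) (yf y) +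
      2 * Complex.I * σ * nls β (Vf y) (yf y)) := by
    ext y
    have e1 : nstep β σ (Vf y) (yf y) = nstep β (2 * σ) (Vf y) (wf y) := by
      rw [hyf]; simp only [nstep_nstep]; congr 1; ring
    have e2 : nstep β (-σ) (Vf y) (yf y) = wf y := by
      rw [hyf]; simp only [nstep_nstep]; rw [neg_add_cancel, nstep_zero_time]
    rw [e1, e2]; ring
  rw [e]
  have a1 := gsob_add_le i M (fun y => (2 * (Complex.I * σ)) *
        (((nls β (Vf y) (cm y) - nls β (Vf y) (pf y)) +
        (nls β (Vf y) (pf y) - nls β (Vf y) (yf y))) - (nls β (Vf y) (cm y) - Ft y)))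
      (fun y => nstep β σ (Vf y) (yf y) - nstep β (-σ) (Vf y) (yf y) +
      2 * Complex.I * σ * nls β (Vf y) (yf y))
  rw [gsob_const_mul, norm_mul, hI, Complex.norm_two] at a1
  have a2 := gsob_sub_le i M (fun y => (nls β (Vf y) (cm y) - nls β (Vf y) (pf y)) +
        (nls β (Vf y) (pf y) - nls β (Vf y) (yf y))) (fun y => nls β (Vf y) (cm y) - Ft y)
  have a3 := gsob_add_le i M (fun y => nls β (Vf y) (cm y) - nls β (Vf y) (pf y))
        (fun y => nls β (Vf y) (pf y) - nls β (Vf y) (yf y))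
  have hsq : 0 ≤ σ ^ 2 := sq_nonneg σ
  have hR'' : 0 ≤ R'' := hR'.trans hRR
  calc _ ≤ 2 * σ * (Λ * (K * ε) + Λ * (K6 * (σ ^ 2 + ε)) + K * ε) +
        L3 * σ ^ 3 * (R + 2 * π * R'') := by
        refine a1.trans (add_le_add ?_ b8)
        gcongr
        linarith
    _ ≤ 2 * σ * (Λ * (K * (σ ^ 2 + ε)) + Λ * (K6 * (σ ^ 2 + ε)) + K * (σ ^ 2 + ε)) +
        L3 * (σ * (σ ^ 2 + ε)) * (R + 2 * π * R'') := by
        have h1 : ε ≤ σ ^ 2 + ε := by linarith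
        have h2 : σ ^ 3 ≤ σ * (σ ^ 2 + ε) := by
          have : 0 ≤ σ * ε := by positivity
          nlinarith
        gcongr
    _ = _ := by ring

set_option maxHeartbeats 1000000 in
-- The new error is the old one carried by the unimodular phases, plus the difference of the
-- potential steps for the exact and the numerical state (Lipschitz with constant `O(τ)`), plus the
-- midpoint quadrature error, plus the symmetric defect. The `H¹` smallness hypothesis is needed
-- even for the `L²` estimate, because it confines the numerical state to the ball on which the
-- nonlinearity is Lipschitz.
theorem step_error {T κ β B Bv : ℝ} {m : ℕ} {c : ℝ → ℤ → ℂ} {v : ℤ → ℂ} (hκ : 0 ≤ κ) (hm : 5 ≤ m)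
    (hv : SobLE m v Bv) (hvr : cbar v = v) (hb : ∀ t ∈ Icc 0 T, SobLE m (c t) B)
    (hB : 0 ≤ B) (hc : ∀ k, ContinuousOn (fun t => c t k) (Icc 0 T))
    (hd : ∀ k, ∀ t ∈ Ioo 0 T, HasDerivAt (fun t => c t k)
      (-Complex.I * (κ * k ^ 2 * c t k + nonlin v β (c t) k)) t) :
    ∃ C, 0 ≤ C ∧ ∀ (M : ℕ) (τ t : ℝ) (a : ℤ → ℂ), 0 < M → 0 < τ → τ ≤ 1 → t ∈ Icc 0 T →
      t + τ ∈ Icc 0 T → trunc M a = a →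
      SobLE 1 (fun k => trunc M (c t) k - a k) (1 / (embConst + 1)) →
      ∀ (i : ℕ) (E : ℝ), i ≤ 1 → SobLE i (fun k => trunc M (c t) k - a k) E →
        SobLE i (fun k => trunc M (c (t + τ)) k - numStep κ β v M τ a k)
          ((1 + C * τ) * E + C * τ * (τ ^ 2 + (M : ℝ) ^ i / M ^ m)) := by
  have hFB : FamBdd T m c := ⟨B, hB, hb⟩
  have hBv := hv.nonneg
  have hemb := embConst_nonneg
  have hv5 : SobLE 5 v Bv := hv.weaken hm
  obtain ⟨_, hF3, hF1⟩ := time_regularity (β := β) hκ hv5 (hFB.weaken hm) hc hd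
  obtain ⟨CF, hCF, hF⟩ := hFB.nonlin (β := β) (by omega) hv
  have hF5 : FamBdd T 5 fun t => nonlin v β (c t) := FamBdd.weaken ⟨CF, hCF, hF⟩ hm
  obtain ⟨C1, hC1, hmid⟩ := midpoint_error hκ hc hd hF5 hF3 hF1
  obtain ⟨C2, hC2, hhalf⟩ := half_step_error hκ hc hd hF5 hF3
  -- The summand `1` is room for the numerical state. Its distance to the exact one is at most
  -- `embConst / (embConst + 1) ≤ 1` in the sup norm.
  set R := embConst * (B + Bv) + 1 with hRdef
  set R' := embConst * (B + Bv) with hR'def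
  have hR' : 0 ≤ R' := by positivity
  have hR : 0 ≤ R := by positivity
  obtain ⟨Lf, hLf, hf⟩ := exists_nls_twoPt β R
  obtain ⟨Ls, hLs, hs⟩ := exists_nstep_taylor_onePt β R
  obtain ⟨L3, hL3, h3⟩ := exists_nstep_symm_onePt β R
  obtain ⟨L0, hL0, h0⟩ := exists_nstep_onePt β R
  obtain ⟨Ld, hLd, hdd⟩ := exists_nstep_sub_twoPt β R
  set K := 3 * (2 ^ m * embConst ^ 2 * (CF + B)) + (1 + π) * (CF + C2) with hKdef
  have hK : 0 ≤ K := by positivity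
  -- Grid increments after half a potential step: the one-point Lipschitz constant times the
  -- increments of potential and state; `R'` is added so that `R''` dominates it.
  set R'' := R' + L0 * (2 * R') with hR''def
  set D := 2 * (K + Lf * (1 + 2 * π * R') * K +
        Lf * (1 + 2 * π * R') * (Ls * (R + 2 * π * R') + K + K + Lf * (1 + 2 * π * R') * K +
          Lf * (1 + 2 * π * R') * (2 * K))) + L3 * (R + 2 * π * R'') with hDdef
  have hR''n : 0 ≤ R'' := by positivity
  have hD : 0 ≤ D := by positivity
  refine ⟨C1 + D + Ld * (1 + 2 * π * R') * (1 + π), by positivity, ?_⟩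
  intro M τ t a hM hτ hτ1 ht htτ hat hsmall i E hi hE
  have hM' : (0 : ℝ) < M := by exact_mod_cast hM
  set σ := τ / 2 with hσdef
  have hσ : 0 ≤ σ := by positivity
  have hσ1 : σ ≤ 1 := by linarith
  have hE0 := hE.nonneg
  set tm := t + σ with htm
  have htm1 : tm - σ = t := by rw [htm]; ring
  have htm2 : tm + σ = t + τ := by rw [htm, hσdef]; ring
  have htmI : tm ∈ Icc 0 T := ⟨by linarith [ht.1], by linarith [htτ.2]⟩
  set ε := (M : ℝ) ^ i / M ^ m with hε
  have hεn : 0 ≤ ε := by positivity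
  set F := nonlin v β (c tm) with hFdef
  have hFm : SobLE m F CF := hF tm htmI
  set w : ℤ → ℂ := fun k => phase κ (-σ) k * c t k with hw
  have hwm : SobLE m w B := (hb t ht).of_norm_le fun k => by rw [norm_mul, norm_phase, one_mul]
  have hcm := hb tm htmI
  set w' : ℤ → ℂ := fun k => phase κ (-σ) k * a k with hw'
  have hw't : trunc M w' = w' := by
    ext k
    rw [hw', trunc_mul, hat]
  set Vf : ℝ → ℝ := fun y => (fser v y).re with hVf
  have hRB : embConst * B ≤ R' := by rw [hR'def]; gcongr; linarith
  have hRBv : embConst * Bv ≤ R' := by rw [hR'def]; gcongr; linarith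
  have hR1 : R = R' + 1 := rfl
  have hbound : ∀ {d : ℤ → ℂ}, SobLE m d B → ∀ y, ‖fser d y‖ ≤ R := fun hd y =>
    (hd.norm_fser_le (by omega) y).trans (by linarith)
  have hgs := gstep_pos hM
  have hincr : ∀ {d : ℤ → ℂ}, SobLE m d B → ∀ y,
      ‖fser d (y + gstep M) - fser d y‖ ≤ R' * gstep M := fun hd y =>
    ((hd.weaken (by omega : 2 ≤ m)).norm_fser_increment_le hM y).trans (by gcongr)
  have hV : ∀ y, |Vf y| ≤ R := fun y =>
    (Complex.abs_re_le_norm _).trans ((hv.norm_fser_le (by omega) y).trans (by linarith))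
  have hV' : ∀ y, |Vf (y + gstep M) - Vf y| ≤ R' * gstep M := fun y => by
    have := (hv.weaken (by omega : 2 ≤ m)).norm_fser_increment_le hM y
    rw [hVf]
    simp only
    rw [← Complex.sub_re]
    exact (Complex.abs_re_le_norm _).trans (this.trans (by gcongr))
  have hwf := hbound (hwm.trunc M)
  have hwf' := hincr (hwm.trunc M)
  have hm1 : 1 ≤ m := by omega
  have hcs := hcm.summable_norm hm1
  have hFs := hFm.summable_norm hm1
  have htail : ∀ {d : ℤ → ℂ} {A : ℝ}, SobLE m d A → A ≤ CF + B →
      gsob i M (fun y => fser d y - fser (trunc M d) y) ≤ K * ε := by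
    intro d A hd hA
    have h1 : (fun y => fser d y - fser (trunc M d) y) = fser fun k => d k - trunc M d k := by
      ext y; rw [fser_sub (hd.summable_norm hm1) (summable_norm_trunc M d)]
    have h2 : SobLE m (fun k => d k - trunc M d k) A := hd.of_norm_le fun k => by
      unfold trunc; split_ifs <;> simp
    rw [h1]
    refine (h2.gsob_fser_le_of_high hM (by omega) hi fun k hk => by
      rw [trunc_of_lt hk, sub_self]).trans ?_
    have : 0 ≤ (1 + π) * (CF + C2) := by positivity
    refine mul_le_mul_of_nonneg_right ?_ hεn
    rw [hKdef]
    have : 3 * (2 ^ m * embConst ^ 2 * A) ≤ 3 * (2 ^ m * embConst ^ 2 * (CF + B)) := by gcongr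
    linarith
  have hHS := hhalf tm σ hσ (by rwa [htm1]) htmI
  rw [htm1] at hHS
  set HS : ℤ → ℂ := fun k => phase κ (-σ) k * c t k - c tm k - Complex.I * σ * F k with hHSdef
  have hKK : (1 + π) * (CF + C2) ≤ K := by
    rw [hKdef]
    have : 0 ≤ 3 * (2 ^ m * embConst ^ 2 * (CF + B)) := by positivity
    linarith
  have hdef := symmetric_defect_le (Vf := Vf) (cm := fser (c tm)) (pf := fser (trunc M (c tm)))
    (wf := fser (trunc M w)) (Ft := fser (trunc M F)) (hs' := fser (trunc M HS)) (ε := ε)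
    hM hi hLf hLs hL3 hR hR'
    (le_add_of_nonneg_right (by positivity) : R' ≤ R'') hK hεn hσ hσ1 hf (hs σ hσ hσ1)
    (h3 σ hσ hσ1) hV hV' (hbound hcm) (hincr hcm) (hbound (hcm.trunc M)) (hincr (hcm.trunc M))
    hwf hwf'
    (fun y => by
      refine (h0 σ (by rwa [abs_of_nonneg hσ]) _ _ _ _ (hV y) (hV _) (hwf y) (hwf _)).trans ?_
      have a1 := hV' y
      have a2 := hwf' y
      calc _ ≤ L0 * (R' * gstep M + R' * gstep M) := by gcongr
        _ ≤ R' * gstep M + L0 * (R' * gstep M + R' * gstep M) :=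
            le_add_of_nonneg_left (by positivity)
        _ = R'' * gstep M := by rw [hR''def]; ring)
    (by
      have h1 : ∀ y, nls β (Vf y) (fser (c tm) y) = fser F y := fun y =>
        (fser_nonlin hm1 hcm hv hvr y).symm
      simp_rw [h1]
      exact htail hFm (by linarith))
    (htail hcm (by linarith))
    (((hFm.weaken (by omega : i ≤ m)).gsob_fser_trunc_le hM hi).trans
      (le_trans (by gcongr; linarith) hKK))
    (((hHS.weaken hi).gsob_fser_trunc_le hM hi).trans (by
      have : (1 + π) * C2 ≤ (1 + π) * (CF + C2) := by gcongr; linarith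
      calc (1 + π) * (C2 * σ ^ 2) = (1 + π) * C2 * σ ^ 2 := by ring
        _ ≤ K * σ ^ 2 := by gcongr; linarith))
    (fun y => by
      rw [← fser_sub (summable_norm_trunc M w) (summable_norm_trunc M _), ← fser_const_mul,
        ← fser_add (summable_norm_trunc M _)
          (by simpa using (summable_norm_trunc M F).mul_left ‖Complex.I * (σ : ℂ)‖)]
      congr 1
      ext k
      rw [← trunc_sub, ← trunc_mul M (fun _ => Complex.I * (σ : ℂ)), ← trunc_add]
      congr 1
      ext k
      simp only [hw, hHSdef]; ring)
  have h2σ : 2 * σ = τ := by rw [hσdef]; ring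
  rw [h2σ] at hdef
  -- `G` is the symmetric defect along the exact solution. The function `D'` below compares the
  -- increments of the potential flow for the exact and the numerical state.
  set G : ℝ → ℂ := fun y => 2 * Complex.I * σ * fser (trunc M F) y +
    (nstep β τ (Vf y) (fser (trunc M w) y) - fser (trunc M w) y) with hG
  set D' : ℝ → ℂ := fun y => (nstep β τ (Vf y) (fser (trunc M w) y) - fser (trunc M w) y) -
    (nstep β τ (Vf y) (fser w' y) - fser w' y) with hD'
  have hVp : ∀ y, Vf (y + 2 * π) = Vf y := fun y => by simp only [hVf, fser_add_two_pi]
  have hGp : ∀ y, G (y + 2 * π) = G y := fun y => by simp only [hG, hVp, fser_add_two_pi]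
  have hD'p : ∀ y, D' (y + 2 * π) = D' y := fun y => by simp only [hD', hVp, fser_add_two_pi]
  have hww : ∀ k, trunc M w k - w' k = phase κ (-σ) k * (trunc M (c t) k - a k) := fun k => by
    rw [hw, hw', trunc_mul]; ring
  have hwwi : SobLE i (fun k => trunc M w k - w' k) E := hE.of_norm_le fun k => by
    rw [hww, norm_mul, norm_phase, one_mul]
  have hww1 : SobLE 1 (fun k => trunc M w k - w' k) (1 / (embConst + 1)) :=
    hsmall.of_norm_le fun k => by rw [hww, norm_mul, norm_phase, one_mul]
  have hw's : Summable fun k => ‖w' k‖ := by rw [← hw't]; exact summable_norm_trunc M w'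
  have hwws : ∀ y, fser (trunc M w) y - fser w' y = fser (fun k => trunc M w k - w' k) y :=
    fun y => (fser_sub (summable_norm_trunc M w) hw's y).symm
  have hafR : ∀ y, ‖fser w' y‖ ≤ R := fun y => by
    have h1 := hww1.norm_fser_le le_rfl y
    rw [← hwws] at h1
    have h2 : embConst * (1 / (embConst + 1)) ≤ 1 := by
      rw [mul_one_div, div_le_one (by positivity)]; linarith
    have h3 := ((hwm.trunc M).norm_fser_le hm1 y)
    have h4 : fser w' y = fser (trunc M w) y - (fser (trunc M w) y - fser w' y) := by ring
    rw [h4]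
    exact (norm_sub_le _ _).trans (by linarith)
  have hD'le : gsob i M D' ≤ Ld * τ * (1 + 2 * π * R') * ((1 + π) * E) := by
    refine (gsob_sub_le_of_twoPt (Vf := Vf) (f := fser (trunc M w)) (g := fser w')
      (Φ := fun V z => nstep β τ V z - z) hM (by positivity) hR' (hdd τ hτ.le hτ1) hV hwf hafR hV' hwf'
      hi).trans ?_
    refine mul_le_mul_of_nonneg_left ?_ (by positivity)
    have h1 : (fun y => fser (trunc M w) y - fser w' y) =
        fser (trunc M fun k => trunc M w k - w' k) := by
      ext y
      rw [hwws]
      congr 1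
      ext k
      rw [trunc_sub, trunc_trunc, hw't]
    rw [h1]
    exact hwwi.gsob_fser_trunc_le hM hi
  have hMP := ((hmid tm σ hσ (by rwa [htm1]) (by rwa [htm2])).trunc M).weaken hi
  rw [htm1, htm2] at hMP
  have htot := (((hMP.add hwwi).add (sobLE_trunc_dft hM hD'p hi)).sub
    (sobLE_trunc_dft hM hGp hi)).of_norm_le
    (c := fun k => trunc M (c (t + τ)) k - numStep κ β v M τ a k) fun k => le_of_eq ?_
  · refine htot.mono ?_
    have hστ : σ ≤ τ := by rw [hσdef]; linarith
    have hσ2 : σ ^ 2 ≤ τ ^ 2 := pow_le_pow_left₀ hσ hστ 2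
    have h1 : C1 * σ ^ 3 ≤ C1 * (τ * (τ ^ 2 + ε)) := by
      refine mul_le_mul_of_nonneg_left ?_ hC1
      calc σ ^ 3 = σ * σ ^ 2 := by ring
        _ ≤ τ * (τ ^ 2 + ε) := by gcongr; linarith
    have h2 : gsob i M G ≤ D * (τ * (τ ^ 2 + ε)) := hdef.trans (by gcongr)
    have hX : 0 ≤ τ * (τ ^ 2 + ε) := by positivity
    have h3 : 0 ≤ Ld * (1 + 2 * π * R') * (1 + π) * (τ * (τ ^ 2 + ε)) := by positivity
    have h4 : 0 ≤ (C1 + D) * (τ * E) := by positivity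
    have h5 : gsob i M D' ≤ Ld * (1 + 2 * π * R') * (1 + π) * (τ * E) :=
      hD'le.trans (le_of_eq (by ring))
    have h6 : (1 + (C1 + D + Ld * (1 + 2 * π * R') * (1 + π)) * τ) * E +
        (C1 + D + Ld * (1 + 2 * π * R') * (1 + π)) * τ * (τ ^ 2 + ε) =
        (C1 * (τ * (τ ^ 2 + ε)) + E + Ld * (1 + 2 * π * R') * (1 + π) * (τ * E) +
          D * (τ * (τ ^ 2 + ε))) + ((C1 + D) * (τ * E) +
          Ld * (1 + 2 * π * R') * (1 + π) * (τ * (τ ^ 2 + ε))) := by ring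
    rw [h6]
    linarith
  -- Multiplication by the inverse phase undoes the last free half step without changing the
  -- modulus, so the error becomes exactly the combination of the four sequences just bounded. The
  -- identity relies on the discrete transform reproducing series with frequencies `|k| < M`.
  · have hphase : ∀ z : ℂ, ‖z‖ = ‖phase κ σ k * z‖ := fun z => by
      rw [norm_mul, norm_phase, one_mul]
    rw [hphase (trunc M (c (t + τ)) k - numStep κ β v M τ a k)]
    congr 1
    have e1 : trunc M (dft M fun y => nstep β τ (Vf y) (fser w' y)) k =
        trunc M (dft M fun y => nstep β τ (Vf y) (fser w' y) - fser w' y) k + w' k := by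
      have : w' k = trunc M (dft M (fser w')) k := by
        conv_rhs => rw [← hw't, dft_fser_trunc hM, hw't]
      rw [this, ← trunc_add]
      congr 1
      ext l
      rw [← dft_add]; congr 1; ext y; ring
    have e2 : trunc M (dft M G) k = 2 * Complex.I * σ * trunc M F k +
        trunc M (dft M fun y => nstep β τ (Vf y) (fser (trunc M w) y) - fser (trunc M w) y) k := by
      have : trunc M F k = trunc M (dft M (fser (trunc M F))) k := by rw [dft_fser_trunc hM]
      rw [this, ← trunc_mul M (fun _ => 2 * Complex.I * (σ : ℂ)), ← trunc_add]
      congr 1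
      ext l
      rw [← dft_const_mul, ← dft_add]
    have e3 : trunc M (dft M D') k =
        trunc M (dft M fun y => nstep β τ (Vf y) (fser (trunc M w) y) - fser (trunc M w) y) k -
        trunc M (dft M fun y => nstep β τ (Vf y) (fser w' y) - fser w' y) k := by
      rw [← trunc_sub]
      congr 1
      ext l
      rw [← dft_sub]
    have e4 : numStep κ β v M τ a k =
      phase κ (-σ) k * trunc M (dft M fun y => nstep β τ (Vf y) (fser w' y)) k := rfl
    rw [e2, e3, e4, e1, trunc_add, trunc_sub, trunc_mul, trunc_mul,
      trunc_mul M (fun _ => 2 * Complex.I * (σ : ℂ))]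
    have := phase_neg_mul κ σ k
    linear_combination (-(trunc M (dft M fun y => nstep β τ (Vf y) (fser w' y) - fser w' y) k + w' k)) *
      this

/-- Convergence of the scheme for the Fourier coefficients. -/
theorem fourier_convergence {T κ β B Bv : ℝ} {m : ℕ} {c : ℝ → ℤ → ℂ} {v : ℤ → ℂ} (hκ : 0 ≤ κ)
    (hm : 5 ≤ m) (hT : 0 ≤ T)
    (hv : SobLE m v Bv) (hvr : cbar v = v) (hb : ∀ t ∈ Icc 0 T, SobLE m (c t) B)
    (hc : ∀ k, ContinuousOn (fun t => c t k) (Icc 0 T))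
    (hd : ∀ k, ∀ t ∈ Ioo 0 T, HasDerivAt (fun t => c t k)
      (-Complex.I * (κ * k ^ 2 * c t k + nonlin v β (c t) k)) t) :
    ∃ C δ, 0 < C ∧ 0 < δ ∧ ∀ (M : ℕ) (τ : ℝ) (a : ℕ → ℤ → ℂ), 0 < M → 0 < τ → τ ≤ 1 →
      τ ^ 2 + (M : ℝ) ^ 1 / M ^ m ≤ δ → a 0 = trunc M (dft M (fser (c 0))) →
      (∀ n, a (n + 1) = numStep κ β v M τ (a n)) →
      ∀ n : ℕ, n * τ ≤ T → ∀ i ≤ 1,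
        SobLE i (fun k => trunc M (c (n * τ)) k - a n k) (C * (τ ^ 2 + (M : ℝ) ^ i / M ^ m)) := by
  have h0T : (0 : ℝ) ∈ Icc 0 T := ⟨le_rfl, hT⟩
  have hB := (hb 0 h0T).nonneg
  have hemb := embConst_nonneg
  obtain ⟨C, hC, hstep⟩ := step_error (β := β) hκ hm hv hvr hb hB hc hd
  obtain ⟨K, hKdef⟩ : ∃ K, K = 3 * (2 ^ m * embConst ^ 2 * B) := ⟨_, rfl⟩
  have hK : 0 ≤ K := by rw [hKdef]; positivity
  -- The first constant is the Gronwall bound. The second keeps the `H¹` error below the threshold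
  -- `1 / (embConst + 1)` required by the step estimate at every time level.
  refine ⟨Real.exp (C * T) * (K + C * T) + 1, 1 / (embConst + 1) / (Real.exp (C * T) * (K + C * T) + 1),
    by positivity, by positivity, ?_⟩
  intro M τ a hM hτ hτ1 hδ ha0 ha
  have hM' : (0 : ℝ) < M := by exact_mod_cast hM
  have hat : ∀ n, trunc M (a n) = a n := by
    intro n
    cases n with
    | zero => rw [ha0, trunc_trunc]
    | succ n =>
      rw [ha]
      ext k
      unfold numStep
      rw [trunc_mul, trunc_trunc]
  have hgrowth : ∀ (n : ℕ) (i : ℕ), n * τ ≤ T →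
      (1 + C * τ) ^ n * (K * ((M : ℝ) ^ i / M ^ m) + n * (C * τ * (τ ^ 2 + (M : ℝ) ^ i / M ^ m))) ≤
        (Real.exp (C * T) * (K + C * T) + 1) * (τ ^ 2 + (M : ℝ) ^ i / M ^ m) := by
    intro n i hn
    have hε : 0 ≤ (M : ℝ) ^ i / M ^ m := by positivity
    have h1 : (1 + C * τ) ^ n ≤ Real.exp (C * T) := by
      calc (1 + C * τ) ^ n ≤ Real.exp (C * τ) ^ n := by
            refine pow_le_pow_left₀ (by positivity) ?_ n
            rw [add_comm]; exact Real.add_one_le_exp _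
        _ = Real.exp (C * (n * τ)) := by rw [← Real.exp_nat_mul]; congr 1; ring
        _ ≤ _ := by gcongr
    have h2 : (n : ℝ) * (C * τ * (τ ^ 2 + (M : ℝ) ^ i / M ^ m)) ≤
        C * T * (τ ^ 2 + (M : ℝ) ^ i / M ^ m) := by
      calc _ = C * (n * τ) * (τ ^ 2 + (M : ℝ) ^ i / M ^ m) := by ring
        _ ≤ _ := by gcongr
    have h3 : K * ((M : ℝ) ^ i / M ^ m) ≤ K * (τ ^ 2 + (M : ℝ) ^ i / M ^ m) := by
      gcongr
      have := sq_nonneg τ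
      linarith
    have h4 : 0 ≤ τ ^ 2 + (M : ℝ) ^ i / M ^ m := by positivity
    calc _ ≤ Real.exp (C * T) * (K * (τ ^ 2 + (M : ℝ) ^ i / M ^ m) +
          C * T * (τ ^ 2 + (M : ℝ) ^ i / M ^ m)) := by gcongr
      _ = Real.exp (C * T) * (K + C * T) * (τ ^ 2 + (M : ℝ) ^ i / M ^ m) := by ring
      _ ≤ _ := by
        refine mul_le_mul_of_nonneg_right ?_ h4
        linarith
  -- Both orders are carried in one induction, since the case `i = 1` at level `n` supplies the
  -- smallness hypothesis for the next step in either norm.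
  have main : ∀ n : ℕ, n * τ ≤ T → ∀ i ≤ 1,
      SobLE i (fun k => trunc M (c (n * τ)) k - a n k)
        ((1 + C * τ) ^ n * (K * ((M : ℝ) ^ i / M ^ m) +
          n * (C * τ * (τ ^ 2 + (M : ℝ) ^ i / M ^ m)))) := by
    intro n
    induction n with
    | zero =>
      intro _ i hi
      have hm1 : 1 ≤ m := by omega
      have h0 := hb 0 h0T
      have hs := h0.summable_norm hm1
      have h2 : SobLE m (fun k => trunc M (c 0) k - c 0 k) B := h0.of_norm_le fun k => by
        unfold trunc; split_ifs <;> simp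
      have h3 := h2.gsob_fser_le_of_high hM (by omega) hi fun k hk => by
        rw [trunc_of_lt hk, sub_self]
      have h4 := (sobLE_trunc_dft hM (g := fser fun k => trunc M (c 0) k - c 0 k)
        (fun y => fser_add_two_pi y) hi).mono h3
      -- The initial error is pure aliasing: it is the discrete transform of the unresolved part of
      -- the initial value.
      have e : (fun k => trunc M (c ((0 : ℕ) * τ)) k - a 0 k) =
          trunc M (dft M (fser fun k => trunc M (c 0) k - c 0 k)) := by
        ext k
        have e1 : (fser fun k => trunc M (c 0) k - c 0 k) =
            fun y => fser (trunc M (c 0)) y - fser (c 0) y := by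
          ext y; rw [fser_sub (summable_norm_trunc M _) hs]
        have e2 : dft M (fun y => fser (trunc M (c 0)) y - fser (c 0) y) =
            fun k => dft M (fser (trunc M (c 0))) k - dft M (fser (c 0)) k := by
          ext k; rw [dft_sub]
        rw [e1, e2, trunc_sub, dft_fser_trunc hM, ha0, Nat.cast_zero, zero_mul]
      rw [e]
      simpa [hKdef] using h4
    | succ n ih =>
      intro hn i hi
      have hn1 : ((n + 1 : ℕ) : ℝ) * τ = n * τ + τ := by push_cast; ring
      have hn' : (n : ℝ) * τ ≤ T := by linarith
      have hnn : 0 ≤ (n : ℝ) * τ := by positivity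
      have hsm := (ih hn' 1 le_rfl).mono ((hgrowth n 1 hn').trans (b := _) (c := 1 / (embConst + 1)) (by
        have hpos : 0 < Real.exp (C * T) * (K + C * T) + 1 := by positivity
        calc _ ≤ (Real.exp (C * T) * (K + C * T) + 1) *
              (1 / (embConst + 1) / (Real.exp (C * T) * (K + C * T) + 1)) := by gcongr
          _ = _ := by field_simp))
      have := hstep M τ (n * τ) (a n) hM hτ hτ1 ⟨hnn, hn'⟩ ⟨by linarith, by linarith⟩ (hat n) hsm i _
        hi (ih hn' i hi)
      rw [← ha, ← hn1] at this
      refine this.mono ?_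
      have hε : 0 ≤ (M : ℝ) ^ i / M ^ m := by positivity
      have h1 : 1 ≤ (1 + C * τ) ^ (n + 1) := one_le_pow₀ (by
        have : 0 ≤ C * τ := by positivity
        linarith)
      have h2 : 0 ≤ C * τ * (τ ^ 2 + (M : ℝ) ^ i / M ^ m) := by positivity
      push_cast
      calc _ = (1 + C * τ) ^ (n + 1) * (K * ((M : ℝ) ^ i / M ^ m) +
            n * (C * τ * (τ ^ 2 + (M : ℝ) ^ i / M ^ m))) +
            1 * (C * τ * (τ ^ 2 + (M : ℝ) ^ i / M ^ m)) := by ring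
        _ ≤ (1 + C * τ) ^ (n + 1) * (K * ((M : ℝ) ^ i / M ^ m) +
            n * (C * τ * (τ ^ 2 + (M : ℝ) ^ i / M ^ m))) +
            (1 + C * τ) ^ (n + 1) * (C * τ * (τ ^ 2 + (M : ℝ) ^ i / M ^ m)) := by gcongr
        _ = _ := by ring
  exact fun n hn i hi => (main n hn i hi).mono (hgrowth n i hn)

/-! ### Primitives of integrable functions and weak derivatives -/

section weak

variable {a b : ℝ}

/-- Since `g` is merely integrable, its primitive need not be differentiable everywhere; Fubini's
theorem on the triangle `t ≤ x` replaces the product rule. -/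
theorem integral_mul_integral_indicator (hab : a ≤ b) {φ φ' g : ℝ → ℂ}
    (hφ : ∀ x, HasDerivAt φ (φ' x) x) (hφ' : Continuous φ') (hg : IntervalIntegrable g volume a b) :
    ∫ x in a..b, φ' x * ∫ t in a..x, g t = φ b * (∫ t in a..b, g t) - ∫ x in a..b, φ x * g x := by
  have hg' : IntegrableOn g (Ioc a b) := (intervalIntegrable_iff_integrableOn_Ioc_of_le hab).1 hg
  have hi : Integrable φ' (volume.restrict (Ioc a b)) :=
    (hφ'.integrableOn_Icc (a := a) (b := b)).mono_set Ioc_subset_Icc_self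
  have hprod : Integrable (fun p : ℝ × ℝ => {p : ℝ × ℝ | p.2 ≤ p.1}.indicator
      (fun p => φ' p.1 * g p.2) p) ((volume.restrict (Ioc a b)).prod (volume.restrict (Ioc a b))) :=
    (hi.mul_prod hg').indicator (measurableSet_le measurable_snd measurable_fst)
  have hswap := integral_integral_swap (f := fun x t => {p : ℝ × ℝ | p.2 ≤ p.1}.indicator
      (fun p => φ' p.1 * g p.2) (x, t)) hprod
  have e1 : ∀ x ∈ Ioc a b, ∫ t in Ioc a b, {p : ℝ × ℝ | p.2 ≤ p.1}.indicator
      (fun p => φ' p.1 * g p.2) (x, t) = φ' x * ∫ t in a..x, g t := fun x hx => by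
    have : ∀ t, {p : ℝ × ℝ | p.2 ≤ p.1}.indicator (fun p => φ' p.1 * g p.2) (x, t) =
        (Iic x).indicator (fun t => φ' x * g t) t := fun t => by
      simp only [indicator, mem_ofPred_eq, mem_Iic]
    simp_rw [this]
    rw [setIntegral_indicator measurableSet_Iic, Ioc_inter_Iic, min_eq_right hx.2,
      intervalIntegral.integral_of_le hx.1.le, integral_const_mul]
  have e2 : ∀ t ∈ Ioc a b, ∫ x in Ioc a b, {p : ℝ × ℝ | p.2 ≤ p.1}.indicator
      (fun p => φ' p.1 * g p.2) (x, t) = (φ b - φ t) * g t := fun t ht => by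
    have : ∀ x, {p : ℝ × ℝ | p.2 ≤ p.1}.indicator (fun p => φ' p.1 * g p.2) (x, t) =
        (Ici t).indicator (fun x => φ' x * g t) x := fun x => by
      simp only [indicator, mem_ofPred_eq, mem_Ici]
    simp_rw [this]
    have hset : Ioc a b ∩ Ici t = Icc t b := by
      ext y; simp only [mem_inter_iff, mem_Ioc, mem_Ici, mem_Icc]
      exact ⟨fun h => ⟨h.2, h.1.2⟩, fun h => ⟨⟨ht.1.trans_le h.1, h.2⟩, h.1⟩⟩
    rw [setIntegral_indicator measurableSet_Ici, hset, integral_Icc_eq_integral_Ioc,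
      ← intervalIntegral.integral_of_le ht.2, intervalIntegral.integral_mul_const,
      intervalIntegral.integral_eq_sub_of_hasDerivAt (fun x _ => hφ x)
        (hφ'.intervalIntegrable _ _)]
  rw [setIntegral_congr_fun measurableSet_Ioc e1, setIntegral_congr_fun measurableSet_Ioc e2,
    ← intervalIntegral.integral_of_le hab, ← intervalIntegral.integral_of_le hab] at hswap
  rw [hswap]
  have hc : Continuous φ := continuous_iff_continuousAt.2 fun x => (hφ x).continuousAt
  simp_rw [sub_mul]
  rw [intervalIntegral.integral_sub (hg.const_mul _) (hg.continuousOn_mul hc.continuousOn),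
    intervalIntegral.integral_const_mul]

/-- Integration by parts for the primitive of an integrable function. -/
theorem integral_deriv_mul_primitive (hab : a ≤ b) {φ φ' U g : ℝ → ℂ}
    (hφ : ∀ x, HasDerivAt φ (φ' x) x) (hφ' : Continuous φ') (hg : IntervalIntegrable g volume a b)
    (hU : ∀ x ∈ Icc a b, U x = U a + ∫ t in a..x, g t) :
    ∫ x in a..b, φ' x * U x = φ b * U b - φ a * U a - ∫ x in a..b, φ x * g x := by
  have h1 : ∫ x in a..b, φ' x * U x =
      ∫ x in a..b, (φ' x * U a + φ' x * ∫ t in a..x, g t) := by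
    refine intervalIntegral.integral_congr fun x hx => ?_
    rw [uIcc_of_le hab] at hx
    simp only [hU x hx, mul_add]
  have hG : ContinuousOn (fun x => ∫ t in a..x, g t) (uIcc a b) :=
    intervalIntegral.continuousOn_primitive_interval'  hg left_mem_uIcc
  have h2 : IntervalIntegrable (fun x => φ' x * U a) volume a b :=
    (hφ'.mul continuous_const).intervalIntegrable _ _
  have h3 : IntervalIntegrable (fun x => φ' x * ∫ t in a..x, g t) volume a b :=
    (hφ'.continuousOn.mul hG).intervalIntegrable
  rw [h1, intervalIntegral.integral_add h2 h3, integral_mul_integral_indicator hab hφ hφ' hg,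
    intervalIntegral.integral_mul_const, intervalIntegral.integral_eq_sub_of_hasDerivAt
      (fun x _ => hφ x) (hφ'.intervalIntegrable _ _), hU b (right_mem_Icc.2 hab)]
  ring

/-- `φ ∈ C_c^∞((a, b))`. -/
structure IsTest (a b : ℝ) (φ : ℝ → ℝ) : Prop where
  smooth : ContDiff ℝ ∞ φ
  compact : HasCompactSupport φ
  supp : tsupport φ ⊆ Ioo a b

namespace IsTest

variable {φ η : ℝ → ℝ}

theorem eq_zero (h : IsTest a b φ) {x : ℝ} (hx : x ∉ Ioo a b) : φ x = 0 :=
  image_eq_zero_of_notMem_tsupport fun h' => hx (h.supp h')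

theorem integrableOn_mul (h : IsTest a b φ) {g : ℝ → ℂ} (hg : LocallyIntegrableOn g (Ioo a b)) :
    IntegrableOn (fun x => ((φ x : ℝ) : ℂ) * g x) (Ioo a b) := by
  have h1 : IntegrableOn g (tsupport φ) :=
    hg.integrableOn_compact_subset h.supp h.compact
  have h2 : IntegrableOn (fun x => ((φ x : ℝ) : ℂ) * g x) (tsupport φ) :=
    h1.continuousOn_mul (Complex.continuous_ofReal.comp h.smooth.continuous).continuousOn h.compact
  refine Integrable.integrableOn ((integrableOn_iff_integrable_of_support_subset ?_).1 h2)
  refine fun x hx => subset_tsupport _ fun h0 => hx ?_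
  simp [h0]

theorem deriv (h : IsTest a b φ) : IsTest a b (deriv φ) where
  smooth := (contDiff_infty_iff_deriv.1 h.smooth).2
  compact := h.compact.deriv
  supp := tsupport_deriv_subset.trans h.supp

theorem sub_const_mul (h : IsTest a b φ) (h' : IsTest a b η) (r : ℝ) :
    IsTest a b fun x => φ x - r * η x where
  smooth := h.smooth.sub (contDiff_const.mul h'.smooth)
  compact := h.compact.sub (h'.compact.mul_left (f := fun _ => r))
  supp := by
    refine (tsupport_sub _ _).trans (union_subset h.supp ?_)
    exact (tsupport_mul_subset_right (f := fun _ => r)).trans h'.supp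

theorem exists_integral_eq_one (hab : a < b) : ∃ φ, IsTest a b φ ∧ ∫ x, φ x = 1 := by
  let f : ContDiffBump ((a + b) / 2) :=
    { rIn := (b - a) / 8, rOut := (b - a) / 4, rIn_pos := by linarith, rIn_lt_rOut := by linarith }
  refine ⟨f.normed volume, ⟨f.contDiff_normed, f.hasCompactSupport_normed, ?_⟩, f.integral_normed⟩
  rw [f.tsupport_normed_eq, Real.closedBall_eq_Icc]
  intro x hx
  have h1 : (a + b) / 2 - (b - a) / 4 ≤ x := hx.1
  have h2 : x ≤ (a + b) / 2 + (b - a) / 4 := hx.2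
  constructor <;> linarith

/-- The primitive from `a` vanishes to the left of the support of `η`, and vanishing mean makes it
vanish to the right as well, so it is again a test function. -/
theorem exists_antideriv (hab : a < b) (h : IsTest a b η) (h0 : ∫ x, η x = 0) :
    ∃ φ, IsTest a b φ ∧ _root_.deriv φ = η := by
  have hc := h.smooth.continuous
  have hd : ∀ x, HasDerivAt (fun x => ∫ t in a..x, η t) (η x) x := fun x =>
    intervalIntegral.integral_hasDerivAt_right (hc.intervalIntegrable _ _)
      (hc.stronglyMeasurableAtFilter _ _) hc.continuousAt
  have hde : _root_.deriv (fun x => ∫ t in a..x, η t) = η := funext fun x => (hd x).deriv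
  obtain ⟨p, q, hap, hqb, hpq, hη⟩ : ∃ p q, a < p ∧ q < b ∧ p ≤ q ∧ ∀ x, η x ≠ 0 → x ∈ Icc p q := by
    -- The midpoint is inserted so that the compact set is nonempty even when `η = 0`.
    have hK : IsCompact (insert ((a + b) / 2) (tsupport η)) := h.compact.isCompact.insert _
    have hne : (insert ((a + b) / 2) (tsupport η)).Nonempty := insert_nonempty _ _
    have hsub : insert ((a + b) / 2) (tsupport η) ⊆ Ioo a b :=
      insert_subset ⟨by linarith, by linarith⟩ h.supp
    obtain ⟨p, hp⟩ := hK.exists_isLeast hne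
    obtain ⟨q, hq⟩ := hK.exists_isGreatest hne
    refine ⟨p, q, (hsub hp.1).1, (hsub hq.1).2, hp.2 hq.1, fun x hx => ?_⟩
    have : x ∈ insert ((a + b) / 2) (tsupport η) := mem_insert_of_mem _ (subset_tsupport _ hx)
    exact ⟨hp.2 this, hq.2 this⟩
  have hab0 : ∫ t in a..b, η t = 0 := by
    rw [intervalIntegral.integral_of_le hab.le, integral_Ioc_eq_integral_Ioo, ← h0]
    exact setIntegral_eq_integral_of_forall_compl_eq_zero fun x hx => h.eq_zero hx
  have hz : ∀ x, x ∉ Icc p q → ∫ t in a..x, η t = 0 := fun x hx => by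
    rcases lt_or_ge x p with hxp | hxp
    · refine (intervalIntegral.integral_congr fun t ht => ?_).trans intervalIntegral.integral_zero
      by_contra hne
      have h1 := (hη t hne).1
      have h2 : t ≤ max a x := ht.2
      exact absurd (h1.trans h2) (not_le.2 (max_lt hap hxp))
    · have hxq : q < x := not_le.1 fun h' => hx ⟨hxp, h'⟩
      rw [← intervalIntegral.integral_add_adjacent_intervals (hc.intervalIntegrable a x)
        (hc.intervalIntegrable x b)] at hab0
      have : ∫ t in x..b, η t = 0 := by
        refine (intervalIntegral.integral_congr fun t ht => ?_).trans intervalIntegral.integral_zero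
        by_contra hne
        have h1 := (hη t hne).2
        have h2 : min x b ≤ t := ht.1
        exact absurd (h2.trans h1) (not_le.2 (lt_min hxq hqb))
      rwa [this, add_zero] at hab0
  have hsupp : tsupport (fun x => ∫ t in a..x, η t) ⊆ Icc p q :=
    closure_minimal (fun x hx => by_contra fun h' => hx (hz x h')) isClosed_Icc
  refine ⟨fun x => ∫ t in a..x, η t, ⟨?_, ?_, ?_⟩, hde⟩
  · exact contDiff_infty_iff_deriv.2 ⟨fun x => (hd x).differentiableAt, by rw [hde]; exact h.smooth⟩
  · exact HasCompactSupport.intro isCompact_Icc hz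
  · exact hsupp.trans fun x hx => ⟨hap.trans_le hx.1, hx.2.trans_lt hqb⟩

end IsTest

theorem ae_eq_zero_of_test {w : ℝ → ℂ} (hw : LocallyIntegrableOn w (Ioo a b))
    (h : ∀ φ, IsTest a b φ → ∫ x in Ioo a b, ((φ x : ℝ) : ℂ) * w x = 0) :
    ∀ᵐ x ∂volume.restrict (Ioo a b), w x = 0 := by
  refine (ae_restrict_iff' measurableSet_Ioo).2 ?_
  refine IsOpen.ae_eq_zero_of_integral_contDiff_smul_eq_zero isOpen_Ioo hw fun φ h1 h2 h3 => ?_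
  have hφ : IsTest a b φ := ⟨h1, h2, h3⟩
  rw [← h φ hφ, ← setIntegral_eq_integral_of_forall_compl_eq_zero (s := Ioo a b)
    (fun x hx => by rw [hφ.eq_zero hx, zero_smul])]
  rfl

/-- The lemma of du Bois-Reymond. -/
theorem exists_ae_eq_const (hab : a < b) {w : ℝ → ℂ} (hw : LocallyIntegrableOn w (Ioo a b))
    (h : ∀ φ, IsTest a b φ → ∫ x in Ioo a b, ((deriv φ x : ℝ) : ℂ) * w x = 0) :
    ∃ c : ℂ, ∀ᵐ x ∂volume.restrict (Ioo a b), w x = c := by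
  obtain ⟨φ₀, hφ₀, hone⟩ := IsTest.exists_integral_eq_one hab
  refine ⟨∫ x in Ioo a b, ((φ₀ x : ℝ) : ℂ) * w x, ?_⟩
  set c : ℂ := ∫ x in Ioo a b, ((φ₀ x : ℝ) : ℂ) * w x with hc
  have hconst : LocallyIntegrableOn (fun _ : ℝ => c) (Ioo a b) :=
    (continuous_const.locallyIntegrable).locallyIntegrableOn _
  have key := ae_eq_zero_of_test (w := fun x => w x - c) (hw.sub hconst) fun η hη => ?_
  · filter_upwards [key] with x hx
    exact sub_eq_zero.1 hx
  have hint : ∀ {φ : ℝ → ℝ}, IsTest a b φ → ∫ x in Ioo a b, φ x = ∫ x, φ x := fun hφ =>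
    setIntegral_eq_integral_of_forall_compl_eq_zero fun x hx => hφ.eq_zero hx
  have hi : ∀ {φ : ℝ → ℝ}, IsTest a b φ → Integrable φ := fun hφ =>
    hφ.smooth.continuous.integrable_of_hasCompactSupport hφ.compact
  -- Subtracting a multiple of the normalised bump `φ₀` gives mean zero, hence the derivative of a
  -- test function. The subtracted part contributes the constant `∫ φ₀ w`.
  have ht := hη.sub_const_mul hφ₀ (∫ x, η x)
  obtain ⟨φ, hφ, hφd⟩ := IsTest.exists_antideriv hab ht (by
    rw [integral_sub (hi hη) ((hi hφ₀).const_mul _), integral_const_mul, hone, mul_one, sub_self])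
  have e := h φ hφ
  rw [hφd] at e
  have e1 : ∀ x, ((η x - (∫ x, η x) * φ₀ x : ℝ) : ℂ) * w x =
      (η x : ℂ) * w x - ((∫ x, η x : ℝ) : ℂ) * ((φ₀ x : ℂ) * w x) := fun x => by
    push_cast; ring
  simp_rw [e1] at e
  rw [integral_sub (hη.integrableOn_mul hw) ((hφ₀.integrableOn_mul hw).const_mul _),
    integral_const_mul, ← hc] at e
  simp_rw [mul_sub]
  rw [integral_sub (hη.integrableOn_mul hw) (hη.integrableOn_mul hconst), integral_mul_const,
    integral_complex_ofReal, hint hη]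
  exact e

theorem HasWeakDeriv.sub {k : ℕ} {u u' g g' : ℝ → ℂ} (h : HasWeakDeriv a b k u g)
    (h' : HasWeakDeriv a b k u' g') :
    HasWeakDeriv a b k (fun x => u x - u' x) (fun x => g x - g' x) := by
  refine ⟨h.1.sub h'.1, h.2.1.sub h'.2.1, fun φ h1 h2 h3 => ?_⟩
  have hφ : IsTest a b φ := ⟨h1, h2, h3⟩
  have hφk : ∀ k, IsTest a b (iteratedDeriv k φ) := fun k => by
    induction k with
    | zero => simpa using hφ
    | succ k ih => rw [iteratedDeriv_succ]; exact ih.deriv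
  simp_rw [mul_sub]
  rw [integral_sub ((hφk k).integrableOn_mul h.1) ((hφk k).integrableOn_mul h'.1),
    integral_sub (hφ.integrableOn_mul h.2.1) (hφ.integrableOn_mul h'.2.1), h.2.2 φ h1 h2 h3,
    h'.2.2 φ h1 h2 h3, mul_sub]

theorem HasWeakDeriv.ae_unique {k : ℕ} {u g g' : ℝ → ℂ} (h : HasWeakDeriv a b k u g)
    (h' : HasWeakDeriv a b k u g') : g =ᵐ[volume.restrict (Ioo a b)] g' := by
  have hs := h.sub h'
  have := ae_eq_zero_of_test hs.2.1 fun φ hφ => by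
    have := hs.2.2 φ hφ.smooth hφ.compact hφ.supp
    simp only [sub_self, mul_zero, integral_zero] at this
    exact (mul_eq_zero.1 this.symm).resolve_left (pow_ne_zero _ (neg_ne_zero.2 one_ne_zero))
  filter_upwards [this] with x hx
  exact sub_eq_zero.1 hx

/-- The order `k` identity tested with `φ'` and the order `k + 1` identity tested with `φ` share
their left sides. Hence weak derivatives of consecutive orders are linked by one integration by
parts. -/
theorem HasWeakDeriv.integral_deriv_mul {k : ℕ} {u g g' : ℝ → ℂ} (h : HasWeakDeriv a b k u g)
    (h' : HasWeakDeriv a b (k + 1) u g') {φ : ℝ → ℝ} (hφ : IsTest a b φ) :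
    ∫ x in Ioo a b, ((deriv φ x : ℝ) : ℂ) * g x = -∫ x in Ioo a b, ((φ x : ℝ) : ℂ) * g' x := by
  have e1 := h.2.2 _ hφ.deriv.smooth hφ.deriv.compact hφ.deriv.supp
  rw [← iteratedDeriv_succ', h'.2.2 φ hφ.smooth hφ.compact hφ.supp, pow_succ, mul_assoc] at e1
  have := mul_left_cancel₀ (pow_ne_zero _ (neg_ne_zero.2 one_ne_zero)) e1
  rw [← this, neg_one_mul]

theorem IsTest.integral_deriv_mul_primitive (hab : a < b) {φ : ℝ → ℝ} (hφ : IsTest a b φ)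
    {U g : ℝ → ℂ} (hg : IntervalIntegrable g volume a b)
    (hU : ∀ x ∈ Icc a b, U x = U a + ∫ t in a..x, g t) :
    ∫ x in Ioo a b, ((_root_.deriv φ x : ℝ) : ℂ) * U x = -∫ x in Ioo a b, ((φ x : ℝ) : ℂ) * g x := by
  have h1 := _root_.integral_deriv_mul_primitive hab.le (φ := fun x => (φ x : ℂ))
    (φ' := fun x => ((_root_.deriv φ x : ℝ) : ℂ))
    (fun x => ((hφ.smooth.differentiable (by simp) x).hasDerivAt).ofReal_comp)
    (Complex.continuous_ofReal.comp hφ.deriv.smooth.continuous) hg hU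
  rw [hφ.eq_zero (x := a) (by simp), hφ.eq_zero (x := b) (by simp)] at h1
  simpa [intervalIntegral.integral_of_le hab.le, integral_Ioc_eq_integral_Ioo] using h1

/-- A function and its weak derivative are related by the fundamental theorem of calculus. -/
theorem exists_ae_eq_primitive (hab : a < b) {g g' : ℝ → ℂ}
    (hg : LocallyIntegrableOn g (Ioo a b)) (hg' : IntervalIntegrable g' volume a b)
    (h : ∀ φ, IsTest a b φ → ∫ x in Ioo a b, ((deriv φ x : ℝ) : ℂ) * g x =
      -∫ x in Ioo a b, ((φ x : ℝ) : ℂ) * g' x) :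
    ∃ c : ℂ, ∀ᵐ x ∂volume.restrict (Ioo a b), g x = c + ∫ t in a..x, g' t := by
  have hG : ContinuousOn (fun x => ∫ t in a..x, g' t) (Icc a b) := by
    rw [← uIcc_of_le hab.le]
    exact intervalIntegral.continuousOn_primitive_interval' hg' left_mem_uIcc
  have hGl : LocallyIntegrableOn (fun x => ∫ t in a..x, g' t) (Ioo a b) :=
    (hG.mono Ioo_subset_Icc_self).locallyIntegrableOn measurableSet_Ioo
  obtain ⟨c, hc⟩ := exists_ae_eq_const hab (hg.sub hGl) fun φ hφ => by
    have e := hφ.integral_deriv_mul_primitive hab (U := fun x => ∫ t in a..x, g' t) hg'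
      (fun x _ => by simp)
    simp_rw [Pi.sub_apply, mul_sub]
    rw [integral_sub (hφ.deriv.integrableOn_mul hg) (hφ.deriv.integrableOn_mul hGl), h φ hφ, e,
      sub_self]
  refine ⟨c, ?_⟩
  filter_upwards [hc] with x hx
  rw [← hx, Pi.sub_apply, sub_add_cancel]

end weak

/-! ### Continuous representatives of Sobolev functions -/

section rep

variable {a b : ℝ}

/-- The `L²` norm on `(a, b)` as a real number. -/
noncomputable def l2 (a b : ℝ) (u : ℝ → ℂ) : ℝ := (normL2 a b u).toReal

theorem l2_nonneg (u : ℝ → ℂ) : 0 ≤ l2 a b u := ENNReal.toReal_nonneg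

theorem l2_le_add {u v : ℝ → ℂ} (hu : MemLp u 2 (volume.restrict (Ioo a b)))
    (hv : MemLp v 2 (volume.restrict (Ioo a b))) :
    l2 a b u ≤ l2 a b (fun x => u x - v x) + l2 a b v := by
  have h := eLpNorm_add_le (hu.sub hv).1 hv.1 (p := 2) (by norm_num)
  rw [sub_add_cancel] at h
  have := ENNReal.toReal_mono (ENNReal.add_ne_top.2 ⟨(hu.sub hv).2.ne, hv.2.ne⟩) h
  rwa [ENNReal.toReal_add (hu.sub hv).2.ne hv.2.ne] at this

theorem abs_l2_sub_le {u v : ℝ → ℂ} (hu : MemLp u 2 (volume.restrict (Ioo a b)))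
    (hv : MemLp v 2 (volume.restrict (Ioo a b))) :
    |l2 a b u - l2 a b v| ≤ l2 a b (fun x => u x - v x) := by
  have h1 := l2_le_add hu hv
  have h2 := l2_le_add hv hu
  have h3 : l2 a b (fun x => v x - u x) = l2 a b (fun x => u x - v x) := by
    unfold l2 normL2
    rw [← eLpNorm_neg]
    congr 2; funext x; simp
  rw [abs_le]; constructor <;> linarith

theorem MemLp.integrableOn_two {u : ℝ → ℂ} (hu : MemLp u 2 (volume.restrict (Ioo a b))) :
    IntegrableOn u (Ioo a b) := hu.integrable (by norm_num)

theorem MemLp.intervalIntegrable_two (hab : a ≤ b) {u : ℝ → ℂ}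
    (hu : MemLp u 2 (volume.restrict (Ioo a b))) : IntervalIntegrable u volume a b := by
  rw [intervalIntegrable_iff_integrableOn_Ioc_of_le hab, integrableOn_Ioc_iff_integrableOn_Ioo]
  exact MemLp.integrableOn_two hu

theorem integral_norm_le_l2 (hab : a ≤ b) {u : ℝ → ℂ} (hu : MemLp u 2 (volume.restrict (Ioo a b))) :
    ∫ x in Ioo a b, ‖u x‖ ≤ √(b - a) * l2 a b u := by
  have h := eLpNorm_le_eLpNorm_mul_rpow_measure_univ (p := 1) (q := 2) (by norm_num) hu.1
  rw [Measure.restrict_apply_univ, Real.volume_Ioo] at h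
  have h1 : ∫ x in Ioo a b, ‖u x‖ = (eLpNorm u 1 (volume.restrict (Ioo a b))).toReal := by
    rw [eLpNorm_one_eq_lintegral_enorm, integral_norm_eq_lintegral_enorm hu.1]
  rw [h1]
  refine (ENNReal.toReal_mono (ENNReal.mul_ne_top hu.2.ne (by simp; norm_num)) h).trans (le_of_eq ?_)
  rw [ENNReal.toReal_mul, ← ENNReal.toReal_rpow, ENNReal.toReal_ofReal (by linarith), mul_comm,
    Real.sqrt_eq_rpow]
  norm_num [l2, normL2]

theorem ContinuousOn.memLp_two {u : ℝ → ℂ} (hu : ContinuousOn u (Icc a b)) :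
    MemLp u 2 (volume.restrict (Ioo a b)) := by
  obtain ⟨C, hC⟩ := isCompact_Icc.exists_bound_of_continuousOn hu
  refine MemLp.of_bound ((hu.mono Ioo_subset_Icc_self).aestronglyMeasurable measurableSet_Ioo) C ?_
  exact (ae_restrict_iff' measurableSet_Ioo).2 (Eventually.of_forall fun x hx =>
    hC x (Ioo_subset_Icc_self hx))

theorem eqOn_Icc_of_ae_eq_Ioo (hab : a < b) {u v : ℝ → ℂ} (hu : ContinuousOn u (Icc a b))
    (hv : ContinuousOn v (Icc a b)) (h : u =ᵐ[volume.restrict (Ioo a b)] v) :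
    EqOn u v (Icc a b) := by
  rw [Measure.restrict_congr_set Ioo_ae_eq_Icc] at h
  exact Measure.eqOn_Icc_of_ae_eq volume hab.ne h hu hv

/-- The one-dimensional Sobolev embedding: `‖U x‖ ≤ ‖U y‖ + ∫ ‖g‖` is averaged over `y`, and both
`L¹` norms are bounded by Cauchy–Schwarz. -/
theorem norm_le_of_primitive (hab : a < b) {U g : ℝ → ℂ} (hUL : MemLp U 2 (volume.restrict (Ioo a b)))
    (hg : MemLp g 2 (volume.restrict (Ioo a b)))
    (hU : ∀ x ∈ Icc a b, U x = U a + ∫ t in a..x, g t) {x : ℝ} (hx : x ∈ Icc a b) :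
    ‖U x‖ ≤ (√(b - a) / (b - a) + √(b - a)) * (l2 a b U + l2 a b g) := by
  have hba : 0 < b - a := sub_pos.2 hab
  have hgi := MemLp.intervalIntegrable_two hab.le hg
  have hsub : ∀ z ∈ Icc a b, IntervalIntegrable g volume a z := fun z hz =>
    hgi.mono_set (by rw [uIcc_of_le hz.1, uIcc_of_le hab.le]; exact Icc_subset_Icc_right hz.2)
  have h1 : ∀ y ∈ Ioo a b, ‖U x‖ ≤ ‖U y‖ + ∫ t in Ioo a b, ‖g t‖ := fun y hy => by
    have hy' := Ioo_subset_Icc_self hy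
    have e : U x = U y + ∫ t in y..x, g t := by
      rw [hU x hx, hU y hy', add_assoc, intervalIntegral.integral_add_adjacent_intervals (hsub y hy')
        ((hsub y hy').symm.trans (hsub x hx))]
    rw [e]
    refine (norm_add_le _ _).trans (add_le_add le_rfl ?_)
    refine (intervalIntegral.norm_integral_le_integral_norm_uIoc).trans ?_
    rw [← integral_Ioc_eq_integral_Ioo]
    refine setIntegral_mono_set ?_ (Eventually.of_forall fun _ => norm_nonneg _) ?_
    · exact ((intervalIntegrable_iff_integrableOn_Ioc_of_le hab.le).1 hgi).norm
    · refine LE.le.eventuallyLE fun t ht => ?_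
      exact ⟨(le_min hy.1.le hx.1).trans_lt ht.1, ht.2.trans (max_le hy.2.le hx.2)⟩
  have hUi := (MemLp.integrableOn_two hUL).norm
  have h2 : ∫ _ in Ioo a b, ‖U x‖ ≤ ∫ y in Ioo a b, (‖U y‖ + ∫ t in Ioo a b, ‖g t‖) := by
    refine setIntegral_mono_on (integrable_const _) (hUi.add (integrable_const _)) measurableSet_Ioo h1
  rw [integral_add hUi (integrable_const _)] at h2
  simp only [integral_const, MeasurableSet.univ, measureReal_restrict_apply, univ_inter,
    Real.volume_real_Ioo_of_le hab.le, smul_eq_mul] at h2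
  have h3 := integral_norm_le_l2 hab.le hUL
  have h4 := integral_norm_le_l2 hab.le hg
  have h5 : (b - a) * ‖U x‖ ≤ √(b - a) * l2 a b U + (b - a) * (√(b - a) * l2 a b g) :=
    h2.trans (add_le_add h3 (mul_le_mul_of_nonneg_left h4 hba.le))
  have h6 : ‖U x‖ ≤ √(b - a) / (b - a) * l2 a b U + √(b - a) * l2 a b g := by
    rw [← mul_le_mul_iff_right₀ hba]
    refine h5.trans (le_of_eq ?_)
    field_simp
  refine h6.trans ?_
  rw [add_mul, mul_add, mul_add]
  have h7 : 0 ≤ √(b - a) / (b - a) * l2 a b g := by have := l2_nonneg (a := a) (b := b) g; positivity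
  have h8 : 0 ≤ √(b - a) * l2 a b U := by have := l2_nonneg (a := a) (b := b) U; positivity
  linarith

/-- `D k` is the `k`-th derivative of `u` for `k ≤ m`, continuous on `[a, b]` for `k < m`. -/
structure SobRep (a b : ℝ) (m : ℕ) (u : ℝ → ℂ) (D : ℕ → ℝ → ℂ) : Prop where
  zero : ∀ x ∈ Icc a b, D 0 x = u x
  cont : ∀ k < m, ContinuousOn (D k) (Icc a b)
  ftc : ∀ k < m, ∀ x ∈ Icc a b, D k x = D k a + ∫ t in a..x, D (k + 1) t
  memLp : ∀ k ≤ m, MemLp (D k) 2 (volume.restrict (Ioo a b))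
  weak : ∀ k ≤ m, HasWeakDeriv a b k u (D k)

theorem HasWeakDeriv.congr_right {k : ℕ} {u g g' : ℝ → ℂ} (h : HasWeakDeriv a b k u g)
    (hg' : LocallyIntegrableOn g' (Ioo a b)) (hgg' : g =ᵐ[volume.restrict (Ioo a b)] g') :
    HasWeakDeriv a b k u g' := by
  refine ⟨h.1, hg', fun φ h1 h2 h3 => ?_⟩
  rw [h.2.2 φ h1 h2 h3]
  congr 1
  exact integral_congr_ae (by filter_upwards [hgg'] with x hx using by rw [hx])

theorem hasWeakDeriv_zero {u : ℝ → ℂ} (hu : LocallyIntegrableOn u (Ioo a b)) :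
    HasWeakDeriv a b 0 u u := ⟨hu, hu, fun φ _ _ _ => by simp⟩

/-- Each weak derivative of order below `m` agrees almost everywhere with a primitive of the next
one, which is taken as its representative. The top derivative remains just an `L²` function. -/
theorem MemH.exists_sobRep (hab : a < b) {m : ℕ} (hm : 1 ≤ m) {u : ℝ → ℂ} (hu : MemH a b m u)
    (hc : ContinuousOn u (Icc a b)) : ∃ D, SobRep a b m u D := by
  choose! g hg hL using hu
  have hex : ∀ k < m, ∃ c : ℂ, ∀ᵐ x ∂volume.restrict (Ioo a b), g k x = c + ∫ t in a..x, g (k + 1) t :=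
    fun k hk => exists_ae_eq_primitive hab (hg k hk.le).2.1
      (MemLp.intervalIntegrable_two hab.le (hL (k + 1) hk))
      fun φ hφ => (hg k hk.le).integral_deriv_mul (hg (k + 1) hk) hφ
  choose! c hcg using hex
  let D : ℕ → ℝ → ℂ := fun k x => if k < m then c k + ∫ t in a..x, g (k + 1) t else g k x
  have hDlt : ∀ k < m, ∀ x, D k x = c k + ∫ t in a..x, g (k + 1) t := fun k hk x => if_pos hk
  have hDae : ∀ k ≤ m, g k =ᵐ[volume.restrict (Ioo a b)] D k := fun k hk => by
    rcases hk.lt_or_eq with h | h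
    · filter_upwards [hcg k h] with x hx
      rw [hx, hDlt k h]
    · refine Eventually.of_forall fun x => ?_
      exact (if_neg (by omega)).symm
  have hLD : ∀ k ≤ m, MemLp (D k) 2 (volume.restrict (Ioo a b)) := fun k hk =>
    (memLp_congr_ae (hDae k hk)).1 (hL k hk)
  have hw : ∀ k ≤ m, HasWeakDeriv a b k u (D k) := fun k hk =>
    (hg k hk).congr_right (MemLp.integrableOn_two (hLD k hk)).locallyIntegrableOn (hDae k hk)
  have hcont : ∀ k < m, ContinuousOn (D k) (Icc a b) := fun k hk => by
    have : ContinuousOn (fun x => ∫ t in a..x, g (k + 1) t) (Icc a b) := by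
      rw [← uIcc_of_le hab.le]
      exact intervalIntegral.continuousOn_primitive_interval'
        (MemLp.intervalIntegrable_two hab.le (hL (k + 1) hk)) left_mem_uIcc
    exact (continuousOn_const.add this).congr fun x _ => hDlt k hk x
  refine ⟨D, ?_, hcont, fun k hk x hx => ?_, hLD, hw⟩
  · refine eqOn_Icc_of_ae_eq_Ioo hab (hcont 0 (by omega)) hc ?_
    exact (hw 0 (Nat.zero_le _)).ae_unique (hasWeakDeriv_zero (hw 0 (Nat.zero_le _)).1)
  · rw [hDlt k hk, hDlt k hk, intervalIntegral.integral_same, add_zero]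
    congr 1
    refine intervalIntegral.integral_congr_ae ?_
    have h1 := hDae (k + 1) hk
    rw [Measure.restrict_congr_set Ioo_ae_eq_Ioc] at h1
    filter_upwards [(ae_restrict_iff' measurableSet_Ioc).1 h1] with t ht htx
    rw [uIoc_of_le hx.1] at htx
    exact ht ⟨htx.1, htx.2.trans hx.2⟩

namespace SobRep

variable {m : ℕ} {u v : ℝ → ℂ} {D E : ℕ → ℝ → ℂ}

theorem intervalIntegrable (hab : a ≤ b) (h : SobRep a b m u D) {k : ℕ} (hk : k ≤ m) :
    IntervalIntegrable (D k) volume a b := MemLp.intervalIntegrable_two hab (h.memLp k hk)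

theorem sub (hab : a ≤ b) (h : SobRep a b m u D) (h' : SobRep a b m v E) :
    SobRep a b m (fun x => u x - v x) (fun k x => D k x - E k x) where
  zero x hx := by rw [h.zero x hx, h'.zero x hx]
  cont k hk := (h.cont k hk).sub (h'.cont k hk)
  ftc k hk x hx := by
    have hs : uIcc a x ⊆ uIcc a b := by
      rw [uIcc_of_le hx.1, uIcc_of_le hab]; exact Icc_subset_Icc_right hx.2
    rw [h.ftc k hk x hx, h'.ftc k hk x hx, intervalIntegral.integral_sub
      ((h.intervalIntegrable hab hk).mono_set hs) ((h'.intervalIntegrable hab hk).mono_set hs)]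
    ring
  memLp k hk := (h.memLp k hk).sub (h'.memLp k hk)
  weak k hk := (h.weak k hk).sub (h'.weak k hk)

theorem semiH_eq (h : SobRep a b m u D) {k : ℕ} (hk : k ≤ m) : semiH a b k u = normL2 a b (D k) := by
  refine le_antisymm (iInf₂_le _ (h.weak k hk)) (le_iInf₂ fun g hg => ?_)
  exact (eLpNorm_congr_ae ((h.weak k hk).ae_unique hg)).le

theorem normH_ne_top (h : SobRep a b m u D) : normH a b m u ≠ ⊤ := by
  refine ENNReal.rpow_ne_top_of_nonneg (by norm_num) (ENNReal.sum_ne_top.2 fun k hk => ?_)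
  rw [h.semiH_eq (Nat.lt_succ_iff.1 (Finset.mem_range.1 hk))]
  exact ENNReal.pow_ne_top (h.memLp k (Nat.lt_succ_iff.1 (Finset.mem_range.1 hk))).2.ne

theorem l2_le (h : SobRep a b m u D) {k : ℕ} (hk : k ≤ m) : l2 a b (D k) ≤ (normH a b m u).toReal := by
  refine ENNReal.toReal_mono h.normH_ne_top ?_
  rw [← h.semiH_eq hk]
  unfold normH
  refine le_trans (le_of_eq ?_) (ENNReal.rpow_le_rpow (Finset.single_le_sum
    (f := fun k => semiH a b k u ^ 2) (fun _ _ => zero_le) (Finset.mem_range.2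
      (Nat.lt_succ_iff.2 hk))) (by norm_num))
  rw [← ENNReal.rpow_natCast, ← ENNReal.rpow_mul]
  norm_num

theorem norm_le (hab : a < b) (h : SobRep a b m u D) {k : ℕ} (hk : k < m) {x : ℝ} (hx : x ∈ Icc a b) :
    ‖D k x‖ ≤ (√(b - a) / (b - a) + √(b - a)) * (2 * (normH a b m u).toReal) := by
  refine (norm_le_of_primitive hab (h.memLp k hk.le) (h.memLp (k + 1) hk) (h.ftc k hk) hx).trans ?_
  have h1 := h.l2_le hk.le
  have h2 := h.l2_le (k := k + 1) hk
  have : 0 < b - a := sub_pos.2 hab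
  gcongr
  linarith

theorem hasDerivAt (hab : a < b) (h : SobRep a b m u D) {k : ℕ} (hk : k + 1 < m) {x : ℝ}
    (hx : x ∈ Ioo a b) : HasDerivAt (D k) (D (k + 1) x) x := by
  have hmem : Icc a b ∈ 𝓝 x := Icc_mem_nhds hx.1 hx.2
  have hc := h.cont (k + 1) hk
  have hs : uIcc a x ⊆ uIcc a b := by
    rw [uIcc_of_le hx.1.le, uIcc_of_le hab.le]; exact Icc_subset_Icc_right hx.2.le
  have h1 := intervalIntegral.integral_hasDerivAt_right
    ((h.intervalIntegrable hab.le (k := k + 1) hk.le).mono_set hs)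
    ((hc.mono Ioo_subset_Icc_self).stronglyMeasurableAtFilter isOpen_Ioo x hx) (hc.continuousAt hmem)
  refine (h1.const_add (D k a)).congr_of_eventuallyEq ?_
  filter_upwards [hmem] with y hy
  exact h.ftc k (by omega) y hy

theorem iteratedDeriv_two (hab : a < b) (h : SobRep a b m u D) (hm : 3 ≤ m) {x : ℝ}
    (hx : x ∈ Ioo a b) : iteratedDeriv 2 u x = D 2 x := by
  have h0 : ∀ y ∈ Ioo a b, HasDerivAt u (D 1 y) y := fun y hy => by
    refine (h.hasDerivAt hab (k := 0) (by omega) hy).congr_of_eventuallyEq ?_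
    filter_upwards [Icc_mem_nhds hy.1 hy.2] with z hz
    exact (h.zero z hz).symm
  have h1 : deriv u =ᶠ[𝓝 x] D 1 := by
    filter_upwards [Ioo_mem_nhds hx.1 hx.2] with y hy
    exact (h0 y hy).deriv
  rw [iteratedDeriv_succ, iteratedDeriv_one, h1.deriv_eq]
  exact (h.hasDerivAt hab (k := 1) (by omega) hx).deriv

end SobRep

/-- A continuously differentiable function has its classical derivative as weak derivative. -/
theorem hasWeakDeriv_one_of_hasDerivAt (hab : a < b) {u g : ℝ → ℂ} (hu : ContinuousOn u (Icc a b))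
    (hg : ContinuousOn g (Icc a b)) (h : ∀ x ∈ Icc a b, u x = u a + ∫ t in a..x, g t) :
    HasWeakDeriv a b 1 u g := by
  refine ⟨(MemLp.integrableOn_two (ContinuousOn.memLp_two hu)).locallyIntegrableOn,
    (MemLp.integrableOn_two (ContinuousOn.memLp_two hg)).locallyIntegrableOn, fun φ h1 h2 h3 => ?_⟩
  have hφ : IsTest a b φ := ⟨h1, h2, h3⟩
  rw [iteratedDeriv_one, hφ.integral_deriv_mul_primitive hab
    (MemLp.intervalIntegrable_two hab.le (ContinuousOn.memLp_two hg)) h, pow_one, neg_one_mul]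

/-! ### Continuous curves in `H^m` -/

variable {T : ℝ} {m : ℕ} {ψ : ℝ → ℝ → ℂ} {D : ℝ → ℕ → ℝ → ℂ}

theorem ContTimeH.continuousOn_of_le (hψ : ContTimeH a b T m ψ) {E : Type*} [NormedAddCommGroup E]
    {f : ℝ → E} {K : ℝ} (h : ∀ s ∈ Icc 0 T, ∀ t ∈ Icc 0 T,
      ‖f t - f s‖ ≤ K * (normH a b m (fun x => ψ t x - ψ s x)).toReal) :
    ContinuousOn f (Icc 0 T) := fun s hs => by
  have h1 := (ENNReal.tendsto_toReal ENNReal.zero_ne_top).comp (hψ.2 s hs)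
  have h2 := h1.const_mul K
  rw [ENNReal.toReal_zero, mul_zero] at h2
  refine tendsto_iff_norm_sub_tendsto_zero.2 (squeeze_zero' (Eventually.of_forall fun _ =>
    norm_nonneg _) ?_ h2)
  filter_upwards [self_mem_nhdsWithin] with t ht
  exact h s hs t ht

theorem ContTimeH.exists_l2_le (hab : a < b) (hψ : ContTimeH a b T m ψ)
    (hD : ∀ t ∈ Icc 0 T, SobRep a b m (ψ t) (D t)) :
    ∃ B, 0 ≤ B ∧ ∀ t ∈ Icc 0 T, ∀ k ≤ m, l2 a b (D t k) ≤ B := by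
  have hc : ∀ k ≤ m, ContinuousOn (fun t => l2 a b (D t k)) (Icc 0 T) := fun k hk => by
    refine hψ.continuousOn_of_le (K := 1) fun s hs t ht => ?_
    rw [one_mul]
    exact (abs_l2_sub_le ((hD t ht).memLp k hk) ((hD s hs).memLp k hk)).trans
      (((hD t ht).sub hab.le (hD s hs)).l2_le hk)
  have hsum : ContinuousOn (fun t => ∑ k ∈ Finset.range (m + 1), l2 a b (D t k)) (Icc 0 T) :=
    continuousOn_finsetSum _ fun k hk => hc k (Nat.lt_succ_iff.1 (Finset.mem_range.1 hk))
  obtain ⟨B, hB⟩ := isCompact_Icc.exists_bound_of_continuousOn hsum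
  refine ⟨max B 0, le_max_right _ _, fun t ht k hk => ?_⟩
  refine le_trans ?_ ((le_abs_self _).trans ((hB t ht).trans (le_max_left _ _)))
  exact Finset.single_le_sum (f := fun k => l2 a b (D t k)) (fun _ _ => l2_nonneg _)
    (Finset.mem_range.2 (Nat.lt_succ_iff.2 hk))

theorem ContTimeH.continuousOn_deriv (hab : a < b) (hψ : ContTimeH a b T m ψ)
    (hD : ∀ t ∈ Icc 0 T, SobRep a b m (ψ t) (D t)) {k : ℕ} (hk : k < m) {x : ℝ} (hx : x ∈ Icc a b) :
    ContinuousOn (fun t => D t k x) (Icc 0 T) := by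
  refine hψ.continuousOn_of_le (K := (√(b - a) / (b - a) + √(b - a)) * 2) fun s hs t ht => ?_
  exact (((hD t ht).sub hab.le (hD s hs)).norm_le hab hk hx).trans (by rw [mul_assoc])

/-- The continuous functions `max ‖u‖ ‖u‖_∞` and `‖u‖_∞` agree almost everywhere, hence everywhere
on the closed interval, end points included. -/
theorem norm_le_normLinf (hab : a < b) {u : ℝ → ℂ} (hu : ContinuousOn u (Icc a b)) {x : ℝ}
    (hx : x ∈ Icc a b) : ‖u x‖ₑ ≤ normLinf a b u := by
  have hae : (fun y => max ‖u y‖ₑ (normLinf a b u)) =ᵐ[volume.restrict (Icc a b)]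
      fun _ => normLinf a b u := by
    rw [← Measure.restrict_congr_set Ioo_ae_eq_Icc]
    have h := ae_le_eLpNormEssSup (f := u) (μ := volume.restrict (Ioo a b))
    filter_upwards [h] with y hy
    refine max_eq_right ?_
    unfold normLinf
    rwa [eLpNorm_exponent_top]
  have hc : ContinuousOn (fun y => max ‖u y‖ₑ (normLinf a b u)) (Icc a b) :=
    (continuous_enorm.comp_continuousOn hu).sup continuousOn_const
  have := Measure.eqOn_Icc_of_ae_eq volume hab.ne hae hc continuousOn_const hx
  exact max_eq_right_iff.1 this

/-- By the Sobolev embedding the sup norm is Lipschitz with respect to the `H^m` norm, so it is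
continuous in time and attains its maximum on the compact time interval. -/
theorem ContTimeH.exists_isGreatest_normLinf (hab : a < b) (hT : 0 ≤ T) (hm : 1 ≤ m)
    (hψ : ContTimeH a b T m ψ) (hc : ∀ t ∈ Icc 0 T, ContinuousOn (ψ t) (Icc a b)) :
    ∃ M₁ : ℝ, 0 ≤ M₁ ∧ IsGreatest ((fun t => normLinf a b (ψ t)) '' Icc 0 T) (ENNReal.ofReal M₁) ∧
      ∀ t ∈ Icc 0 T, ∀ x ∈ Icc a b, ‖ψ t x‖ ≤ M₁ := by
  choose! D hD using fun t (ht : t ∈ Icc 0 T) => MemH.exists_sobRep hab hm (hψ.1 t ht).1 (hc t ht)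
  have hmeas : ∀ t ∈ Icc 0 T, AEStronglyMeasurable (ψ t) (volume.restrict (Ioo a b)) := fun t ht =>
    (ContinuousOn.memLp_two (hc t ht)).1
  have hbd : ∀ {u : ℝ → ℂ} {C : ℝ}, (∀ x ∈ Icc a b, ‖u x‖ ≤ C) → normLinf a b u ≤ ENNReal.ofReal C :=
    fun {u C} h => by
      unfold normLinf
      rw [eLpNorm_exponent_top]
      exact eLpNormEssSup_le_of_ae_bound ((ae_restrict_iff' measurableSet_Ioo).2
        (Eventually.of_forall fun x hx => h x (Ioo_subset_Icc_self hx)))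
  have hfin : ∀ t ∈ Icc 0 T, normLinf a b (ψ t) ≠ ⊤ := fun t ht => by
    obtain ⟨C, hC⟩ := isCompact_Icc.exists_bound_of_continuousOn (hc t ht)
    exact ((hbd hC).trans_lt ENNReal.ofReal_lt_top).ne
  have hcont : ContinuousOn (fun t => (normLinf a b (ψ t)).toReal) (Icc 0 T) := by
    refine hψ.continuousOn_of_le (K := (√(b - a) / (b - a) + √(b - a)) * 2) fun s hs t ht => ?_
    set δ := (√(b - a) / (b - a) + √(b - a)) * 2 * (normH a b m fun x => ψ t x - ψ s x).toReal with hδ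
    have hδ0 : 0 ≤ δ := by
      have : 0 < b - a := sub_pos.2 hab
      positivity
    have hle : ∀ p ∈ Icc 0 T, ∀ q ∈ Icc 0 T, (∀ x ∈ Icc a b, ‖ψ p x - ψ q x‖ ≤ δ) →
        (normLinf a b (ψ p)).toReal ≤ δ + (normLinf a b (ψ q)).toReal := fun p hp q hq h => by
      have h1 := eLpNorm_add_le (p := ⊤) ((hmeas p hp).sub (hmeas q hq)) (hmeas q hq) (by simp)
      rw [sub_add_cancel] at h1
      have h2 : normLinf a b (ψ p) ≤ ENNReal.ofReal δ + normLinf a b (ψ q) :=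
        h1.trans (add_le_add (hbd h) le_rfl)
      have h3 := ENNReal.toReal_mono (ENNReal.add_ne_top.2 ⟨ENNReal.ofReal_ne_top, hfin q hq⟩) h2
      rwa [ENNReal.toReal_add ENNReal.ofReal_ne_top (hfin q hq), ENNReal.toReal_ofReal hδ0] at h3
    have hd : ∀ x ∈ Icc a b, ‖ψ t x - ψ s x‖ ≤ δ := fun x hx => by
      have := ((hD t ht).sub hab.le (hD s hs)).norm_le hab (k := 0) (by omega) hx
      rw [(hD t ht).zero x hx, (hD s hs).zero x hx] at this
      exact this.trans (by rw [hδ, mul_assoc])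
    have h1 := hle t ht s hs hd
    have h2 := hle s hs t ht fun x hx => by rw [norm_sub_rev]; exact hd x hx
    rw [Real.norm_eq_abs, abs_le]
    constructor <;> linarith
  obtain ⟨t₀, ht₀, hmax⟩ := isCompact_Icc.exists_isMaxOn (nonempty_Icc.2 hT) hcont
  have hle : ∀ t ∈ Icc 0 T, normLinf a b (ψ t) ≤ normLinf a b (ψ t₀) := fun t ht =>
    (ENNReal.toReal_le_toReal (hfin t ht) (hfin t₀ ht₀)).1 (hmax ht)
  have he : ENNReal.ofReal (normLinf a b (ψ t₀)).toReal = normLinf a b (ψ t₀) :=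
    ENNReal.ofReal_toReal (hfin t₀ ht₀)
  refine ⟨(normLinf a b (ψ t₀)).toReal, ENNReal.toReal_nonneg, ⟨?_, ?_⟩, fun t ht x hx => ?_⟩
  · rw [he]; exact ⟨t₀, ht₀, rfl⟩
  · rw [he]
    rintro _ ⟨t, ht, rfl⟩
    exact hle t ht
  · have h1 := (norm_le_normLinf hab (hc t ht) hx).trans (hle t ht)
    have h2 := ENNReal.toReal_mono (hfin t₀ ht₀) h1
    rwa [toReal_enorm] at h2

end rep

/-! ### Sine series on an interval -/

section sine

variable {a b : ℝ}

/-- The fundamental frequency `π / (b - a)`. -/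
noncomputable def freqUnit (a b : ℝ) : ℝ := π / (b - a)

theorem freqUnit_pos (hab : a < b) : 0 < freqUnit a b := div_pos pi_pos (sub_pos.2 hab)

theorem freqUnit_mul (hab : a < b) : freqUnit a b * (b - a) = π :=
  div_mul_cancel₀ _ (sub_pos.2 hab).ne'

/-- The integral of `u` against `e^{ikπ(x-a)/(b-a)}`. -/
noncomputable def expInt (a b : ℝ) (u : ℝ → ℂ) (k : ℤ) : ℂ :=
  ∫ x in a..b, osc k (freqUnit a b * (x - a)) * u x

/-- The coefficients of the odd `2(b-a)`-periodic extension of `u`. -/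
noncomputable def oddCoeff (a b : ℝ) (u : ℝ → ℂ) (k : ℤ) : ℂ :=
  -(expInt a b u k - expInt a b u (-k)) / (2 * ((b : ℂ) - a))

theorem oddCoeff_neg (u : ℝ → ℂ) (k : ℤ) : oddCoeff a b u (-k) = -oddCoeff a b u k := by
  unfold oddCoeff; rw [neg_neg]; ring

theorem oddCoeff_zero (u : ℝ → ℂ) : oddCoeff a b u 0 = 0 := by simp [oddCoeff]

theorem continuous_osc_freq (k : ℤ) : Continuous fun x => osc k (freqUnit a b * (x - a)) :=
  (continuous_osc k).comp (by fun_prop)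

theorem intervalIntegrable_osc_mul {u : ℝ → ℂ} (hu : IntervalIntegrable u volume a b) (k : ℤ) :
    IntervalIntegrable (fun x => osc k (freqUnit a b * (x - a)) * u x) volume a b :=
  hu.continuousOn_mul (continuous_osc_freq k).continuousOn

theorem expInt_sub {u v : ℝ → ℂ} (hu : IntervalIntegrable u volume a b)
    (hv : IntervalIntegrable v volume a b) (k : ℤ) :
    expInt a b (fun x => u x - v x) k = expInt a b u k - expInt a b v k := by
  unfold expInt
  rw [← intervalIntegral.integral_sub (intervalIntegrable_osc_mul hu k)
    (intervalIntegrable_osc_mul hv k)]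
  simp_rw [mul_sub]

theorem oddCoeff_sub {u v : ℝ → ℂ} (hu : IntervalIntegrable u volume a b)
    (hv : IntervalIntegrable v volume a b) (k : ℤ) :
    oddCoeff a b (fun x => u x - v x) k = oddCoeff a b u k - oddCoeff a b v k := by
  unfold oddCoeff
  rw [expInt_sub hu hv, expInt_sub hu hv]; ring

theorem expInt_congr (hab : a ≤ b) {u v : ℝ → ℂ} (h : ∀ x ∈ Icc a b, u x = v x) (k : ℤ) :
    expInt a b u k = expInt a b v k :=
  intervalIntegral.integral_congr fun x hx => by
    rw [uIcc_of_le hab] at hx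
    simp only [h x hx]

theorem oddCoeff_congr (hab : a ≤ b) {u v : ℝ → ℂ} (h : ∀ x ∈ Icc a b, u x = v x) (k : ℤ) :
    oddCoeff a b u k = oddCoeff a b v k := by
  unfold oddCoeff
  rw [expInt_congr hab h, expInt_congr hab h]

theorem norm_expInt_le (hab : a ≤ b) {u : ℝ → ℂ} (hu : MemLp u 2 (volume.restrict (Ioo a b)))
    (k : ℤ) : ‖expInt a b u k‖ ≤ √(b - a) * l2 a b u := by
  refine le_trans ?_ (integral_norm_le_l2 hab hu)
  refine (intervalIntegral.norm_integral_le_integral_norm hab).trans (le_of_eq ?_)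
  rw [intervalIntegral.integral_of_le hab, integral_Ioc_eq_integral_Ioo]
  simp [norm_osc]

theorem sq_l2_eq {u : ℝ → ℂ} (hu : MemLp u 2 (volume.restrict (Ioo a b))) :
    ∫ x in Ioo a b, ‖u x‖ ^ 2 = l2 a b u ^ 2 := by
  have h := hu.eLpNorm_eq_integral_rpow_norm (by norm_num) (by norm_num)
  have h0 : 0 ≤ ∫ x in Ioo a b, ‖u x‖ ^ 2 := integral_nonneg fun _ => by positivity
  unfold l2 normL2
  rw [h, ENNReal.toReal_ofReal (by positivity)]
  norm_num
  rw [← Real.sqrt_eq_rpow, Real.sq_sqrt h0]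

/-- The interval `(2a - b, b)` is `(a, b)` together with its mirror image about `a`. Its length `2(b
- a)` has fundamental frequency `π/(b - a)`, and the prefactor moves the origin of the oscillations
to `a`. -/
theorem fourierCoeffOn_reflect (hab : a < b) (W : ℝ → ℂ) (k : ℤ) :
    fourierCoeffOn (show 2 * a - b < b by linarith) W k = osc (-k) (freqUnit a b * a) *
      ((1 / (2 * (b - a)) : ℝ) * ∫ x in (2 * a - b)..b, osc (-k) (freqUnit a b * (x - a)) * W x) := by
  rw [fourierCoeffOn_eq_integral (E := ℂ), Complex.real_smul,
    mul_left_comm (osc (-k) (freqUnit a b * a)), show b - (2 * a - b) = 2 * (b - a) by ring,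
    ← intervalIntegral.integral_const_mul (osc (-k) (freqUnit a b * a))]
  congr 1
  refine intervalIntegral.integral_congr (E := ℂ) fun x _ => ?_
  have hb : ((b : ℂ) - a) ≠ 0 := by exact_mod_cast (sub_pos.2 hab).ne'
  simp only [smul_eq_mul]
  rw [← mul_assoc, ← osc_add_right, fourier_coe_apply]
  congr 1
  unfold osc
  congr 1
  unfold freqUnit
  push_cast
  field_simp
  ring

/-- Parseval's identity on the doubled interval for the extension of `u` by zero. -/
theorem sum_norm_expInt_sq_le (hab : a < b) {u : ℝ → ℂ}
    (hu : MemLp u 2 (volume.restrict (Ioo a b))) :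
    SobLE 0 (expInt a b u) (√(2 * (b - a)) * l2 a b u) := by
  have hba : 0 < b - a := sub_pos.2 hab
  have hlt : 2 * a - b < b := by linarith
  have hm : MemLp ((Ioo a b).indicator u) 2 volume := (memLp_indicator_iff_restrict measurableSet_Ioo).2 hu
  have hs := hasSum_sq_fourierCoeffOn hlt (hm.restrict _)
  have hsub : Ioo a b ⊆ Ioc (2 * a - b) b := fun x hx => ⟨by linarith [hx.1], hx.2.le⟩
  have e1 : ∀ k, ∫ x in (2 * a - b)..b, osc (-k) (freqUnit a b * (x - a)) * (Ioo a b).indicator u x =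
      expInt a b u (-k) := fun k => by
    have : ∀ x, osc (-k) (freqUnit a b * (x - a)) * (Ioo a b).indicator u x =
      (Ioo a b).indicator (fun x => osc (-k) (freqUnit a b * (x - a)) * u x) x := fun x => by
        simp only [indicator]; split_ifs <;> simp
    simp_rw [this]
    rw [intervalIntegral.integral_of_le hlt.le, setIntegral_indicator measurableSet_Ioo,
      inter_eq_self_of_subset_right hsub, expInt,
      intervalIntegral.integral_of_le hab.le, integral_Ioc_eq_integral_Ioo]
  have e2 : ∀ k, ‖fourierCoeffOn hlt ((Ioo a b).indicator u) k‖ ^ 2 =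
      (1 / (2 * (b - a))) ^ 2 * ‖expInt a b u (-k)‖ ^ 2 := fun k => by
    rw [fourierCoeffOn_reflect hab, e1, norm_mul, norm_osc, one_mul, norm_mul, mul_pow,
      Complex.norm_real, Real.norm_eq_abs, sq_abs]
  have e3 : ∫ x in (2 * a - b)..b, ‖(Ioo a b).indicator u x‖ ^ 2 = l2 a b u ^ 2 := by
    have : ∀ x, ‖(Ioo a b).indicator u x‖ ^ 2 = (Ioo a b).indicator (fun x => ‖u x‖ ^ 2) x := fun x => by
        simp only [indicator]; split_ifs <;> simp
    simp_rw [this]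
    rw [intervalIntegral.integral_of_le hlt.le, setIntegral_indicator measurableSet_Ioo,
      inter_eq_self_of_subset_right hsub, sq_l2_eq hu]
  rw [e3] at hs
  simp_rw [e2] at hs
  refine SobLE.of_sum (mul_nonneg (Real.sqrt_nonneg _) (l2_nonneg _)) fun S => ?_
  have h1 := sum_le_hasSum (S.map (Equiv.neg ℤ).toEmbedding) (fun _ _ => by positivity) hs
  rw [Finset.sum_map] at h1
  simp only [Equiv.toEmbedding_apply, Equiv.neg_apply, neg_neg, ← Finset.mul_sum, smul_eq_mul,
    show b - (2 * a - b) = 2 * (b - a) by ring] at h1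
  simp only [pow_zero, one_mul]
  rw [mul_pow, Real.sq_sqrt (by positivity)]
  have h2 : (1 / (2 * (b - a))) ^ 2 * ∑ k ∈ S, ‖expInt a b u k‖ ^ 2 ≤
      (1 / (2 * (b - a))) ^ 2 * (2 * (b - a) * l2 a b u ^ 2) := by
    refine h1.trans (le_of_eq ?_)
    field_simp
  exact le_of_mul_le_mul_left h2 (by positivity)

theorem tendsto_expInt (hab : a < b) {u : ℝ → ℂ} (hu : MemLp u 2 (volume.restrict (Ioo a b))) :
    Tendsto (expInt a b u) cofinite (𝓝 0) := by
  have h := sum_norm_expInt_sq_le hab hu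
  have hs : Summable fun k => ‖expInt a b u k‖ ^ 2 := by
    refine summable_of_sum_le (c := (√(2 * (b - a)) * l2 a b u) ^ 2) (fun _ => by positivity)
      fun S => ?_
    simpa using h.sum_le S
  have h0 := hs.tendsto_cofinite_zero
  rw [tendsto_zero_iff_norm_tendsto_zero]
  have := (Real.continuous_sqrt.tendsto 0).comp h0
  rw [Real.sqrt_zero] at this
  exact this.congr fun k => Real.sqrt_sq (norm_nonneg _)

/-- A continuous function with vanishing sine coefficients vanishes. -/
theorem eq_zero_of_oddCoeff_eq_zero (hab : a < b) {u : ℝ → ℂ} (hu : ContinuousOn u (Icc a b))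
    (h : ∀ k, oddCoeff a b u k = 0) {x : ℝ} (hx : x ∈ Icc a b) : u x = 0 := by
  have hba : 0 < b - a := sub_pos.2 hab
  have hbac : (2 * ((b : ℂ) - a)) ≠ 0 := mul_ne_zero two_ne_zero (by exact_mod_cast hba.ne')
  have hlt : 2 * a - b < b := by linarith
  -- The odd reflection about `a`. Its Fourier coefficients on the doubled interval are multiples of
  -- the odd coefficients of `u`, so they all vanish and Parseval's identity gives `W = 0` almost
  -- everywhere.
  let W : ℝ → ℂ := fun x => if a < x then u x else -u (2 * a - x)
  have hWr : ∀ x ∈ Ioo a b, W x = u x := fun x hx => if_pos hx.1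
  have hWl : ∀ x ∈ Ioc (2 * a - b) a, W x = -u (2 * a - x) := fun x hx => if_neg (not_lt.2 hx.2)
  have hul : ContinuousOn (fun x => -u (2 * a - x)) (Icc (2 * a - b) a) :=
    (hu.comp (by fun_prop) fun x hx => ⟨by linarith [hx.2], by linarith [hx.1]⟩).neg
  obtain ⟨C, hC⟩ := isCompact_Icc.exists_bound_of_continuousOn hu
  have hunion : Ioc (2 * a - b) b = Ioc (2 * a - b) a ∪ Ioc a b :=
    (Ioc_union_Ioc_eq_Ioc (by linarith) hab.le).symm
  have hmeas : AEStronglyMeasurable W (volume.restrict (Ioc (2 * a - b) b)) := by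
    rw [hunion]
    refine aestronglyMeasurable_union_iff.2 ⟨?_, ?_⟩
    · refine ((hul.mono Ioc_subset_Icc_self).aestronglyMeasurable measurableSet_Ioc).congr ?_
      exact (ae_restrict_iff' measurableSet_Ioc).2 (Eventually.of_forall fun x hx => (hWl x hx).symm)
    · refine ((hu.mono Ioc_subset_Icc_self).aestronglyMeasurable measurableSet_Ioc).congr ?_
      exact (ae_restrict_iff' measurableSet_Ioc).2
        (Eventually.of_forall fun x hx => (if_pos hx.1).symm)
  have hL : MemLp W 2 (volume.restrict (Ioc (2 * a - b) b)) := by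
    refine MemLp.of_bound hmeas C ((ae_restrict_iff' measurableSet_Ioc).2
      (Eventually.of_forall fun x hx => ?_))
    by_cases hxa : a < x
    · simp only [W, if_pos hxa]; exact hC x ⟨hxa.le, hx.2⟩
    · simp only [W, if_neg hxa, norm_neg]
      exact hC _ ⟨by linarith [not_lt.1 hxa], by linarith [hx.1]⟩
  have hWi : IntervalIntegrable W volume (2 * a - b) b :=
    (intervalIntegrable_iff_integrableOn_Ioc_of_le hlt.le).2 (hL.integrable (by norm_num))
  have hz : ∀ k, fourierCoeffOn hlt W k = 0 := fun k => by
    rw [fourierCoeffOn_reflect hab]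
    have hfi : IntervalIntegrable (fun x => osc (-k) (freqUnit a b * (x - a)) * W x) volume
        (2 * a - b) b := hWi.continuousOn_mul (continuous_osc_freq (-k)).continuousOn
    have hsplit := intervalIntegral.integral_add_adjacent_intervals
      (hfi.mono_set (c := 2 * a - b) (d := a) (by
        rw [uIcc_of_le (by linarith), uIcc_of_le hlt.le]; exact Icc_subset_Icc_right hab.le))
      (hfi.mono_set (c := a) (d := b) (by
        rw [uIcc_of_le hab.le, uIcc_of_le hlt.le]; exact Icc_subset_Icc_left (by linarith)))
    have e1 : ∫ x in a..b, osc (-k) (freqUnit a b * (x - a)) * W x = expInt a b u (-k) := by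
      refine intervalIntegral.integral_congr_ae (Eventually.of_forall fun x hx => ?_)
      rw [uIoc_of_le hab.le] at hx
      simp only [W, if_pos hx.1]
    have e2 : ∫ x in (2 * a - b)..a, osc (-k) (freqUnit a b * (x - a)) * W x = -expInt a b u k := by
      have h1 : ∫ x in (2 * a - b)..a, osc (-k) (freqUnit a b * (x - a)) * W x =
          ∫ x in (2 * a - b)..a, (fun y => -(osc k (freqUnit a b * (y - a)) * u y)) (2 * a - x) := by
        refine intervalIntegral.integral_congr_ae (Eventually.of_forall fun x hx => ?_)
        rw [uIoc_of_le (by linarith)] at hx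
        rw [hWl x hx, osc_neg_left, mul_neg]
        congr 3; ring
      rw [h1, intervalIntegral.integral_comp_sub_left
        (fun y => -(osc k (freqUnit a b * (y - a)) * u y)), intervalIntegral.integral_neg, expInt]
      congr 2 <;> ring
    have h2 : expInt a b u k - expInt a b u (-k) = 0 := by
      have := h k
      unfold oddCoeff at this
      rw [div_eq_zero_iff] at this
      exact neg_eq_zero.1 (this.resolve_right hbac)
    rw [← hsplit, e1, e2, show -expInt a b u k + expInt a b u (-k) =
      -(expInt a b u k - expInt a b u (-k)) by ring, h2]
    simp
  have hs := hasSum_sq_fourierCoeffOn hlt hL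
  simp_rw [hz] at hs
  have h0 : ∫ x in (2 * a - b)..b, ‖W x‖ ^ 2 = 0 := by
    have := hs.unique (show HasSum (fun _ : ℤ => ‖(0 : ℂ)‖ ^ 2) 0 by simp [hasSum_zero])
    have hne : (b - (2 * a - b))⁻¹ ≠ 0 := inv_ne_zero (by linarith)
    exact (smul_eq_zero.1 this).resolve_left hne
  rw [intervalIntegral.integral_of_le hlt.le] at h0
  have hae := (integral_eq_zero_iff_of_nonneg (fun _ => by positivity) hL.integrable_norm_pow').1 h0
  have hae' : u =ᵐ[volume.restrict (Ioo a b)] fun _ => 0 := by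
    have hsub : Ioo a b ⊆ Ioc (2 * a - b) b := fun x hx => ⟨by linarith [hx.1], hx.2.le⟩
    have := ae_restrict_of_ae_restrict_of_subset hsub hae
    filter_upwards [this, ae_restrict_mem measurableSet_Ioo] with x hx hxm
    rw [hWr x hxm] at hx
    simpa using hx
  exact eqOn_Icc_of_ae_eq_Ioo hab hu continuousOn_const hae' hx

/-- For an odd series the integral over `(-π, 0)` is determined by the one over `(0, π)`, so
integrals over half a period already recover the coefficients. -/
theorem integral_fser_mul_osc_freq (hab : a < b) {d : ℤ → ℂ} (hd : Summable fun k => ‖d k‖)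
    (hodd : ∀ k, d (-k) = -d k) (k : ℤ) :
    oddCoeff a b (fun x => fser d (freqUnit a b * (x - a))) k = d k := by
  have hθ := freqUnit_pos hab
  have hcf := continuous_fser hd
  have e1 : ∀ k, expInt a b (fun x => fser d (freqUnit a b * (x - a))) k =
      ((freqUnit a b)⁻¹ : ℝ) * ∫ y in (0 : ℝ)..π, osc k y * fser d y := fun k => by
    have := intervalIntegral.integral_comp_mul_sub (a := a) (b := b)
      (fun y => osc k y * fser d y) hθ.ne' (freqUnit a b * a)
    rw [sub_self, ← mul_sub, freqUnit_mul hab, Complex.real_smul] at this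
    rw [← this, expInt]
    simp_rw [mul_sub]
  have hint : ∀ (k : ℤ) (p q : ℝ), IntervalIntegrable (fun y => osc k y * fser d y) volume p q :=
    fun k p q => ((continuous_osc k).mul hcf).intervalIntegrable _ _
  have e2 : ∫ y in (-π)..0, osc (-k) y * fser d y = -∫ y in (0 : ℝ)..π, osc k y * fser d y := by
    have := intervalIntegral.integral_comp_neg (a := 0) (b := π) (fun y => osc (-k) y * fser d y)
    rw [neg_zero] at this
    rw [← this, ← intervalIntegral.integral_neg]
    refine intervalIntegral.integral_congr fun y _ => ?_
    simp only [osc_neg_left, neg_neg, fser_neg_of_odd hodd, mul_neg]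
  have e3 := integral_fser_mul_osc hd k
  simp_rw [mul_comm (fser d _)] at e3
  rw [← intervalIntegral.integral_add_adjacent_intervals (hint (-k) (-π) 0) (hint (-k) 0 π), e2] at e3
  unfold oddCoeff
  rw [e1, e1, ← mul_sub, show (∫ y in (0 : ℝ)..π, osc k y * fser d y) -
    ∫ y in (0 : ℝ)..π, osc (-k) y * fser d y = -(2 * π * d k) by rw [← e3]; ring]
  have hba : ((b : ℂ) - a) ≠ 0 := by exact_mod_cast (sub_pos.2 hab).ne'
  have hpi : (π : ℂ) ≠ 0 := by exact_mod_cast pi_ne_zero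
  unfold freqUnit
  push_cast
  field_simp

/-- A continuous function with summable sine coefficients is the sum of its sine series. -/
theorem eq_fser_oddCoeff (hab : a < b) {u : ℝ → ℂ} (hu : ContinuousOn u (Icc a b))
    (hs : Summable fun k => ‖oddCoeff a b u k‖) {x : ℝ} (hx : x ∈ Icc a b) :
    u x = fser (oddCoeff a b u) (freqUnit a b * (x - a)) := by
  have hf : Continuous fun x => fser (oddCoeff a b u) (freqUnit a b * (x - a)) :=
    (continuous_fser hs).comp (by fun_prop)
  refine sub_eq_zero.1 (eq_zero_of_oddCoeff_eq_zero hab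
    (u := fun x => u x - fser (oddCoeff a b u) (freqUnit a b * (x - a)))
    (hu.sub hf.continuousOn) (fun k => ?_) hx)
  rw [oddCoeff_sub (hu.intervalIntegrable_of_Icc hab.le) (hf.intervalIntegrable _ _),
    integral_fser_mul_osc_freq hab hs (oddCoeff_neg u), sub_self]

theorem sineCoeff_eq (hab : a < b) {u : ℝ → ℂ} (hu : IntervalIntegrable u volume a b) (l : ℕ) :
    sineCoeff a b u l = 2 * Complex.I * oddCoeff a b u l := by
  have hba : ((b : ℂ) - a) ≠ 0 := by exact_mod_cast (sub_pos.2 hab).ne'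
  have e : ∫ x in Ioo a b, u x * ((sin (freq a b l * (x - a)) : ℝ) : ℂ) =
      (expInt a b u l - expInt a b u (-l)) / (2 * Complex.I) := by
    unfold expInt
    rw [← intervalIntegral.integral_sub (intervalIntegrable_osc_mul hu _)
      (intervalIntegrable_osc_mul hu _), ← intervalIntegral.integral_div,
      intervalIntegral.integral_of_le hab.le, integral_Ioc_eq_integral_Ioo]
    congr 1
    funext x
    have h1 : freq a b l * (x - a) = l * (freqUnit a b * (x - a)) := by
      unfold freq freqUnit; ring
    rw [h1, Complex.ofReal_sin, Complex.sin]
    unfold osc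
    push_cast
    field_simp
    rw [Complex.I_sq]
    ring_nf
  unfold sineCoeff oddCoeff
  rw [e]
  field_simp
  rw [Complex.I_sq]
  ring

theorem osc_neg_pi (k : ℤ) : osc (-k) π = osc k π := by
  have h : osc k (-π + 2 * π) = osc k (-π) := by rw [osc_add_right, osc_two_pi, mul_one]
  rw [osc_neg_left, ← h]; congr 1; ring

/-- Integration by parts in the exponential integrals. -/
theorem SobRep.expInt_succ (hab : a < b) {m : ℕ} {u : ℝ → ℂ} {D : ℕ → ℝ → ℂ}
    (h : SobRep a b m u D) {k : ℕ} (hk : k < m) (l : ℤ) :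
    Complex.I * l * freqUnit a b * expInt a b (D k) l =
      osc l π * D k b - D k a - expInt a b (D (k + 1)) l := by
  have hd : ∀ x, HasDerivAt (fun x => osc l (freqUnit a b * (x - a)))
      (Complex.I * l * freqUnit a b * osc l (freqUnit a b * (x - a))) x := fun x => by
    have h1 : HasDerivAt (fun x => freqUnit a b * (x - a)) (freqUnit a b) x := by
      simpa using ((hasDerivAt_id x).sub_const a).const_mul (freqUnit a b)
    refine ((hasDerivAt_osc l (freqUnit a b * (x - a))).scomp x h1).congr_deriv ?_
    rw [Complex.real_smul]; ring
  have := integral_deriv_mul_primitive hab.le hd (continuous_const.mul (continuous_osc_freq l))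
    (h.intervalIntegrable hab.le (k := k + 1) hk) (h.ftc k hk)
  rw [sub_self, mul_zero, osc_zero_right, one_mul, freqUnit_mul hab] at this
  unfold expInt
  rw [← this, ← intervalIntegral.integral_const_mul]
  simp_rw [mul_assoc]

end sine

/-! ### Decay of sine coefficients -/

section decay

variable {a b : ℝ}

/-- The coefficients of the even `2(b-a)`-periodic extension of `u`. -/
noncomputable def evenCoeff (a b : ℝ) (u : ℝ → ℂ) (k : ℤ) : ℂ :=
  (expInt a b u k + expInt a b u (-k)) / (2 * ((b : ℂ) - a))

/-- The symbol `ikπ/(b-a)` of the derivative. -/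
noncomputable def dsymb (a b : ℝ) (k : ℤ) : ℂ := Complex.I * k * freqUnit a b

theorem norm_dsymb (hab : a < b) (k : ℤ) : ‖dsymb a b k‖ = |(k : ℝ)| * freqUnit a b := by
  simp [dsymb, abs_of_pos (freqUnit_pos hab)]

theorem dsymb_ne_zero (hab : a < b) {k : ℤ} (hk : k ≠ 0) : dsymb a b k ≠ 0 :=
  mul_ne_zero (mul_ne_zero Complex.I_ne_zero (by exact_mod_cast hk))
    (by exact_mod_cast (freqUnit_pos hab).ne')

/-- Integration by parts exchanges odd and even coefficients. Going from odd to even leaves a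
boundary term, the only obstruction to decay; in the opposite direction the boundary terms cancel
because `osc l π` is even in `l`. -/
theorem SobRep.dsymb_mul_oddCoeff (hab : a < b) {m : ℕ} {u : ℝ → ℂ} {D : ℕ → ℝ → ℂ}
    (h : SobRep a b m u D) {k : ℕ} (hk : k < m) (l : ℤ) :
    dsymb a b l * oddCoeff a b (D k) l =
      evenCoeff a b (D (k + 1)) l - (osc l π * D k b - D k a) / ((b : ℂ) - a) := by
  have h1 := h.expInt_succ hab hk l
  have h2 := h.expInt_succ hab hk (-l)
  rw [osc_neg_pi] at h2
  push_cast at h2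
  have hba : ((b : ℂ) - a) ≠ 0 := by exact_mod_cast (sub_pos.2 hab).ne'
  unfold dsymb oddCoeff evenCoeff
  field_simp
  linear_combination -h1 - h2

theorem SobRep.dsymb_mul_evenCoeff (hab : a < b) {m : ℕ} {u : ℝ → ℂ} {D : ℕ → ℝ → ℂ}
    (h : SobRep a b m u D) {k : ℕ} (hk : k < m) (l : ℤ) :
    dsymb a b l * evenCoeff a b (D k) l = oddCoeff a b (D (k + 1)) l := by
  have h1 := h.expInt_succ hab hk l
  have h2 := h.expInt_succ hab hk (-l)
  rw [osc_neg_pi] at h2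
  push_cast at h2
  have hba : ((b : ℂ) - a) ≠ 0 := by exact_mod_cast (sub_pos.2 hab).ne'
  unfold dsymb oddCoeff evenCoeff
  field_simp
  linear_combination h1 - h2

theorem SobRep.oddCoeff_add_two (hab : a < b) {m : ℕ} {u : ℝ → ℂ} {D : ℕ → ℝ → ℂ}
    (h : SobRep a b m u D) {k : ℕ} (hk : k + 1 < m) (ha : D k a = 0) (hb : D k b = 0) (l : ℤ) :
    oddCoeff a b (D (k + 2)) l = dsymb a b l ^ 2 * oddCoeff a b (D k) l := by
  have h1 := h.dsymb_mul_oddCoeff hab (k := k) (by omega) l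
  rw [ha, hb] at h1
  rw [← h.dsymb_mul_evenCoeff hab hk, pow_two, mul_assoc, h1]
  simp

theorem norm_evenCoeff_le (hab : a < b) {u : ℝ → ℂ} (hu : MemLp u 2 (volume.restrict (Ioo a b)))
    (k : ℤ) : ‖evenCoeff a b u k‖ ≤ √(b - a) * l2 a b u / (b - a) := by
  have hba : 0 < b - a := sub_pos.2 hab
  have e : ‖(2 * ((b : ℂ) - a))‖ = 2 * (b - a) := by
    rw [norm_mul, ← Complex.ofReal_sub, Complex.norm_real, Real.norm_of_nonneg hba.le]; norm_num
  unfold evenCoeff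
  rw [norm_div, e, div_le_div_iff₀ (by positivity) hba]
  have h1 := norm_add_le (expInt a b u k) (expInt a b u (-k))
  have h2 := norm_expInt_le hab.le hu k
  have h3 := norm_expInt_le hab.le hu (-k)
  calc _ ≤ (2 * (√(b - a) * l2 a b u)) * (b - a) := by gcongr; linarith
    _ = _ := by ring

theorem SobLE.comp_neg {s : ℕ} {c : ℤ → ℂ} {B : ℝ} (h : SobLE s c B) : SobLE s (fun k => c (-k)) B :=
  h.star_neg.of_norm_le fun k => by simp

theorem sobLE_oddCoeff (hab : a < b) {u : ℝ → ℂ} (hu : MemLp u 2 (volume.restrict (Ioo a b))) :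
    SobLE 0 (oddCoeff a b u) (‖(2 * ((b : ℂ) - a))⁻¹‖ *
      (√(2 * (b - a)) * l2 a b u + √(2 * (b - a)) * l2 a b u)) := by
  have h := sum_norm_expInt_sq_le hab hu
  refine ((h.sub h.comp_neg).const_mul (2 * ((b : ℂ) - a))⁻¹).of_norm_le fun k => ?_
  unfold oddCoeff
  refine le_of_eq ?_
  rw [div_eq_inv_mul, norm_mul, norm_neg, norm_mul]

theorem sobLE_evenCoeff (hab : a < b) {u : ℝ → ℂ} (hu : MemLp u 2 (volume.restrict (Ioo a b))) :
    SobLE 0 (evenCoeff a b u) (‖(2 * ((b : ℂ) - a))⁻¹‖ *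
      (√(2 * (b - a)) * l2 a b u + √(2 * (b - a)) * l2 a b u)) := by
  have h := sum_norm_expInt_sq_le hab hu
  refine ((h.add h.comp_neg).const_mul (2 * ((b : ℂ) - a))⁻¹).of_norm_le fun k => ?_
  unfold evenCoeff
  refine le_of_eq ?_
  rw [div_eq_inv_mul]

theorem tendsto_evenCoeff (hab : a < b) {u : ℝ → ℂ} (hu : MemLp u 2 (volume.restrict (Ioo a b))) :
    Tendsto (evenCoeff a b u) cofinite (𝓝 0) := by
  have h := tendsto_expInt hab hu
  have h' := h.comp (neg_injective (G := ℤ)).tendsto_cofinite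
  have := (h.add h').div_const (2 * ((b : ℂ) - a))
  rw [add_zero, zero_div] at this
  exact this

/-- Away from the zero frequency `1 + |k| ≤ 2|k|`, so powers of the derivative symbol control the
weight. The zero frequency must be excluded separately. -/
theorem SobLE.of_dsymb (hab : a < b) {s : ℕ} {c z : ℤ → ℂ} {B : ℝ} (hz : SobLE 0 z B)
    (h0 : c 0 = 0) (h : ∀ k, ‖dsymb a b k ^ s * c k‖ = ‖z k‖) :
    SobLE s c ((2 / freqUnit a b) ^ s * B) := by
  have hθ := freqUnit_pos hab
  refine hz.of_le (by positivity) fun k => ?_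
  rcases eq_or_ne k 0 with rfl | hk
  · rw [h0, norm_zero, mul_zero]
    have := wt_pos 0
    positivity
  · have h1 : wt k ≤ 2 / freqUnit a b * (|(k : ℝ)| * freqUnit a b) := by
      have : (1 : ℝ) ≤ |(k : ℝ)| := by exact_mod_cast Int.one_le_abs hk
      have e : 2 / freqUnit a b * (|(k : ℝ)| * freqUnit a b) = 2 * |(k : ℝ)| := by field_simp
      rw [e, wt]; linarith
    rw [← h k, norm_mul, norm_pow, norm_dsymb hab, pow_zero, one_mul, ← mul_assoc, ← mul_pow]
    exact mul_le_mul_of_nonneg_right (pow_le_pow_left₀ (wt_pos k).le h1 _) (norm_nonneg _)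

theorem sobLE_single (s : ℕ) (z : ℂ) : SobLE s (fun k => if k = 0 then z else 0) ‖z‖ := by
  refine SobLE.of_sum (norm_nonneg _) fun S => ?_
  have h : ∀ k : ℤ, (wt k ^ s * ‖if k = 0 then z else 0‖) ^ 2 = if k = 0 then ‖z‖ ^ 2 else 0 := by
    intro k
    split_ifs with hk
    · subst hk; simp [wt]
    · simp
  simp_rw [h]
  rw [Finset.sum_ite_eq']
  split_ifs
  · exact le_rfl
  · positivity

theorem fser_single (z : ℂ) (y : ℝ) : fser (fun k => if k = 0 then z else 0) y = z := by
  unfold fser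
  rw [tsum_eq_single 0 fun k hk => by simp [hk]]
  simp [osc_zero_left]

theorem integral_fser_freq (hab : a < b) {c : ℤ → ℂ} (hc : Summable fun k => wt k ^ 1 * ‖c k‖) (x : ℝ) :
    ∫ t in a..x, fser (fun k => dsymb a b k * c k) (freqUnit a b * (t - a)) =
      fser c (freqUnit a b * (x - a)) - fser c 0 := by
  have hd : ∀ t, HasDerivAt (fun t => fser c (freqUnit a b * (t - a)))
      (fser (fun k => dsymb a b k * c k) (freqUnit a b * (t - a))) t := fun t => by
    have h1 : HasDerivAt (fun t => freqUnit a b * (t - a)) (freqUnit a b) t := by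
      simpa using ((hasDerivAt_id t).sub_const a).const_mul (freqUnit a b)
    refine ((hasDerivAt_fser hc (freqUnit a b * (t - a))).scomp t h1).congr_deriv ?_
    rw [Complex.real_smul, ← fser_const_mul]
    congr 1
    funext k
    unfold dsymb; ring
  have hs : Summable fun k => ‖dsymb a b k * c k‖ := by
    refine Summable.of_nonneg_of_le (fun _ => norm_nonneg _) (fun k => ?_)
      (hc.mul_left (freqUnit a b))
    rw [norm_mul, norm_dsymb hab, pow_one, mul_comm |(k : ℝ)|, mul_assoc]
    exact mul_le_mul_of_nonneg_left (mul_le_mul_of_nonneg_right (abs_le_wt k) (norm_nonneg _))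
      (freqUnit_pos hab).le
  have hcont : Continuous fun t => fser (fun k => dsymb a b k * c k) (freqUnit a b * (t - a)) :=
    (continuous_fser hs).comp (by fun_prop)
  rw [intervalIntegral.integral_eq_sub_of_hasDerivAt (fun t _ => hd t)
    (hcont.intervalIntegrable _ _)]
  simp

theorem sobLE_of_summable_freq (hab : a < b) {s : ℕ} {w : ℤ → ℂ} (hw : ∀ k, w (-k) = -w k)
    (hs : Summable fun l : ℕ => freq a b (l + 1) ^ (2 * s) * ‖2 * Complex.I * w (l + 1 : ℕ)‖ ^ 2) :
    ∃ B, SobLE 0 (fun k => dsymb a b k ^ s * w k) B := by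
  have hn : ∀ k : ℤ, ‖dsymb a b (-k) ^ s * w (-k)‖ = ‖dsymb a b k ^ s * w k‖ := fun k => by
    rw [hw, norm_mul, norm_mul, norm_pow, norm_pow, norm_dsymb hab, norm_dsymb hab, norm_neg]
    simp
  have h1 : Summable fun l : ℕ => ‖dsymb a b (l : ℤ) ^ s * w (l : ℤ)‖ ^ 2 := by
    rw [← summable_nat_add_iff 1]
    refine (hs.mul_left (1 / 4)).congr fun l => ?_
    rw [norm_mul (dsymb a b _ ^ s), norm_pow, norm_dsymb hab]
    unfold freq freqUnit
    simp only [Complex.norm_mul, Complex.norm_I, Complex.norm_ofNat]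
    push_cast
    rw [abs_of_nonneg (by positivity)]
    ring
  have h2 : Summable fun k : ℤ => ‖dsymb a b k ^ s * w k‖ ^ 2 :=
    Summable.of_nat_of_neg h1 (h1.congr fun l => by rw [hn])
  refine ⟨√(∑' k : ℤ, ‖dsymb a b k ^ s * w k‖ ^ 2), SobLE.of_sum (Real.sqrt_nonneg _) fun S => ?_⟩
  rw [Real.sq_sqrt (tsum_nonneg fun _ => by positivity)]
  simp only [pow_zero, one_mul]
  exact h2.sum_le_tsum S fun _ _ => by positivity

/-- The cosine coefficients of the potential. -/
theorem exists_potential_coeff (hab : a < b) {m : ℕ} (hm : 2 ≤ m) {V : ℝ → ℝ}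
    (hVc : ContinuousOn V (Icc a b)) (hV : MemH a b m (fun x => (V x : ℂ)))
    (hV' : ∃ W : ℝ → ℂ, HasWeakDeriv a b 1 (fun x => (V x : ℂ)) W ∧ MemHsin a b (m - 1) W) :
    ∃ v B, SobLE m v B ∧ cbar v = v ∧ (∀ k, v (-k) = v k) ∧
      ∀ x ∈ Icc a b, fser v (freqUnit a b * (x - a)) = V x := by
  have hθ := freqUnit_pos hab
  obtain ⟨D, hD⟩ := hV.exists_sobRep hab (by omega) (Complex.continuous_ofReal.comp_continuousOn hVc)
  obtain ⟨W, hW, hWm, -, hWs⟩ := hV'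
  have hae : W =ᵐ[volume.restrict (Ioo a b)] D 1 := hW.ae_unique (hD.weak 1 (by omega))
  have hWi : MemLp W 2 (volume.restrict (Ioo a b)) :=
    (memLp_congr_ae hae).2 (hD.memLp 1 (by omega))
  have hsc : ∀ l, sineCoeff a b W l = 2 * Complex.I * oddCoeff a b (D 1) l := fun l => by
    rw [← sineCoeff_eq hab (hD.intervalIntegrable hab.le (by omega))]
    unfold sineCoeff
    congr 1
    refine integral_congr_ae ?_
    filter_upwards [hae] with x hx
    rw [hx]
  set w := oddCoeff a b (D 1) with hw
  have hwodd : ∀ k, w (-k) = -w k := oddCoeff_neg _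
  obtain ⟨A, hA⟩ := sobLE_of_summable_freq hab (s := m - 1) hwodd (by simpa only [hsc] using hWs)
  have hw1 : SobLE (m - 1) w ((2 / freqUnit a b) ^ (m - 1) * A) :=
    SobLE.of_dsymb hab hA (oddCoeff_zero _) fun _ => rfl
  -- Termwise integration of the sine series of the derivative. At frequency zero both numerator and
  -- denominator vanish, and the quotient is `0` by convention; the mean is restored afterwards.
  let v' : ℤ → ℂ := fun k => w k / dsymb a b k
  have hdv : ∀ k, dsymb a b k * v' k = w k := fun k => by
    rcases eq_or_ne k 0 with rfl | hk
    · simp [v', hw, oddCoeff_zero, dsymb]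
    · exact mul_div_cancel₀ _ (dsymb_ne_zero hab hk)
  have hv' : SobLE m v' ((2 / freqUnit a b) ^ m * A) :=
    SobLE.of_dsymb hab hA (by simp [v', hw, oddCoeff_zero]) fun k => by
      obtain ⟨p, rfl⟩ : ∃ p, m = p + 1 := ⟨m - 1, by omega⟩
      rw [pow_succ, mul_assoc, hdv, Nat.add_sub_cancel]
  have hv's : Summable fun k => wt k ^ 1 * ‖v' k‖ := (hv'.weaken hm).summable_wt
  have heven : ∀ k, v' (-k) = v' k := fun k => by
    simp only [v', hwodd, dsymb]
    push_cast
    rw [mul_neg, neg_mul, neg_div_neg_eq]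
  -- The constant of integration, fixed by the value of the potential at `a`.
  let z : ℂ := V a - fser v' 0
  let v'' : ℤ → ℂ := fun k => v' k + if k = 0 then z else 0
  have hv'' : SobLE m v'' ((2 / freqUnit a b) ^ m * A + ‖z‖) := hv'.add (sobLE_single m z)
  have hsum1 := hv'.summable_norm (by omega)
  have hsum2 := (sobLE_single m z).summable_norm (by omega)
  have hval : ∀ x ∈ Icc a b, fser v'' (freqUnit a b * (x - a)) = V x := fun x hx => by
    have h1 := hD.ftc 0 (by omega) x hx
    rw [hD.zero x hx, hD.zero a (left_mem_Icc.2 hab.le)] at h1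
    have h2 : ∫ t in a..x, D (0 + 1) t =
        ∫ t in a..x, fser (fun k => dsymb a b k * v' k) (freqUnit a b * (t - a)) := by
      refine intervalIntegral.integral_congr fun t ht => ?_
      rw [uIcc_of_le hx.1] at ht
      simp_rw [hdv]
      exact eq_fser_oddCoeff hab (hD.cont 1 (by omega)) (hw1.summable_norm (by omega))
        ⟨ht.1, ht.2.trans hx.2⟩
    rw [h2, integral_fser_freq hab hv's] at h1
    rw [fser_add hsum1 hsum2, fser_single, h1]
    ring
  have hv''s := hv''.summable_norm (show 1 ≤ m by omega)
  have heven'' : ∀ k, v'' (-k) = v'' k := fun k => by simp [v'', heven]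
  -- Averaging with the conjugate makes the series real on the whole circle without changing it on
  -- `[a, b]`, where the potential is real.
  refine ⟨fun k => (1 / 2 : ℂ) * (v'' k + cbar v'' k), _, (hv''.add hv''.cbar).const_mul _, ?_, ?_, ?_⟩
  · funext k
    simp only [cbar, map_mul, map_add, neg_neg, Complex.conj_conj]
    rw [add_comm, map_div₀, map_one, Complex.conj_ofNat]
  · intro k
    simp only [cbar, heven'', neg_neg]
  · intro x hx
    rw [fser_const_mul, fser_add hv''s (summable_cbar hv''s), fser_cbar, hval x hx, Complex.conj_ofReal]
    ring

/-! ### Parity of convolutions and of the nonlinear term. -/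

theorem conv_neg_index (c d : ℤ → ℂ) (k : ℤ) :
    conv c d (-k) = conv (fun j => c (-j)) (fun j => d (-j)) k := by
  unfold conv
  rw [← (Equiv.neg ℤ).tsum_eq]
  refine tsum_congr fun j => ?_
  simp only [Equiv.neg_apply]
  congr 2; ring

theorem nonlin_odd {v c : ℤ → ℂ} {β : ℝ} (hv : ∀ k, v (-k) = v k) (hc : ∀ k, c (-k) = -c k) (k : ℤ) :
    nonlin v β c (-k) = -nonlin v β c k := by
  have hneg : ∀ (p q : ℤ → ℂ) k, conv p (fun j => -q j) k = -conv p q k := fun p q k => by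
    unfold conv; rw [← tsum_neg]; simp_rw [mul_neg]
  have h1 : conv v c (-k) = -conv v c k := by
    rw [conv_neg_index]; simp_rw [hv, hc]; exact hneg v c k
  have h2 : ∀ k, conv c (cbar c) (-k) = conv c (cbar c) k := fun k => by
    rw [conv_neg_index]
    unfold conv
    refine tsum_congr fun j => ?_
    have e : c (-(k - j)) = -c (k - j) := hc _
    rw [neg_sub] at e
    simp [hc, cbar, e]
  have h3 : conv (conv c (cbar c)) c (-k) = -conv (conv c (cbar c)) c k := by
    rw [conv_neg_index]; simp_rw [h2, hc]; exact hneg _ c k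
  unfold nonlin
  rw [h1, h3]; ring

end decay

/-! ### The Fourier coefficients of the exact solution -/

/-- `ψ` is a curve in `H^m` with derivatives `D t k = ∂ₓᵏ ψ(t)` that solves the Gross-Pitaevskii
equation with potential `fser v (π (x - a) / (b - a))` and Dirichlet boundary conditions. -/
structure GPECurve (a b T β : ℝ) (m : ℕ) (V : ℝ → ℝ) (v : ℤ → ℂ) (Bv B : ℝ) (ψ : ℝ → ℝ → ℂ)
    (D : ℝ → ℕ → ℝ → ℂ) : Prop where
  lt : a < b
  nonneg : 0 ≤ T
  order : 3 ≤ m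
  cont : ∀ t ∈ Icc 0 T, ContinuousOn (ψ t) (Icc a b)
  curve : ContTimeH a b T m ψ
  rep : ∀ t ∈ Icc 0 T, SobRep a b m (ψ t) (D t)
  l2_le : ∀ t ∈ Icc 0 T, ∀ k ≤ m, l2 a b (D t k) ≤ B
  left : ∀ t ∈ Icc 0 T, ψ t a = 0
  right : ∀ t ∈ Icc 0 T, ψ t b = 0
  pot_cont : ContinuousOn V (Icc a b)
  pot_sob : SobLE m v Bv
  pot_real : cbar v = v
  pot_even : ∀ k, v (-k) = v k
  pot_eq : ∀ x ∈ Icc a b, fser v (freqUnit a b * (x - a)) = V x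
  eqn : ∀ t ∈ Ioo 0 T, ∀ x ∈ Ioo a b, HasDerivAt (fun s => ψ s x)
    (-Complex.I * (-(1 / 2) * D t 2 x + nls β (V x) (ψ t x))) t

theorem continuousOn_expInt {a b T : ℝ} (hab : a < b) {u : ℝ → ℝ → ℂ} {C : ℝ}
    (hu : ∀ t ∈ Icc 0 T, ContinuousOn (u t) (Icc a b))
    (hC : ∀ t ∈ Icc 0 T, ∀ x ∈ Icc a b, ‖u t x‖ ≤ C)
    (hc : ∀ x ∈ Icc a b, ContinuousOn (fun t => u t x) (Icc 0 T)) (l : ℤ) :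
    ContinuousOn (fun t => expInt a b (u t) l) (Icc 0 T) := fun t ht => by
  refine intervalIntegral.continuousWithinAt_of_dominated_interval (bound := fun _ => C) ?_ ?_
    intervalIntegrable_const (Eventually.of_forall fun x hx => ?_)
  · filter_upwards [self_mem_nhdsWithin] with s hs
    rw [uIoc_of_le hab.le]
    exact (((continuous_osc_freq l).continuousOn.mul (hu s hs)).mono
      Ioc_subset_Icc_self).aestronglyMeasurable measurableSet_Ioc
  · filter_upwards [self_mem_nhdsWithin] with s hs
    refine Eventually.of_forall fun x hx => ?_
    rw [uIoc_of_le hab.le] at hx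
    rw [norm_mul, norm_osc, one_mul]
    exact hC s hs x (Ioc_subset_Icc_self hx)
  · rw [uIoc_of_le hab.le] at hx
    exact (continuousWithinAt_const.mul (hc x (Ioc_subset_Icc_self hx) t ht))

theorem continuousOn_oddCoeff {a b T : ℝ} (hab : a < b) {u : ℝ → ℝ → ℂ} {C : ℝ}
    (hu : ∀ t ∈ Icc 0 T, ContinuousOn (u t) (Icc a b))
    (hC : ∀ t ∈ Icc 0 T, ∀ x ∈ Icc a b, ‖u t x‖ ≤ C)
    (hc : ∀ x ∈ Icc a b, ContinuousOn (fun t => u t x) (Icc 0 T)) (l : ℤ) :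
    ContinuousOn (fun t => oddCoeff a b (u t) l) (Icc 0 T) :=
  ((continuousOn_expInt hab hu hC hc l).sub (continuousOn_expInt hab hu hC hc (-l))).neg.div_const _

/-- A continuous function all of whose integrals from `0` vanish is zero. -/
theorem eq_zero_of_integral_eq_zero {T : ℝ} (hT : 0 < T) {f : ℝ → ℂ} (hf : ContinuousOn f (Icc 0 T))
    (h : ∀ s ∈ Icc 0 T, ∫ t in (0 : ℝ)..s, f t = 0) {t : ℝ} (ht : t ∈ Icc 0 T) : f t = 0 := by
  have h1 : ∀ s ∈ Ioo 0 T, f s = 0 := fun s hs => by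
    have hi : IntervalIntegrable f volume 0 s :=
      (hf.mono (Icc_subset_Icc_right hs.2.le)).intervalIntegrable_of_Icc hs.1.le
    have hd := intervalIntegral.integral_hasDerivAt_right hi
      ((hf.mono Ioo_subset_Icc_self).stronglyMeasurableAtFilter isOpen_Ioo s hs)
      (hf.continuousAt (Icc_mem_nhds hs.1 hs.2))
    refine hd.unique ((hasDerivAt_const s (0 : ℂ)).congr_of_eventuallyEq ?_)
    filter_upwards [Icc_mem_nhds hs.1 hs.2] with r hr
    exact h r hr
  exact eqOn_Icc_of_ae_eq_Ioo hT hf continuousOn_const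
    ((ae_restrict_iff' measurableSet_Ioo).2 (Eventually.of_forall h1)) ht

theorem continuous_nls (β : ℝ) : Continuous fun p : ℝ × ℂ => nls β p.1 p.2 := by
  unfold nls; fun_prop

namespace GPECurve

variable {a b T β : ℝ} {m : ℕ} {V : ℝ → ℝ} {v : ℤ → ℂ} {Bv B : ℝ} {ψ : ℝ → ℝ → ℂ}
  {D : ℝ → ℕ → ℝ → ℂ}

theorem exists_bound (h : GPECurve a b T β m V v Bv B ψ D) :
    ∃ C, ∀ t ∈ Icc 0 T, ∀ k < m, ∀ x ∈ Icc a b, ‖D t k x‖ ≤ C := by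
  refine ⟨(√(b - a) / (b - a) + √(b - a)) * (B + B), fun t ht k hk x hx => ?_⟩
  have hr := h.rep t ht
  refine (norm_le_of_primitive h.lt (hr.memLp k hk.le) (hr.memLp (k + 1) hk) (hr.ftc k hk) hx).trans ?_
  have hba : 0 < b - a := sub_pos.2 h.lt
  have h1 := h.l2_le t ht k hk.le
  have h2 := h.l2_le t ht (k + 1) hk
  gcongr

theorem nls_continuousOn (h : GPECurve a b T β m V v Bv B ψ D) {t : ℝ} (ht : t ∈ Icc 0 T) :
    ContinuousOn (fun x => nls β (V x) (ψ t x)) (Icc a b) :=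
  (continuous_nls β).comp_continuousOn (h.pot_cont.prodMk (h.cont t ht))

theorem exists_nls_bound (h : GPECurve a b T β m V v Bv B ψ D) :
    ∃ C, ∀ t ∈ Icc 0 T, ∀ x ∈ Icc a b, ‖nls β (V x) (ψ t x)‖ ≤ C := by
  obtain ⟨C, hC⟩ := h.exists_bound
  obtain ⟨C', hC'⟩ := isCompact_Icc.exists_bound_of_continuousOn h.pot_cont
  refine ⟨(C' + |β| * C ^ 2) * C, fun t ht x hx => ?_⟩
  have h1 := hC t ht 0 (by have := h.order; omega) x hx
  rw [(h.rep t ht).zero x hx] at h1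
  have h2 := hC' x hx
  have hC0 : 0 ≤ C := (norm_nonneg _).trans h1
  unfold nls
  rw [norm_mul, Complex.norm_real]
  refine mul_le_mul ((norm_add_le _ _).trans (add_le_add h2 ?_)) h1 (norm_nonneg _) ?_
  · rw [norm_mul, Real.norm_eq_abs, norm_pow, norm_norm]
    gcongr
  · have : 0 ≤ C' := (norm_nonneg _).trans h2
    positivity

theorem psi_continuousOn (h : GPECurve a b T β m V v Bv B ψ D) {x : ℝ} (hx : x ∈ Icc a b) :
    ContinuousOn (fun t => ψ t x) (Icc 0 T) := by
  refine (h.curve.continuousOn_deriv h.lt h.rep (k := 0) (by have := h.order; omega) hx).congr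
    fun t ht => ?_
  exact ((h.rep t ht).zero x hx).symm

theorem deriv_coeff_continuousOn (h : GPECurve a b T β m V v Bv B ψ D) {k : ℕ} (hk : k < m) (l : ℤ) :
    ContinuousOn (fun t => oddCoeff a b (D t k) l) (Icc 0 T) := by
  obtain ⟨C, hC⟩ := h.exists_bound
  exact continuousOn_oddCoeff h.lt (fun t ht => (h.rep t ht).cont k hk) (fun t ht => hC t ht k hk)
    (fun x hx => h.curve.continuousOn_deriv h.lt h.rep hk hx) l

theorem coeff_eq (h : GPECurve a b T β m V v Bv B ψ D) {t : ℝ} (ht : t ∈ Icc 0 T) (l : ℤ) :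
    oddCoeff a b (D t 0) l = oddCoeff a b (ψ t) l :=
  oddCoeff_congr h.lt.le (h.rep t ht).zero l

theorem coeff_continuousOn (h : GPECurve a b T β m V v Bv B ψ D) (l : ℤ) :
    ContinuousOn (fun t => oddCoeff a b (ψ t) l) (Icc 0 T) :=
  (h.deriv_coeff_continuousOn (k := 0) (by have := h.order; omega) l).congr
    fun t ht => (h.coeff_eq ht l).symm

theorem nls_coeff_continuousOn (h : GPECurve a b T β m V v Bv B ψ D) (l : ℤ) :
    ContinuousOn (fun t => oddCoeff a b (fun x => nls β (V x) (ψ t x)) l) (Icc 0 T) := by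
  obtain ⟨C, hC⟩ := h.exists_nls_bound
  exact continuousOn_oddCoeff h.lt (fun t ht => h.nls_continuousOn ht) hC
    (fun x hx => (continuous_nls β).comp_continuousOn
      (continuousOn_const.prodMk (h.psi_continuousOn hx))) l

theorem coeff_two (h : GPECurve a b T β m V v Bv B ψ D) {t : ℝ} (ht : t ∈ Icc 0 T) (l : ℤ) :
    oddCoeff a b (D t 2) l = dsymb a b l ^ 2 * oddCoeff a b (ψ t) l := by
  have hr := h.rep t ht
  have := hr.oddCoeff_add_two h.lt (k := 0) (by have := h.order; omega)
    (by rw [hr.zero a (left_mem_Icc.2 h.lt.le), h.left t ht])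
    (by rw [hr.zero b (right_mem_Icc.2 h.lt.le), h.right t ht]) l
  rw [zero_add, h.coeff_eq ht] at this
  exact this

theorem expInt_hasDerivAt (h : GPECurve a b T β m V v Bv B ψ D) {t : ℝ} (ht : t ∈ Ioo 0 T) (l : ℤ) :
    HasDerivAt (fun t => expInt a b (ψ t) l) (expInt a b
      (fun x => -Complex.I * (-(1 / 2) * D t 2 x + nls β (V x) (ψ t x))) l) t := by
  obtain ⟨C, hC⟩ := h.exists_bound
  obtain ⟨C', hC'⟩ := h.exists_nls_bound
  have h2m : 2 < m := by have := h.order; omega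
  have hab := h.lt
  have hcont : ∀ s ∈ Icc 0 T, ContinuousOn (fun x => -Complex.I * (-(1 / 2) * D s 2 x +
      nls β (V x) (ψ s x))) (Icc a b) := fun s hs =>
    continuousOn_const.mul ((continuousOn_const.mul ((h.rep s hs).cont 2 h2m)).add
      (h.nls_continuousOn hs))
  -- The equation is given only in the open interval, while interval integrals run over `(a, b]`;
  -- the end point `b` is a null set.
  have hne : ∀ᵐ x : ℝ, x ≠ b := by simp [ae_iff, measure_singleton]
  refine (intervalIntegral.hasDerivAt_integral_of_dominated_loc_of_deriv_le (s := Ioo 0 T)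
    (F := fun t x => osc l (freqUnit a b * (x - a)) * ψ t x)
    (F' := fun t x => osc l (freqUnit a b * (x - a)) *
      (-Complex.I * (-(1 / 2) * D t 2 x + nls β (V x) (ψ t x))))
    (bound := fun _ => 1 / 2 * C + C')
    (Ioo_mem_nhds ht.1 ht.2) ?_ ?_ ?_ ?_ intervalIntegrable_const ?_).2
  · filter_upwards [Icc_mem_nhds ht.1 ht.2] with s hs
    rw [uIoc_of_le hab.le]
    exact (((continuous_osc_freq l).continuousOn.mul (h.cont s hs)).mono
      Ioc_subset_Icc_self).aestronglyMeasurable measurableSet_Ioc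
  · exact ((continuous_osc_freq l).continuousOn.mul
      (h.cont t (Ioo_subset_Icc_self ht))).intervalIntegrable_of_Icc hab.le
  · rw [uIoc_of_le hab.le]
    exact (((continuous_osc_freq l).continuousOn.mul (hcont t (Ioo_subset_Icc_self ht))).mono
      Ioc_subset_Icc_self).aestronglyMeasurable measurableSet_Ioc
  · refine Eventually.of_forall fun x hx s hs => ?_
    rw [uIoc_of_le hab.le] at hx
    have hx' := Ioc_subset_Icc_self hx
    have hs' := Ioo_subset_Icc_self hs
    rw [norm_mul, norm_osc, one_mul, norm_mul, norm_neg, Complex.norm_I, one_mul]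
    refine (norm_add_le _ _).trans (add_le_add ?_ (hC' s hs' x hx'))
    rw [norm_mul]
    have := hC s hs' 2 h2m x hx'
    norm_num
    linarith
  · filter_upwards [hne] with x hxb hx s hs
    rw [uIoc_of_le hab.le] at hx
    exact (h.eqn s hs x ⟨hx.1, lt_of_le_of_ne hx.2 hxb⟩).const_mul _

theorem oddCoeff_lin (hab : a < b) {u w : ℝ → ℂ} (hu : ContinuousOn u (Icc a b))
    (hw : ContinuousOn w (Icc a b)) (p q : ℂ) (l : ℤ) :
    oddCoeff a b (fun x => p * (q * u x + w x)) l =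
      p * (q * oddCoeff a b u l + oddCoeff a b w l) := by
  have e : ∀ l, expInt a b (fun x => p * (q * u x + w x)) l =
      p * (q * expInt a b u l + expInt a b w l) := fun l => by
    have i1 := intervalIntegrable_osc_mul (hu.intervalIntegrable_of_Icc (μ := volume) hab.le) l
    have i2 := intervalIntegrable_osc_mul (hw.intervalIntegrable_of_Icc (μ := volume) hab.le) l
    unfold expInt
    rw [← intervalIntegral.integral_const_mul q, ← intervalIntegral.integral_add (i1.const_mul q) i2,
      ← intervalIntegral.integral_const_mul p]
    refine intervalIntegral.integral_congr fun x _ => ?_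
    simp only
    ring
  unfold oddCoeff
  rw [e, e]; ring

/-- The coefficients of the exact solution satisfy the expected system of equations. -/
theorem coeff_hasDerivAt (h : GPECurve a b T β m V v Bv B ψ D) {t : ℝ} (ht : t ∈ Ioo 0 T) (l : ℤ) :
    HasDerivAt (fun t => oddCoeff a b (ψ t) l) (-Complex.I * (-(1 / 2) * (dsymb a b l ^ 2 *
      oddCoeff a b (ψ t) l) + oddCoeff a b (fun x => nls β (V x) (ψ t x)) l)) t := by
  have ht' := Ioo_subset_Icc_self ht
  have h1 := (((h.expInt_hasDerivAt ht l).sub (h.expInt_hasDerivAt ht (-l))).neg).div_const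
    (2 * ((b : ℂ) - a))
  refine h1.congr_deriv ?_
  rw [← h.coeff_two ht', ← oddCoeff_lin h.lt ((h.rep t ht').cont 2 (by have := h.order; omega))
    (h.nls_continuousOn ht')]
  rfl

/-- The odd series with coefficients `nonlin` takes the values of the nonlinear term on `[a, b]`, so
it has the same odd coefficients. The order `s` is free because the identity is needed before
regularity of order `m` is known. -/
theorem nls_coeff (h : GPECurve a b T β m V v Bv B ψ D) {t : ℝ} (ht : t ∈ Icc 0 T) {s : ℕ}
    (hs : 1 ≤ s) (hsm : s ≤ m) {A : ℝ} (hA : SobLE s (oddCoeff a b (ψ t)) A) (l : ℤ) :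
    oddCoeff a b (fun x => nls β (V x) (ψ t x)) l = nonlin v β (oddCoeff a b (ψ t)) l := by
  have hv := h.pot_sob.weaken hsm
  obtain ⟨C, -, hC⟩ := FamBdd.nonlin (T := 0) (β := β) hs hv
    (c := fun _ => oddCoeff a b (ψ t)) ⟨A, hA.nonneg, fun _ _ => hA⟩
  have hsum : Summable fun k => ‖nonlin v β (oddCoeff a b (ψ t)) k‖ :=
    (hC 0 (by simp)).summable_norm hs
  rw [← integral_fser_mul_osc_freq h.lt hsum (nonlin_odd h.pot_even (oddCoeff_neg _))]
  refine oddCoeff_congr h.lt.le (fun x hx => ?_) l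
  rw [fser_nonlin hs hA hv h.pot_real, h.pot_eq x hx, Complex.ofReal_re,
    ← eq_fser_oddCoeff h.lt (h.cont t ht) (hA.summable_norm hs) hx]

/-- Coefficients controlled by those of a derivative are uniformly in a weighted space. -/
theorem famBdd_of_coeff (h : GPECurve a b T β m V v Bv B ψ D) {s : ℕ} (hs : s ≤ m)
    (hco : ∀ t ∈ Icc 0 T,
      (∀ l, ‖dsymb a b l ^ s * oddCoeff a b (ψ t) l‖ = ‖oddCoeff a b (D t s) l‖) ∨
      ∀ l, ‖dsymb a b l ^ s * oddCoeff a b (ψ t) l‖ = ‖evenCoeff a b (D t s) l‖) :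
    FamBdd T s fun t => oddCoeff a b (ψ t) := by
  have hθ := freqUnit_pos h.lt
  have hB : 0 ≤ B := (l2_nonneg _).trans (h.l2_le 0 (left_mem_Icc.2 h.nonneg) 0 (Nat.zero_le _))
  refine ⟨(2 / freqUnit a b) ^ s * (‖(2 * ((b : ℂ) - a))⁻¹‖ *
    (√(2 * (b - a)) * B + √(2 * (b - a)) * B)), by positivity, fun t ht => ?_⟩
  have hle : ‖(2 * ((b : ℂ) - a))⁻¹‖ * (√(2 * (b - a)) * l2 a b (D t s) +
      √(2 * (b - a)) * l2 a b (D t s)) ≤ ‖(2 * ((b : ℂ) - a))⁻¹‖ *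
      (√(2 * (b - a)) * B + √(2 * (b - a)) * B) := by
    have := h.l2_le t ht s hs
    gcongr
  rcases hco t ht with hc | hc
  · exact SobLE.of_dsymb h.lt ((sobLE_oddCoeff h.lt ((h.rep t ht).memLp s hs)).mono hle)
      (oddCoeff_zero _) hc
  · exact SobLE.of_dsymb h.lt ((sobLE_evenCoeff h.lt ((h.rep t ht).memLp s hs)).mono hle)
      (oddCoeff_zero _) hc

theorem norm_dsymb_pow_mul_le (hab : a < b) {p : ℕ} {c : ℤ → ℂ} {A : ℝ} (hc : SobLE (p + 1) c A)
    (l : ℤ) : ‖dsymb a b l ^ p * c l‖ ≤ freqUnit a b ^ p * A * (wt l)⁻¹ := by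
  have hθ := freqUnit_pos hab
  have hw := wt_pos l
  rw [norm_mul, norm_pow, norm_dsymb hab, mul_pow, ← div_eq_mul_inv, le_div_iff₀ hw]
  calc |(l : ℝ)| ^ p * freqUnit a b ^ p * ‖c l‖ * wt l
      ≤ wt l ^ p * freqUnit a b ^ p * ‖c l‖ * wt l := by
        have := abs_le_wt l
        gcongr
    _ = freqUnit a b ^ p * (wt l ^ (p + 1) * ‖c l‖) := by ring
    _ ≤ _ := by
        have := hc.norm_le l
        gcongr

/-! ### Vanishing of the even derivatives at the end points. -/

theorem tendsto_inv_wt : Tendsto (fun k => (wt k)⁻¹) cofinite (𝓝 0) := by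
  have := (Real.continuous_sqrt.tendsto 0).comp summable_wt_neg_two.tendsto_cofinite_zero
  rw [Real.sqrt_zero] at this
  refine this.congr fun k => ?_
  rw [Function.comp_apply, ← inv_pow, Real.sqrt_sq (inv_nonneg.2 (wt_pos k).le)]

/-- Order `2i + 2` regularity of the coefficients makes their multiples by `dsymb ^ (2i + 1)` tend
to zero at each time as the frequency grows. The equation gives the time derivative of these
multiples, and one integration by parts writes it as a null sequence plus a fixed multiple of the
boundary combination, up to the sign `osc l π`. Along frequencies with constant sign, integration in
time shows that the integral of the boundary term over every `[0, s]` is zero, hence so is the term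
itself. -/
theorem boundary_combination (h : GPECurve a b T β m V v Bv B ψ D) (hT : 0 < T) {i : ℕ}
    (hi : 2 * i + 2 < m)
    (hQ : ∀ t ∈ Icc 0 T, ∀ l, oddCoeff a b (D t (2 * i + 2)) l =
      dsymb a b l ^ (2 * i + 2) * oddCoeff a b (ψ t) l)
    {e : ℂ} {q : ℕ → ℤ} (hq : Tendsto q atTop cofinite) (he : ∀ n, osc (q n) π = e) {t : ℝ}
    (ht : t ∈ Icc 0 T) : e * D t (2 * i + 2) b - D t (2 * i + 2) a = 0 := by
  have hab := h.lt
  have hba : 0 < b - a := sub_pos.2 hab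
  have hbac : ((b : ℂ) - a) ≠ 0 := by exact_mod_cast hba.ne'
  have hθ := freqUnit_pos hab
  have hbn : ‖((b : ℂ) - a)‖ = b - a := by
    rw [← Complex.ofReal_sub, Complex.norm_real, Real.norm_of_nonneg hba.le]
  obtain ⟨A, hA0, hA⟩ := h.famBdd_of_coeff hi.le fun t ht => Or.inl fun l => by rw [hQ t ht l]
  obtain ⟨A', hA'0, hA'⟩ := FamBdd.nonlin (β := β) (by omega) (h.pot_sob.weaken hi.le) ⟨A, hA0, hA⟩
  obtain ⟨C, hC⟩ := h.exists_bound
  let F : ℝ → ℤ → ℂ := fun t l => oddCoeff a b (fun x => nls β (V x) (ψ t x)) l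
  let x : ℤ → ℝ → ℂ := fun l t => dsymb a b l ^ (2 * i + 1) * oddCoeff a b (ψ t) l
  let G : ℤ → ℝ → ℂ := fun l t => -Complex.I * (-(1 / 2) * (dsymb a b l *
    oddCoeff a b (D t (2 * i + 2)) l) + dsymb a b l ^ (2 * i + 1) * F t l)
  have hxc : ∀ l, ContinuousOn (x l) (Icc 0 T) := fun l =>
    continuousOn_const.mul (h.coeff_continuousOn l)
  have hGc : ∀ l, ContinuousOn (G l) (Icc 0 T) := fun l =>
    continuousOn_const.mul ((continuousOn_const.mul (continuousOn_const.mul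
      (h.deriv_coeff_continuousOn hi l))).add (continuousOn_const.mul (h.nls_coeff_continuousOn l)))
  have hxd : ∀ l, ∀ t ∈ Ioo 0 T, HasDerivAt (x l) (G l t) t := fun l t ht => by
    refine ((h.coeff_hasDerivAt ht l).const_mul (dsymb a b l ^ (2 * i + 1))).congr_deriv ?_
    simp only [G, F]
    rw [hQ t (Ioo_subset_Icc_self ht) l]
    ring
  have hftc : ∀ l, ∀ s ∈ Icc 0 T, ∫ t in (0 : ℝ)..s, G l t = x l s - x l 0 := fun l s hs =>
    intervalIntegral.integral_eq_sub_of_hasDerivAt_of_le hs.1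
      ((hxc l).mono (Icc_subset_Icc_right hs.2))
      (fun t ht => hxd l t ⟨ht.1, ht.2.trans_le hs.2⟩)
      (((hGc l).mono (Icc_subset_Icc_right hs.2)).intervalIntegrable_of_Icc hs.1)
  have hw := tendsto_inv_wt.comp hq
  have hwz : ∀ K : ℝ, Tendsto (fun n => K * (wt (q n))⁻¹) atTop (𝓝 0) := fun K => by
    simpa using hw.const_mul K
  have hxz : ∀ s ∈ Icc 0 T, Tendsto (fun n => x (q n) s) atTop (𝓝 0) := fun s hs =>
    squeeze_zero_norm (fun n => norm_dsymb_pow_mul_le hab (hA s hs) (q n)) (hwz _)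
  have hFle : ∀ s ∈ Icc 0 T, ∀ l, ‖dsymb a b l ^ (2 * i + 1) * F s l‖ ≤
      freqUnit a b ^ (2 * i + 1) * A' * (wt l)⁻¹ := fun s hs l => by
    simp only [F]
    rw [h.nls_coeff hs (s := 2 * i + 2) (by omega) hi.le (hA s hs)]
    exact norm_dsymb_pow_mul_le hab (hA' s hs) l
  have hFz : ∀ s ∈ Icc 0 T, Tendsto (fun n => dsymb a b (q n) ^ (2 * i + 1) * F s (q n)) atTop (𝓝 0) :=
    fun s hs => squeeze_zero_norm (fun n => hFle s hs (q n)) (hwz _)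
  -- The limit of `G (q n)`: even coefficients of an `L²` function and the weighted nonlinear
  -- coefficients tend to zero, and only the boundary term survives.
  let J : ℝ → ℂ := fun t => -Complex.I * (-(1 / 2) *
    (0 - (e * D t (2 * i + 2) b - D t (2 * i + 2) a) / ((b : ℂ) - a)) + 0)
  have hGe : ∀ s ∈ Icc 0 T, ∀ n, G (q n) s = -Complex.I * (-(1 / 2) *
      (evenCoeff a b (D s (2 * i + 2 + 1)) (q n) -
        (e * D s (2 * i + 2) b - D s (2 * i + 2) a) / ((b : ℂ) - a)) +
      dsymb a b (q n) ^ (2 * i + 1) * F s (q n)) := fun s hs n => by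
    simp only [G]
    rw [(h.rep s hs).dsymb_mul_oddCoeff hab hi, he n]
  have hlim : ∀ s ∈ Icc 0 T, Tendsto (fun n => G (q n) s) atTop (𝓝 (J s)) := fun s hs => by
    refine Tendsto.congr (fun n => (hGe s hs n).symm) ?_
    exact (((((tendsto_evenCoeff hab ((h.rep s hs).memLp _ hi)).comp hq).sub_const _).const_mul
      _).add (hFz s hs)).const_mul _
  have hJc : ContinuousOn J (Icc 0 T) := by
    have h1 := h.curve.continuousOn_deriv hab h.rep hi (right_mem_Icc.2 hab.le)
    have h2 := h.curve.continuousOn_deriv hab h.rep hi (left_mem_Icc.2 hab.le)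
    exact continuousOn_const.mul ((continuousOn_const.mul (continuousOn_const.sub
      (((continuousOn_const.mul h1).sub h2).div_const _))).add continuousOn_const)
  have hJ0 : ∀ s ∈ Icc 0 T, ∫ t in (0 : ℝ)..s, J t = 0 := fun s hs => by
    have hl1 : Tendsto (fun n => ∫ t in (0 : ℝ)..s, G (q n) t) atTop (𝓝 (∫ t in (0 : ℝ)..s, J t)) := by
      refine intervalIntegral.tendsto_integral_filter_of_dominated_convergence
        (fun _ => 1 / 2 * (√(b - a) * B / (b - a) + (C + C) / (b - a)) +
          freqUnit a b ^ (2 * i + 1) * A') (Eventually.of_forall fun n => ?_)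
        (Eventually.of_forall fun n => Eventually.of_forall fun t htm => ?_) intervalIntegrable_const
        (Eventually.of_forall fun t htm => ?_)
      · rw [uIoc_of_le hs.1]
        exact ((hGc (q n)).mono fun t ht => ⟨ht.1.le, ht.2.trans hs.2⟩).aestronglyMeasurable
          measurableSet_Ioc
      · rw [uIoc_of_le hs.1] at htm
        have ht' : t ∈ Icc 0 T := ⟨htm.1.le, htm.2.trans hs.2⟩
        rw [hGe t ht' n, norm_mul, norm_neg, Complex.norm_I, one_mul]
        refine (norm_add_le _ _).trans (add_le_add ?_ ?_)
        · rw [norm_mul, show ‖(-(1 / 2) : ℂ)‖ = 1 / 2 by norm_num]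
          refine mul_le_mul_of_nonneg_left ((norm_sub_le _ _).trans (add_le_add ?_ ?_)) (by norm_num)
          · refine (norm_evenCoeff_le hab ((h.rep t ht').memLp _ hi) _).trans ?_
            have := h.l2_le t ht' _ hi
            gcongr
          · rw [norm_div, hbn, ← he n]
            have h1 := hC t ht' _ hi b (right_mem_Icc.2 hab.le)
            have h2 := hC t ht' _ hi a (left_mem_Icc.2 hab.le)
            have h3 := norm_sub_le (osc (q n) π * D t (2 * i + 2) b) (D t (2 * i + 2) a)
            rw [norm_mul, norm_osc, one_mul] at h3
            gcongr
            linarith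
        · refine (hFle t ht' (q n)).trans (mul_le_of_le_one_right (by positivity) ?_)
          exact inv_le_one_of_one_le₀ (one_le_wt _)
      · rw [uIoc_of_le hs.1] at htm
        exact hlim t ⟨htm.1.le, htm.2.trans hs.2⟩
    have hl2 := (hxz s hs).sub (hxz 0 (left_mem_Icc.2 h.nonneg))
    rw [sub_zero] at hl2
    exact tendsto_nhds_unique (hl1.congr fun n => hftc (q n) s hs) hl2
  have hfin := eq_zero_of_integral_eq_zero hT hJc hJ0 ht
  simp only [J] at hfin
  field_simp at hfin
  simpa using hfin

theorem osc_two_mul_pi (k : ℤ) : osc (2 * k) π = 1 := by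
  rw [← osc_two_pi k]
  unfold osc
  congr 2
  push_cast; ring

theorem osc_one_pi : osc 1 π = -1 := by
  unfold osc
  simp

/-- Even frequencies annihilate the difference of the two boundary values, odd frequencies their
sum. -/
theorem boundary_zero (h : GPECurve a b T β m V v Bv B ψ D) (hT : 0 < T) {i : ℕ}
    (hi : 2 * i + 2 < m)
    (hQ : ∀ t ∈ Icc 0 T, ∀ l, oddCoeff a b (D t (2 * i + 2)) l =
      dsymb a b l ^ (2 * i + 2) * oddCoeff a b (ψ t) l) {t : ℝ} (ht : t ∈ Icc 0 T) :
    D t (2 * i + 2) a = 0 ∧ D t (2 * i + 2) b = 0 := by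
  have hq : ∀ r : ℤ, Tendsto (fun n : ℕ => 2 * (n : ℤ) + r) atTop cofinite := fun r => by
    rw [← Nat.cofinite_eq_atTop]
    refine Function.Injective.tendsto_cofinite fun p q hpq => ?_
    have hpq' : 2 * (p : ℤ) + r = 2 * (q : ℤ) + r := hpq
    omega
  have h1 := h.boundary_combination hT hi hQ (e := 1) (hq 0) (fun n => by
    rw [add_zero, osc_two_mul_pi]) ht
  have h2 := h.boundary_combination hT hi hQ (e := -1) (hq 1) (fun n => by
    rw [osc_add_left, osc_two_mul_pi, osc_one_pi, one_mul]) ht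
  have h3 : D t (2 * i + 2) a = 0 := by linear_combination -(1 / 2) * h1 - (1 / 2) * h2
  exact ⟨h3, by rw [h3] at h1; linear_combination h1⟩

/-- An alternating induction: the coefficient formula at one even order yields vanishing boundary
values there, and these permit two more integrations by parts. -/
theorem even_coeff (h : GPECurve a b T β m V v Bv B ψ D) (hT : 0 < T) (j : ℕ) :
    2 * j ≤ m → ∀ t ∈ Icc 0 T, ∀ l, oddCoeff a b (D t (2 * j)) l =
      dsymb a b l ^ (2 * j) * oddCoeff a b (ψ t) l := by
  induction j with
  | zero => intro _ t ht l; rw [mul_zero, pow_zero, one_mul, h.coeff_eq ht]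
  | succ j ih =>
    intro hj t ht l
    rcases j with _ | i
    · exact h.coeff_two ht l
    · have hQ := ih (by omega)
      obtain ⟨ha, hb⟩ := h.boundary_zero hT (i := i) (by omega) hQ ht
      have := (h.rep t ht).oddCoeff_add_two h.lt (k := 2 * i + 2) (by omega) ha hb l
      rw [show 2 * (i + 1 + 1) = 2 * i + 2 + 2 by ring, this]
      have hq := hQ t ht l
      rw [show 2 * (i + 1) = 2 * i + 2 by ring] at hq
      rw [hq]; ring

/-- The coefficients of the exact solution are bounded in the weighted space of order `m`. -/
theorem famBdd (h : GPECurve a b T β m V v Bv B ψ D) (hT : 0 < T) :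
    FamBdd T m fun t => oddCoeff a b (ψ t) := by
  -- For even `m` the odd coefficients of the top derivative carry the weight. For odd `m` one more
  -- integration by parts from order `m - 1`, where the boundary values vanish, leads to the even
  -- coefficients.
  rcases Nat.even_or_odd' m with ⟨j, hj | hj⟩
  · refine h.famBdd_of_coeff le_rfl fun t ht => Or.inl fun l => ?_
    rw [hj, h.even_coeff hT j (by omega) t ht]
  · refine h.famBdd_of_coeff le_rfl fun t ht => Or.inr fun l => ?_
    obtain ⟨i, rfl⟩ : ∃ i, j = i + 1 := ⟨j - 1, by have := h.order; omega⟩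
    have hQ := h.even_coeff hT (i + 1) (by omega)
    obtain ⟨ha, hb⟩ := h.boundary_zero hT (i := i) (by omega) hQ ht
    have h1 := (h.rep t ht).dsymb_mul_oddCoeff h.lt (k := 2 * i + 2) (by omega) l
    rw [ha, hb, mul_zero, sub_zero, zero_div, sub_zero] at h1
    rw [show m = 2 * i + 2 + 1 by omega, ← h1]
    have hq := hQ t ht l
    rw [show 2 * (i + 1) = 2 * i + 2 by ring] at hq
    rw [hq, pow_succ]
    congr 1
    ring

end GPECurve

/-! ### The sine pseudospectral method in terms of Fourier coefficients -/

section grid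

theorem sum_Ioo_zero_succ {E : Type*} [AddCommMonoid E] (f : ℕ → E) (p : ℕ) :
    ∑ l ∈ Finset.Ioo 0 (p + 1), f l = ∑ i ∈ Finset.range p, f (i + 1) := by
  have : Finset.Ioo 0 (p + 1) = Finset.Ico (0 + 1) (p + 1) := by
    ext x; simp only [Finset.mem_Ioo, Finset.mem_Ico]; omega
  rw [this, ← Finset.sum_Ico_add' f 0 p 1, Finset.range_eq_Ico]

theorem sum_Ioo_neg {E : Type*} [AddCommGroup E] (f : ℤ → E) {M : ℕ} (hM : 0 < M) :
    ∑ k ∈ Finset.Ioo (-(M : ℤ)) M, f k = f 0 + ∑ l ∈ Finset.Ioo 0 M, (f (l : ℤ) + f (-(l : ℤ))) := by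
  obtain ⟨p, rfl⟩ : ∃ p, M = p + 1 := ⟨M - 1, by omega⟩
  rw [sum_Ioo_zero_succ (fun l => f (l : ℤ) + f (-(l : ℤ)))]
  clear hM
  induction p with
  | zero =>
    have : Finset.Ioo (-((0 + 1 : ℕ) : ℤ)) ((0 + 1 : ℕ) : ℤ) = {0} := by
      ext x; simp only [Finset.mem_Ioo, Finset.mem_singleton]; omega
    rw [this]; simp
  | succ p ih =>
    have : Finset.Ioo (-((p + 1 + 1 : ℕ) : ℤ)) ((p + 1 + 1 : ℕ) : ℤ) = insert ((p + 1 : ℕ) : ℤ)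
        (insert (-((p + 1 : ℕ) : ℤ)) (Finset.Ioo (-((p + 1 : ℕ) : ℤ)) ((p + 1 : ℕ) : ℤ))) := by
      ext x; simp only [Finset.mem_Ioo, Finset.mem_insert]; omega
    rw [this, Finset.sum_insert, Finset.sum_insert, ih, Finset.sum_range_succ]
    · abel
    · simp
    · simp only [Finset.mem_insert, Finset.mem_Ioo]; omega

theorem sum_range_two_mul {E : Type*} [AddCommGroup E] (f : ℕ → E) {M : ℕ} (hM : 0 < M) :
    ∑ j ∈ Finset.range (2 * M), f j =
      f 0 + f M + ∑ j ∈ Finset.Ioo 0 M, (f j + f (2 * M - j)) := by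
  obtain ⟨p, rfl⟩ : ∃ p, M = p + 1 := ⟨M - 1, by omega⟩
  rw [sum_Ioo_zero_succ (fun j => f j + f (2 * (p + 1) - j)), two_mul, Finset.sum_range_add,
    Finset.sum_range_succ', Finset.sum_range_succ' (fun x => f (p + 1 + x)), Finset.sum_add_distrib,
    ← Finset.sum_range_reflect (fun x => f (p + 1 + (x + 1)))]
  have : ∑ j ∈ Finset.range p, f (p + 1 + (p - 1 - j + 1)) =
      ∑ i ∈ Finset.range p, f (p + 1 + (p + 1) - (i + 1)) := by
    refine Finset.sum_congr rfl fun j hj => ?_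
    have := Finset.mem_range.1 hj
    congr 1; omega
  rw [this, add_zero]
  abel

theorem osc_sub_osc_neg (k : ℤ) (y : ℝ) :
    osc k y - osc (-k) y = 2 * Complex.I * ((sin (k * y) : ℝ) : ℂ) := by
  rw [Complex.ofReal_sin, Complex.sin]
  unfold osc
  push_cast
  field_simp
  rw [Complex.I_sq]
  ring_nf

theorem fser_trunc_of_odd {M : ℕ} (hM : 0 < M) {c : ℤ → ℂ} (hc : ∀ k, c (-k) = -c k) (y : ℝ) :
    fser (trunc M c) y = ∑ l ∈ Finset.Ioo 0 M, 2 * Complex.I * c l * ((sin (l * y) : ℝ) : ℂ) := by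
  have h0 : c 0 = 0 := by
    have := hc 0
    rw [neg_zero] at this
    exact self_eq_neg.1 this
  rw [fser_trunc, sum_Ioo_neg _ hM, h0, zero_mul, zero_add]
  refine Finset.sum_congr rfl fun l _ => ?_
  have := osc_sub_osc_neg l y
  rw [hc]
  push_cast at this ⊢
  linear_combination c l * this

/-- The discrete Fourier coefficients determined by the discrete sine transform. -/
noncomputable def gridCoeff (M : ℕ) (v : Fin (M + 1) → ℂ) (k : ℤ) : ℂ :=
  2 / (M : ℂ) * (∑ j ∈ Finset.Ioo (0 : Fin (M + 1)) (Fin.last M),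
    v j * ((sin (k * ((j : ℕ) * gstep M)) : ℝ) : ℂ)) / (2 * Complex.I)

theorem gridCoeff_neg (M : ℕ) (v : Fin (M + 1) → ℂ) (k : ℤ) :
    gridCoeff M v (-k) = -gridCoeff M v k := by
  unfold gridCoeff
  push_cast
  simp only [neg_mul, Complex.sin_neg, mul_neg, Finset.sum_neg_distrib, neg_div]

theorem dst_eq_gridCoeff (M : ℕ) (v : Fin (M + 1) → ℂ) (l : ℕ) :
    dst M v l = 2 * Complex.I * gridCoeff M v l := by
  have hI : (2 * Complex.I) ≠ 0 := mul_ne_zero two_ne_zero Complex.I_ne_zero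
  unfold gridCoeff
  rw [mul_div_cancel₀ _ hI, dst]
  congr 1
  refine Finset.sum_congr rfl fun j _ => ?_
  congr 3
  unfold gstep
  push_cast
  ring

/-- An odd periodic function vanishes at `0` and `π`, and the remaining grid points pair up as `j`
and `2M - j`. Each pair turns two oscillations into a sine, so the sine transform on half the circle
is the discrete Fourier transform on all of it. -/
theorem gridCoeff_eq_dft {M : ℕ} (hM : 0 < M) {v : Fin (M + 1) → ℂ} {g : ℝ → ℂ}
    (hodd : ∀ y, g (-y) = -g y) (hper : ∀ y, g (y + 2 * π) = g y)
    (hv : ∀ j, v j = g ((j : ℕ) * gstep M)) (k : ℤ) : gridCoeff M v k = dft M g k := by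
  have hMc : (M : ℂ) ≠ 0 := by exact_mod_cast hM.ne'
  have hMr : (M : ℝ) ≠ 0 := by exact_mod_cast hM.ne'
  have hself : ∀ z : ℂ, z = -z → z = 0 := fun z h => self_eq_neg.1 h
  have h0 : g 0 = 0 := hself _ (by simpa using hodd 0)
  have hpi : g π = 0 := hself _ (by
    rw [← hodd, ← hper (-π)]; congr 1; ring)
  have hMpi : (M : ℝ) * gstep M = π := by unfold gstep; field_simp
  have hfin : ∑ j ∈ Finset.Ioo (0 : Fin (M + 1)) (Fin.last M),
      v j * ((sin (k * ((j : ℕ) * gstep M)) : ℝ) : ℂ) =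
      ∑ j ∈ Finset.Ioo 0 M, g (j * gstep M) * ((sin (k * (j * gstep M)) : ℝ) : ℂ) := by
    have h1 : (Finset.Ioo (0 : Fin (M + 1)) (Fin.last M)).map Fin.valEmbedding = Finset.Ioo 0 M := by
      rw [Fin.map_valEmbedding_Ioo]; simp
    rw [← h1, Finset.sum_map]
    exact Finset.sum_congr rfl fun j _ => by rw [hv]; rfl
  unfold gridCoeff dft
  rw [hfin, sum_range_two_mul _ hM, Nat.cast_zero, zero_mul, h0, hMpi, hpi, zero_mul, zero_mul,
    add_zero, zero_add]
  have hterm : ∀ j ∈ Finset.Ioo 0 M, g (j * gstep M) * osc (-k) (j * gstep M) +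
      g ((2 * M - j : ℕ) * gstep M) * osc (-k) ((2 * M - j : ℕ) * gstep M) =
      -(2 * Complex.I) * (g (j * gstep M) * ((sin (k * (j * gstep M)) : ℝ) : ℂ)) := fun j hj => by
    have hj' := (Finset.mem_Ioo.1 hj).2
    have e : ((2 * M - j : ℕ) : ℝ) * gstep M = -(j * gstep M) + 2 * π := by
      rw [Nat.cast_sub (by omega)]
      push_cast
      linear_combination 2 * hMpi
    have e2 : osc (-k) (-(j * gstep M) + 2 * π) = osc k (j * gstep M) := by
      rw [osc_add_right, osc_two_pi, mul_one, osc_neg_left, neg_neg]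
    rw [e, hper, hodd, e2]
    linear_combination -g (j * gstep M) * osc_sub_osc_neg k (j * gstep M)
  rw [Finset.sum_congr rfl hterm, ← Finset.mul_sum]
  have hI : Complex.I ≠ 0 := Complex.I_ne_zero
  generalize ∑ j ∈ Finset.Ioo 0 M, g (j * gstep M) * ((sin (k * (j * gstep M)) : ℝ) : ℂ) = S
  field_simp
  rw [Complex.I_sq]
  ring

end grid

section scheme

variable {a b : ℝ} {M : ℕ}

theorem freqUnit_mul_gridPt (hab : a < b) (M : ℕ) (j : Fin (M + 1)) :
    freqUnit a b * (gridPt a b M j - a) = (j : ℕ) * gstep M := by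
  have : b - a ≠ 0 := (sub_pos.2 hab).ne'
  unfold freqUnit gridPt mesh gstep
  field_simp
  ring

theorem gridPt_mem (hab : a < b) (hM : 0 < M) (j : Fin (M + 1)) : gridPt a b M j ∈ Icc a b := by
  have hj : ((j : ℕ) : ℝ) ≤ M := by exact_mod_cast Nat.lt_succ_iff.1 j.2
  have hMr : (0 : ℝ) < M := by exact_mod_cast hM
  have hba : 0 < b - a := sub_pos.2 hab
  unfold gridPt mesh
  constructor
  · have : 0 ≤ (j : ℕ) * ((b - a) / M) := by positivity
    linarith
  · have : (j : ℕ) * ((b - a) / M) ≤ M * ((b - a) / M) := by gcongr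
    rw [mul_div_cancel₀ _ hMr.ne'] at this
    linarith

theorem freq_mul_sub (l : ℕ) (x : ℝ) : freq a b l * (x - a) = l * (freqUnit a b * (x - a)) := by
  unfold freq freqUnit; ring

theorem sineInterp_eq (hM : 0 < M) (v : Fin (M + 1) → ℂ) (x : ℝ) :
    sineInterp a b M v x = fser (trunc M (gridCoeff M v)) (freqUnit a b * (x - a)) := by
  rw [fser_trunc_of_odd hM (gridCoeff_neg M v)]
  unfold sineInterp
  refine Finset.sum_congr rfl fun l _ => ?_
  rw [dst_eq_gridCoeff, freq_mul_sub]

theorem phase_gridCoeff_odd (κ r : ℝ) (v : Fin (M + 1) → ℂ) (k : ℤ) :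
    phase κ r (-k) * gridCoeff M v (-k) = -(phase κ r k * gridCoeff M v k) := by
  rw [phase_index_neg, gridCoeff_neg, mul_neg]

theorem kineticHalfStep_eq (hab : a < b) (hM : 0 < M) (τ : ℝ) (v : Fin (M + 1) → ℂ) (j : Fin (M + 1)) :
    kineticHalfStep a b M τ v j = fser (trunc M fun k =>
      phase (freqUnit a b ^ 2 / 2) (-(τ / 2)) k * gridCoeff M v k) ((j : ℕ) * gstep M) := by
  rw [fser_trunc_of_odd hM (phase_gridCoeff_odd _ _ v)]
  unfold kineticHalfStep
  refine Finset.sum_congr rfl fun l _ => ?_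
  rw [dst_eq_gridCoeff, freq_mul_sub, freqUnit_mul_gridPt hab]
  have : Complex.exp (-Complex.I * τ * (freq a b l : ℂ) ^ 2 / 4) =
      phase (freqUnit a b ^ 2 / 2) (-(τ / 2)) l := by
    unfold phase freq freqUnit
    congr 1
    push_cast
    ring
  rw [this]
  push_cast
  ring

theorem nstep_neg (β s V : ℝ) (z : ℂ) : nstep β s V (-z) = -nstep β s V z := by
  simp [nstep]

/-- One step of the scheme in terms of Fourier coefficients. -/
theorem gridCoeff_step (hab : a < b) (hM : 0 < M) {V : ℝ → ℝ} {v : ℤ → ℂ} {β : ℝ}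
    (hv : ∀ k, v (-k) = v k) (hV : ∀ x ∈ Icc a b, fser v (freqUnit a b * (x - a)) = V x) (τ : ℝ)
    (w : Fin (M + 1) → ℂ) :
    (∀ j, kineticHalfStep a b M τ (potentialStep a b V β M τ (kineticHalfStep a b M τ w)) j =
      fser (numStep (freqUnit a b ^ 2 / 2) β v M τ (trunc M (gridCoeff M w))) ((j : ℕ) * gstep M)) ∧
    trunc M (gridCoeff M (kineticHalfStep a b M τ (potentialStep a b V β M τ
      (kineticHalfStep a b M τ w)))) =
      numStep (freqUnit a b ^ 2 / 2) β v M τ (trunc M (gridCoeff M w)) := by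
  set κ := freqUnit a b ^ 2 / 2
  set p : ℤ → ℂ := fun k => phase κ (-(τ / 2)) k * gridCoeff M w k with hp
  have hptr : (fun k => phase κ (-(τ / 2)) k * trunc M (gridCoeff M w) k) = trunc M p :=
    funext fun k => (trunc_mul M _ _ k).symm
  let g : ℝ → ℂ := fun y => nstep β τ (fser v y).re (fser (trunc M p) y)
  have htodd : ∀ {c : ℤ → ℂ}, (∀ k, c (-k) = -c k) → ∀ k, trunc M c (-k) = -trunc M c k :=
    fun hc k => by unfold trunc; rw [abs_neg, hc]; split_ifs <;> simp
  have hgodd : ∀ y, g (-y) = -g y := fun y => by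
    simp only [g]
    rw [fser_neg_of_even hv, fser_neg_of_odd (htodd (phase_gridCoeff_odd _ _ w)), nstep_neg]
  have hgper : ∀ y, g (y + 2 * π) = g y := fun y => by simp only [g, fser_add_two_pi]
  have hpot : ∀ j, potentialStep a b V β M τ (kineticHalfStep a b M τ w) j = g ((j : ℕ) * gstep M) :=
    fun j => by
      have h1 := hV _ (gridPt_mem hab hM j)
      rw [freqUnit_mul_gridPt hab] at h1
      simp only [g, h1, Complex.ofReal_re]
      unfold potentialStep nstep
      rw [kineticHalfStep_eq hab hM]
  have hdft := gridCoeff_eq_dft hM hgodd hgper hpot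
  have hnum : numStep κ β v M τ (trunc M (gridCoeff M w)) =
      trunc M fun k => phase κ (-(τ / 2)) k * dft M g k := by
    funext k
    unfold numStep
    rw [hptr, trunc_mul]
  have hq : ∀ j, kineticHalfStep a b M τ (potentialStep a b V β M τ (kineticHalfStep a b M τ w)) j =
      fser (numStep κ β v M τ (trunc M (gridCoeff M w))) ((j : ℕ) * gstep M) := fun j => by
    rw [kineticHalfStep_eq hab hM, hnum]
    simp_rw [hdft]
    rfl
  refine ⟨hq, ?_⟩
  have hodd' : ∀ k, phase κ (-(τ / 2)) (-k) * dft M g (-k) = -(phase κ (-(τ / 2)) k * dft M g k) :=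
    fun k => by rw [← hdft, ← hdft]; exact phase_gridCoeff_odd _ _ _ k
  have h2 := gridCoeff_eq_dft hM (v := kineticHalfStep a b M τ (potentialStep a b V β M τ
      (kineticHalfStep a b M τ w)))
    (fser_neg_of_odd (htodd (c := fun k => phase κ (-(τ / 2)) k * dft M g k) hodd')) fser_add_two_pi
    (fun j => by rw [hq j, hnum])
  rw [show gridCoeff M (kineticHalfStep a b M τ (potentialStep a b V β M τ
    (kineticHalfStep a b M τ w))) = _ from funext h2, dft_fser_trunc hM, hnum]

end scheme

/-! ### Norms of Fourier sums on the interval -/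

section norms

variable {a b : ℝ} {e : ℤ → ℂ} {B B' : ℝ}

theorem SobLE.tsum_sq_le (h : SobLE 0 e B) : ∑' k, ‖e k‖ ^ 2 ≤ B ^ 2 := by
  refine Real.tsum_le_of_sum_le (fun _ => by positivity) fun S => ?_
  simpa using h.sum_le S

/-- The integral over half a period is at most the one over the full period, to which Parseval's
identity applies. The order 1 bound only ensures convergence; the order 0 bound gives the constant.
-/
theorem normL2_fser_le (hab : a < b) (h1 : SobLE 1 e B') (h0 : SobLE 0 e B) {u : ℝ → ℂ}
    (hu : ∀ x ∈ Icc a b, u x = fser e (freqUnit a b * (x - a))) :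
    normL2 a b u ≤ ENNReal.ofReal (√(2 * (b - a)) * B) := by
  have hθ := freqUnit_pos hab
  have hba : 0 < b - a := sub_pos.2 hab
  have hs := h1.summable_norm le_rfl
  have hcf := continuous_fser hs
  have hcu : ContinuousOn u (Icc a b) :=
    ContinuousOn.congr (hcf.comp (by fun_prop : Continuous fun x => freqUnit a b * (x - a))).continuousOn hu
  have hL := ContinuousOn.memLp_two hcu
  have e1 : l2 a b u ^ 2 = (freqUnit a b)⁻¹ * ∫ y in (0 : ℝ)..π, ‖fser e y‖ ^ 2 := by
    have := intervalIntegral.integral_comp_mul_sub (a := a) (b := b)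
      (fun y => ‖fser e y‖ ^ 2) hθ.ne' (freqUnit a b * a)
    rw [sub_self, ← mul_sub, freqUnit_mul hab, smul_eq_mul] at this
    rw [← this, ← sq_l2_eq hL, intervalIntegral.integral_of_le hab.le, integral_Ioc_eq_integral_Ioo]
    refine setIntegral_congr_fun measurableSet_Ioo fun x hx => ?_
    simp only [hu x (Ioo_subset_Icc_self hx), mul_sub]
  have hi : ∀ p q : ℝ, IntervalIntegrable (fun y => ‖fser e y‖ ^ 2) volume p q := fun p q =>
    (hcf.norm.pow 2).intervalIntegrable _ _
  have e2 : ∫ y in (0 : ℝ)..π, ‖fser e y‖ ^ 2 ≤ 2 * π * B ^ 2 := by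
    have h3 := h1.integral_norm_fser_sq
    rw [← intervalIntegral.integral_add_adjacent_intervals (hi (-π) 0) (hi 0 π)] at h3
    have h4 : 0 ≤ ∫ y in (-π)..0, ‖fser e y‖ ^ 2 :=
      intervalIntegral.integral_nonneg (by linarith [pi_pos]) fun _ _ => by positivity
    have h5 : 2 * π * ∑' k, ‖e k‖ ^ 2 ≤ 2 * π * B ^ 2 :=
      mul_le_mul_of_nonneg_left h0.tsum_sq_le (by positivity)
    linarith
  have e3 : l2 a b u ≤ √(2 * (b - a)) * B := by
    refine le_of_sq_le_sq ?_ (mul_nonneg (Real.sqrt_nonneg _) h0.nonneg)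
    rw [e1, mul_pow, Real.sq_sqrt (by positivity)]
    calc _ ≤ (freqUnit a b)⁻¹ * (2 * π * B ^ 2) := by gcongr
      _ = _ := by rw [← freqUnit_mul hab]; field_simp
  unfold l2 at e3
  rw [← ENNReal.ofReal_toReal (show normL2 a b u ≠ ⊤ from hL.2.ne)]
  exact ENNReal.ofReal_le_ofReal e3

/-- The termwise derivative is a weak derivative. The order 2 bound serves only to justify this and
does not enter the estimate. -/
theorem semiH_one_fser_le (hab : a < b) (h2 : SobLE 2 e B') (h1 : SobLE 1 e B) {u : ℝ → ℂ}
    (hu : ∀ x ∈ Icc a b, u x = fser e (freqUnit a b * (x - a))) :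
    semiH a b 1 u ≤ ENNReal.ofReal (√(2 * (b - a)) * (freqUnit a b * B)) := by
  have hθ := freqUnit_pos hab
  have hcf := continuous_fser (h2.summable_norm (by norm_num))
  have hcu : ContinuousOn u (Icc a b) :=
    ContinuousOn.congr (hcf.comp (by fun_prop : Continuous fun x => freqUnit a b * (x - a))).continuousOn hu
  have hz : ∀ k, ‖dsymb a b k‖ ≤ freqUnit a b * wt k ^ 1 := fun k => by
    rw [norm_dsymb hab, mul_comm, pow_one]
    exact mul_le_mul_of_nonneg_left (abs_le_wt k) hθ.le
  have hd1 : SobLE 1 (fun k => dsymb a b k * e k) (freqUnit a b * B') := 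
    SobLE.mul_multiplier (s := 1) (r := 1) (c := e) (z := dsymb a b) h2 hθ.le hz
  have hd0 : SobLE 0 (fun k => dsymb a b k * e k) (freqUnit a b * B) :=
    SobLE.mul_multiplier (s := 0) (r := 1) (c := e) (z := dsymb a b) h1 hθ.le hz
  have hcg : Continuous fun x => fser (fun k => dsymb a b k * e k) (freqUnit a b * (x - a)) :=
    (continuous_fser (hd1.summable_norm le_rfl)).comp (by fun_prop)
  have hw : HasWeakDeriv a b 1 u
      fun x => fser (fun k => dsymb a b k * e k) (freqUnit a b * (x - a)) := by
    refine hasWeakDeriv_one_of_hasDerivAt hab hcu hcg.continuousOn fun x hx => ?_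
    rw [integral_fser_freq hab (SobLE.summable_wt (r := 1) h2), hu x hx, hu a (left_mem_Icc.2 hab.le), sub_self, mul_zero]
    ring
  exact (iInf₂_le _ hw).trans (normL2_fser_le hab hd1 hd0 fun _ _ => rfl)

theorem exists_sobLE_trunc (s M : ℕ) (x : ℤ → ℂ) : ∃ B, SobLE s (trunc M x) B := by
  refine ⟨√(∑ k ∈ Finset.Ioo (-(M : ℤ)) M, (wt k ^ s * ‖x k‖) ^ 2),
    SobLE.of_sum (Real.sqrt_nonneg _) fun S => ?_⟩
  rw [Real.sq_sqrt (Finset.sum_nonneg fun _ _ => by positivity)]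
  have h1 : ∑ k ∈ S, (wt k ^ s * ‖trunc M x k‖) ^ 2 =
      ∑ k ∈ S with |k| < (M : ℤ), (wt k ^ s * ‖x k‖) ^ 2 := by
    rw [Finset.sum_filter]
    refine Finset.sum_congr rfl fun k _ => ?_
    unfold trunc
    split_ifs <;> simp
  rw [h1]
  refine Finset.sum_le_sum_of_subset_of_nonneg (fun k hk => ?_) fun _ _ _ => by positivity
  exact Finset.mem_Ioo.2 (abs_lt.1 (Finset.mem_filter.1 hk).2)

/-- Only frequencies with `wt k ≥ M` remain, so each of the `m - i` unused derivatives yields a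
factor `1/M`. -/
theorem SobLE.sub_trunc {m i : ℕ} (h : SobLE m e B) (hi : i ≤ m) {M : ℕ} (hM : 0 < M) :
    SobLE i (fun k => e k - _root_.trunc M e k) ((M : ℝ) ^ i / M ^ m * B) := by
  have hMr : (0 : ℝ) < M := by exact_mod_cast hM
  refine h.of_le (by positivity) fun k => ?_
  have hw := wt_pos k
  unfold _root_.trunc
  split_ifs with hk
  · rw [sub_self, norm_zero, mul_zero]; positivity
  · have hMw : (M : ℝ) ≤ wt k := by
      have h1 : (M : ℤ) ≤ |k| := not_lt.1 hk
      have h2 : (M : ℝ) ≤ |(k : ℝ)| := by exact_mod_cast h1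
      exact h2.trans (abs_le_wt k)
    rw [sub_zero, ← mul_assoc]
    refine mul_le_mul_of_nonneg_right ?_ (norm_nonneg _)
    rw [div_mul_eq_mul_div, le_div_iff₀ (by positivity)]
    obtain ⟨p, rfl⟩ : ∃ p, m = i + p := ⟨m - i, by omega⟩
    calc wt k ^ i * (M : ℝ) ^ (i + p) = wt k ^ i * (M : ℝ) ^ i * (M : ℝ) ^ p := by ring
      _ ≤ wt k ^ i * (M : ℝ) ^ i * wt k ^ p := by gcongr
      _ = _ := by ring

end norms

/-! ### Convergence of the scheme -/

section main

variable {a b T β : ℝ} {m : ℕ} {V : ℝ → ℝ} {v : ℤ → ℂ} {Bv B : ℝ} {ψ₀ : ℝ → ℂ} {ψ : ℝ → ℝ → ℂ}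
  {D : ℝ → ℕ → ℝ → ℂ}

theorem exists_gpeCurve (hab : a < b) (hT : 0 ≤ T) (hm : 3 ≤ m) (hVc : ContinuousOn V (Icc a b))
    (hV : MemH a b m (fun x => (V x : ℂ)))
    (hV' : ∃ W : ℝ → ℂ, HasWeakDeriv a b 1 (fun x => (V x : ℂ)) W ∧ MemHsin a b (m - 1) W)
    (hψc : ∀ t ∈ Icc 0 T, ContinuousOn (ψ t) (Icc a b)) (hψ : ContTimeH a b T m ψ)
    (hsol : IsGPESolution a b T V β ψ₀ ψ) : ∃ v Bv B D, GPECurve a b T β m V v Bv B ψ D := by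
  obtain ⟨v, Bv, hv, hvr, hve, hvV⟩ := exists_potential_coeff hab (by omega) hVc hV hV'
  choose! D hD using fun t (ht : t ∈ Icc 0 T) =>
    MemH.exists_sobRep hab (show 1 ≤ m by omega) (hψ.1 t ht).1 (hψc t ht)
  obtain ⟨B, -, hB⟩ := hψ.exists_l2_le hab hD
  refine ⟨v, Bv, B, D, hab, hT, hm, hψc, hψ, hD, hB, fun t ht => (hsol.2.2 t ht).1,
    fun t ht => (hsol.2.2 t ht).2, hVc, hv, hvr, hve, hvV, fun t ht x hx => ?_⟩
  obtain ⟨hd, he⟩ := hsol.1 t ht x hx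
  refine hd.hasDerivAt.congr_deriv ?_
  rw [(hD t (Ioo_subset_Icc_self ht)).iteratedDeriv_two hab hm hx] at he
  have e : deriv (fun s => ψ s x) t = -Complex.I * (Complex.I * deriv (fun s => ψ s x) t) := by
    rw [← mul_assoc, neg_mul, Complex.I_mul_I, neg_neg, one_mul]
  rw [e, he]
  unfold nls
  push_cast
  ring

theorem gridCoeff_initial (h : GPECurve a b T β m V v Bv B ψ D) (hs : Summable fun k =>
    ‖oddCoeff a b (ψ 0) k‖) (h0 : ∀ x ∈ Icc a b, ψ 0 x = ψ₀ x) {M : ℕ} (hM : 0 < M) (τ : ℝ) :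
    trunc M (gridCoeff M (tssp a b V β ψ₀ M τ 0)) =
      trunc M (dft M (fser (oddCoeff a b (ψ 0)))) := by
  congr 1
  funext k
  refine gridCoeff_eq_dft hM (fser_neg_of_odd (oddCoeff_neg _)) fser_add_two_pi (fun j => ?_) k
  have hj := gridPt_mem h.lt hM j
  rw [← freqUnit_mul_gridPt h.lt, ← eq_fser_oddCoeff h.lt (h.cont 0 (left_mem_Icc.2 h.nonneg)) hs hj,
    h0 _ hj]
  rfl

/-- The total error of the scheme in the weighted sequence spaces. -/
theorem exists_coeff_error (h : GPECurve a b T β m V v Bv B ψ D) (hT : 0 < T) (hm : 5 ≤ m)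
    (h0 : ∀ x ∈ Icc a b, ψ 0 x = ψ₀ x) :
    ∃ C δ : ℝ, 0 < C ∧ 0 < δ ∧ ∀ (M : ℕ) (τ : ℝ), 0 < M → 0 < τ → τ ≤ 1 →
      τ ^ 2 + (M : ℝ) ^ 1 / M ^ m ≤ δ → ∀ n : ℕ, n * τ ≤ T → ∀ i ≤ 1,
        SobLE i (fun k => oddCoeff a b (ψ (n * τ)) k -
          trunc M (gridCoeff M (tssp a b V β ψ₀ M τ n)) k) (C * (τ ^ 2 + (M : ℝ) ^ i / M ^ m)) := by
  obtain ⟨A, hA0, hA⟩ := h.famBdd hT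
  have h0T : (0 : ℝ) ∈ Icc 0 T := left_mem_Icc.2 h.nonneg
  obtain ⟨C, δ, hC, hδ, hconv⟩ := fourier_convergence (κ := freqUnit a b ^ 2 / 2) (T := T) (β := β)
    (c := fun t => oddCoeff a b (ψ t)) (by positivity) hm h.nonneg h.pot_sob h.pot_real hA
    h.coeff_continuousOn (fun k t ht => by
      refine (h.coeff_hasDerivAt ht k).congr_deriv ?_
      have ht' := Ioo_subset_Icc_self ht
      rw [h.nls_coeff ht' (show 1 ≤ m by omega) le_rfl (hA t ht')]
      unfold dsymb
      push_cast
      rw [mul_pow, mul_pow, Complex.I_sq]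
      ring)
  -- `C` accounts for the error of the scheme against the truncated solution and `A` for the
  -- truncated tail.
  refine ⟨C + A, δ, by positivity, hδ, fun M τ hM hτ hτ1 hδM n hn i hi => ?_⟩
  have hMr : (0 : ℝ) < M := by exact_mod_cast hM
  have hnT : n * τ ∈ Icc 0 T := ⟨by positivity, hn⟩
  have h1 := hconv M τ (fun n => trunc M (gridCoeff M (tssp a b V β ψ₀ M τ n))) hM hτ hτ1 hδM
    (gridCoeff_initial h ((hA 0 h0T).summable_norm (by omega)) h0 hM τ)
    (fun n => (gridCoeff_step h.lt hM h.pot_even h.pot_eq τ _).2) n hn i hi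
  have h2 := (hA (n * τ) hnT).sub_trunc (i := i) (by omega) hM
  refine ((h2.add h1).of_norm_le fun k => le_of_eq ?_).mono ?_
  · simp only [sub_add_sub_cancel]
  · have : 0 ≤ A * τ ^ 2 := by positivity
    linarith

theorem normalized_mesh (hab : a < b) {M : ℕ} (hM : 0 < M) {i m : ℕ} (hi : i ≤ m) :
    (M : ℝ) ^ i / M ^ m = ((b - a)⁻¹) ^ (m - i) * mesh a b M ^ (m - i) := by
  have hMr : (M : ℝ) ≠ 0 := by exact_mod_cast hM.ne'
  have hba : b - a ≠ 0 := (sub_pos.2 hab).ne'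
  obtain ⟨p, rfl⟩ : ∃ p, m = i + p := ⟨m - i, by omega⟩
  unfold mesh
  rw [Nat.add_sub_cancel_left, ← mul_pow, pow_add,
    show (b - a)⁻¹ * ((b - a) / M) = (M : ℝ)⁻¹ by field_simp, inv_pow]
  field_simp

/-- After at least one step the grid values come from a kinetic half step, so they are values of a
sine polynomial and interpolation reproduces them. -/
theorem tssp_grid_eq (h : GPECurve a b T β m V v Bv B ψ D) {M : ℕ} (hM : 0 < M) (τ : ℝ) (n : ℕ)
    (j : Fin (M + 1)) : tssp a b V β ψ₀ M τ (n + 1) j =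
      fser (trunc M (gridCoeff M (tssp a b V β ψ₀ M τ (n + 1)))) ((j : ℕ) * gstep M) := by
  have := gridCoeff_step h.lt hM h.pot_even h.pot_eq (β := β) τ (tssp a b V β ψ₀ M τ n)
  exact (this.1 j).trans (by rw [← this.2]; rfl)

end main

theorem mainTheorem5 (a b : ℝ) (hab : a < b) (T : ℝ) (hT : 0 < T) (β : ℝ) (m : ℕ) (hm : 5 ≤ m)
    (V : ℝ → ℝ) (hVc : ContinuousOn V (Icc a b))
    (hV : MemH a b m (fun x => (V x : ℂ)))
    (hV' : ∃ W : ℝ → ℂ, HasWeakDeriv a b 1 (fun x => (V x : ℂ)) W ∧ MemHsin a b (m - 1) W)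
    (ψ₀ : ℝ → ℂ) (ψ : ℝ → ℝ → ℂ)
    (hψc : ∀ t ∈ Icc 0 T, ContinuousOn (ψ t) (Icc a b))
    (hψ : ContTimeH a b T m ψ)
    (hsol : IsGPESolution a b T V β ψ₀ ψ) :
    ∃ M₁ : ℝ, 0 ≤ M₁ ∧
      IsGreatest ((fun t => normLinf a b (ψ t)) '' Icc 0 T) (ENNReal.ofReal M₁) ∧
      ∃ τ₀ h₀ C : ℝ, 0 < τ₀ ∧ τ₀ ≤ 1 ∧ 0 < h₀ ∧ h₀ ≤ 1 ∧ 0 < C ∧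
        ∀ (M : ℕ) (τ : ℝ), 0 < M → Even M → mesh a b M ≤ h₀ → 0 < τ → τ ≤ τ₀ →
          ∀ n : ℕ, (n : ℝ) ≤ T / τ →
            normL2 a b (fun x => ψ (n * τ) x - sineInterp a b M (tssp a b V β ψ₀ M τ n) x)
                ≤ ENNReal.ofReal (C * (mesh a b M ^ m + τ ^ 2)) ∧
            semiH a b 1 (fun x => ψ (n * τ) x - sineInterp a b M (tssp a b V β ψ₀ M τ n) x)
                ≤ ENNReal.ofReal (C * (mesh a b M ^ (m - 1) + τ ^ 2)) ∧
            ∀ j, ‖tssp a b V β ψ₀ M τ n j‖ ≤ M₁ + 1 := by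
  obtain ⟨M₁, hM₁, hgr, hle⟩ := hψ.exists_isGreatest_normLinf hab hT.le (by omega) hψc
  obtain ⟨v, Bv, B, D, h⟩ := exists_gpeCurve hab hT.le (by omega) hVc hV hV' hψc hψ hsol
  obtain ⟨C, δ, hC, hδ, herr⟩ := exists_coeff_error h hT hm hsol.2.1
  obtain ⟨A, -, hA⟩ := h.famBdd hT
  have hba : 0 < b - a := sub_pos.2 hab
  have hθ := freqUnit_pos hab
  have hemb := embConst_nonneg
  obtain ⟨K, hK1, hK⟩ : ∃ K : ℝ, 1 ≤ K ∧ ∀ (M : ℕ) (τ : ℝ), 0 < M → ∀ i ≤ 1,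
      τ ^ 2 + (M : ℝ) ^ i / M ^ m ≤ K * (mesh a b M ^ (m - i) + τ ^ 2) := by
    -- Powers of `1/M` are powers of `h/(b - a)`; the sum covers both exponents `m` and `m - 1` and
    -- the coefficient `1` of `τ²`.
    refine ⟨1 + ((b - a)⁻¹) ^ m + ((b - a)⁻¹) ^ (m - 1), ?_, fun M τ hM i hi => ?_⟩
    · have h1 : 0 ≤ ((b - a)⁻¹) ^ m := by positivity
      have h2 : 0 ≤ ((b - a)⁻¹) ^ (m - 1) := by positivity
      linarith
    · rw [normalized_mesh hab hM (show i ≤ m by omega)]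
      have h1 : 0 ≤ ((b - a)⁻¹) ^ m := by positivity
      have h2 : 0 ≤ ((b - a)⁻¹) ^ (m - 1) := by positivity
      have h3 : ((b - a)⁻¹) ^ (m - i) ≤ 1 + ((b - a)⁻¹) ^ m + ((b - a)⁻¹) ^ (m - 1) := by
        interval_cases i
        · rw [Nat.sub_zero]; linarith
        · linarith
      have h4 : 0 ≤ mesh a b M ^ (m - i) := by
        have : 0 ≤ mesh a b M := by unfold mesh; positivity
        positivity
      have h5 := mul_le_mul_of_nonneg_right h3 h4
      have h6 : 0 ≤ (((b - a)⁻¹) ^ m + ((b - a)⁻¹) ^ (m - 1)) * τ ^ 2 := by positivity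
      linarith
  have hK0 : 0 < K := by linarith
  -- The bound `δ` makes the convergence result applicable; the other entry forces the embedding
  -- bound of the `H¹` error below `1`. With `h, τ ≤ 1` both powers are at most their bases, hence
  -- the thresholds `η / (2K)`.
  set η := min δ (1 / (embConst * C + 1)) with hη
  have hη0 : 0 < η := lt_min hδ (by positivity)
  have hr0 : 0 < min 1 (η / (2 * K)) := lt_min one_pos (by positivity)
  refine ⟨M₁, hM₁, hgr, min 1 (η / (2 * K)), min 1 (η / (2 * K)),
    √(2 * (b - a)) * ((1 + freqUnit a b) * (C * K)), hr0, min_le_left _ _, hr0, min_le_left _ _,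
    by positivity, fun M τ hM _ hh hτ hτ0 n hn => ?_⟩
  have hnT : n * τ ≤ T := (le_div_iff₀ hτ).1 hn
  have hmem : n * τ ∈ Icc 0 T := ⟨by positivity, hnT⟩
  have hmesh : 0 ≤ mesh a b M := by unfold mesh; positivity
  have hmesh1 : mesh a b M ≤ 1 := hh.trans (min_le_left _ _)
  have hτ1 : τ ≤ 1 := hτ0.trans (min_le_left _ _)
  have hsmall : τ ^ 2 + (M : ℝ) ^ 1 / M ^ m ≤ η := by
    refine (hK M τ hM 1 le_rfl).trans ?_
    have h1 : mesh a b M ^ (m - 1) ≤ mesh a b M := pow_le_of_le_one hmesh hmesh1 (by omega)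
    have h2 : τ ^ 2 ≤ τ := pow_le_of_le_one hτ.le hτ1 two_ne_zero
    have h3 := hh.trans (min_le_right _ _)
    have h4 := hτ0.trans (min_le_right _ _)
    calc K * (mesh a b M ^ (m - 1) + τ ^ 2) ≤ K * (η / (2 * K) + η / (2 * K)) := by
          gcongr
          · exact h1.trans h3
          · exact h2.trans h4
      _ = η := by field_simp; ring
  have he := herr M τ hM hτ hτ1 (hsmall.trans (min_le_left _ _)) n hnT
  set e : ℤ → ℂ := fun k => oddCoeff a b (ψ (n * τ)) k -
    trunc M (gridCoeff M (tssp a b V β ψ₀ M τ n)) k with hedef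
  have hcs := (hA (n * τ) hmem).summable_norm (show 1 ≤ m by omega)
  have hts := summable_norm_trunc M (gridCoeff M (tssp a b V β ψ₀ M τ n))
  have hrep : ∀ x ∈ Icc a b, ψ (n * τ) x = fser (oddCoeff a b (ψ (n * τ))) (freqUnit a b * (x - a)) :=
    fun x hx => eq_fser_oddCoeff hab (hψc _ hmem) hcs hx
  have hu : ∀ x ∈ Icc a b, ψ (n * τ) x - sineInterp a b M (tssp a b V β ψ₀ M τ n) x =
      fser e (freqUnit a b * (x - a)) := fun x hx => by
    rw [hedef, fser_sub hcs hts, ← hrep x hx, sineInterp_eq hM]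
  have he1 := (he 1 le_rfl).mono (mul_le_mul_of_nonneg_left (hK M τ hM 1 le_rfl) hC.le)
  have he0 := (he 0 (Nat.zero_le _)).mono (mul_le_mul_of_nonneg_left (hK M τ hM 0 (Nat.zero_le _)) hC.le)
  -- Any order 2 bound will do, even one depending on `M` and `n`, since it only licenses termwise
  -- differentiation of the error series.
  obtain ⟨A', hA'⟩ := exists_sobLE_trunc 2 M (gridCoeff M (tssp a b V β ψ₀ M τ n))
  have he2 := ((hA (n * τ) hmem).weaken (show 2 ≤ m by omega)).sub hA'
  refine ⟨(normL2_fser_le hab he1 he0 hu).trans (ENNReal.ofReal_le_ofReal ?_),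
    (semiH_one_fser_le hab he2 he1 hu).trans (ENNReal.ofReal_le_ofReal ?_), fun j => ?_⟩
  · rw [Nat.sub_zero, ← mul_assoc C K, mul_assoc (√(2 * (b - a)))]
    refine mul_le_mul_of_nonneg_left ?_ (Real.sqrt_nonneg _)
    refine mul_le_mul_of_nonneg_right ?_ (by positivity)
    exact le_mul_of_one_le_left (by positivity) (by linarith)
  · rw [← mul_assoc C K, ← mul_assoc (freqUnit a b), mul_assoc (√(2 * (b - a)))]
    refine mul_le_mul_of_nonneg_left ?_ (Real.sqrt_nonneg _)
    refine mul_le_mul_of_nonneg_right ?_ (by positivity)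
    exact mul_le_mul_of_nonneg_right (by linarith) (by positivity)
  · have hpt : ‖ψ (n * τ) (gridPt a b M j)‖ ≤ M₁ := hle _ hmem _ (gridPt_mem hab hM j)
    -- At `n = 0` the grid values are those of the exact initial value; afterwards the sine
    -- interpolant passes through them, and the sup bound on the error supplies the extra `1`.
    rcases n with _ | n
    · have e0 : tssp a b V β ψ₀ M τ 0 j = ψ 0 (gridPt a b M j) :=
        (hsol.2.1 _ (gridPt_mem hab hM j)).symm
      rw [e0]
      rw [Nat.cast_zero, zero_mul] at hpt
      linarith
    · have e1 := hu _ (gridPt_mem hab hM j)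
      rw [sineInterp_eq hM, freqUnit_mul_gridPt hab, ← tssp_grid_eq h hM] at e1
      have e2 : ‖fser e ((j : ℕ) * gstep M)‖ ≤ 1 := by
        refine ((he 1 le_rfl).norm_fser_le le_rfl _).trans ?_
        have h1 : C * (τ ^ 2 + (M : ℝ) ^ 1 / M ^ m) ≤ C * (1 / (embConst * C + 1)) :=
          mul_le_mul_of_nonneg_left (hsmall.trans (min_le_right _ _)) hC.le
        refine (mul_le_mul_of_nonneg_left h1 hemb).trans ?_
        rw [← mul_assoc, mul_one_div]
        exact div_le_one_of_le₀ (by linarith) (by positivity)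
      have e3 : tssp a b V β ψ₀ M τ (n + 1) j =
          ψ ((n + 1 : ℕ) * τ) (gridPt a b M j) - fser e ((j : ℕ) * gstep M) := by
        rw [← e1]; ring
      rw [e3]
      exact (norm_sub_le _ _).trans (add_le_add hpt e2)
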